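/- Let $a\ge 0$, $d>0$ and $0<k_1\le k_2$ be real numbers. There is a constant $C>0$ depending only on $a,d,k_1,k_2$ such that the following holds for all integers $n\ge 4$ and $p\ge 3$. Let $X_1,\dots,X_n$ be independent random vectors in $\mathbb{R}^p$ with finite second moments, each of which is centered ($\mathrm{E}[X_i]=0$) and has a log-concave law $\mu_i$, that is, $\mu_i(\lambda A_1+(1-\lambda)A_2)\ge \mu_i(A_1)^{\lambda}\mu_i(A_2)^{1-\lambda}$ for all compact $A_1,A_2\subset\mathbb{R}^p$ and all $\lambda\in(0,1)$. Suppose that for every $i$ all eigenvalues of the covariance matrix $\mathrm{E}[X_iX_i']$ lie in $[k_1,k_2]$. Let $Y_1,\dots,Y_n$ be independent with $Y_i\sim N(0,\mathrm{E}[X_iX_i'])$, and put $S_n^X=n^{-1/2}\sum_{i=1}^nX_i$ and $S_n^Y=n^{-1/2}\sum_{i=1}^nY_i$. Then $$\rho_n(\mathcal{A}^{\mathrm{si}}(a,d)):=\sup_{A\in\mathcal{A}^{\mathrm{si}}(a,d)}\bigl|\Pr(S_n^X\in A)-\Pr(S_n^Y\in A)\bigr|\le C\,n^{-1/6}\log^{7/6}(pn).$$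 Here $\mathcal{A}^{\mathrm{si}}(a,d)$ is the class of simple convex sets, defined as follows. For $A\subset\mathbb{R}^p$ and $v\in\mathbb{R}^p$ with $\|v\|=1$ let $\mathcal{S}_A(v)=\sup\{w'v: w\in A\}\in[-\infty,\infty]$. A set $A^m\subset\mathbb{R}^p$ is $m$-generated, with set of normals $\mathcal{V}$, if $\mathcal{V}$ is a set of at most $m$ unit vectors and $A^m=\bigcap_{v\in\mathcal{V}}\{w: w'v\le \mathcal{S}_{A^m}(v)\}$; put $A^{m,\epsilon}=\bigcap_{v\in\mathcal{V}}\{w: w'v\le \mathcal{S}_{A^m}(v)+\epsilon\}$. Then $\mathcal{A}^{\mathrm{si}}(a,d)$ is the class of all convex Borel sets $A\subset\mathbb{R}^p$ for which there are an integer $0\le m\le (pn)^d$ and an $m$-generated set $A^m$ (with some set of normals $\mathcal{V}$) such that $A^m\subset A\subset A^{m,a/n}$. -/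

import Mathlib

open MeasureTheory ProbabilityTheory
open scoped Pointwise RealInnerProductSpace

noncomputable section

/-- The normalized sum `n ^ (-1/2) * ∑ i, X i` of `n` random vectors. -/
def normalizedSum {n p : ℕ} {Ω : Type*} (X : Fin n → Ω → EuclideanSpace ℝ (Fin p)) (ω : Ω) :
    EuclideanSpace ℝ (Fin p) :=
  (Real.sqrt n)⁻¹ • ∑ i, X i ω

/-- The matrix `E[X X']`; it is the covariance matrix when `X` is centered. -/
def secondMomentMatrix {p : ℕ} {Ω : Type*} [MeasurableSpace Ω]
    (X : Ω → EuclideanSpace ℝ (Fin p)) (P : Measure Ω) : Matrix (Fin p) (Fin p) ℝ :=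
  Matrix.of fun j k => ∫ ω, X ω j * X ω k ∂P

/-- The supremum over `A` in the class `𝒜` of `|P(S ∈ A) - P'(T ∈ A)|`
(all the values lie in `[0, 1]` for probability measures). -/
def rhoDist {p : ℕ} {Ω Ω' : Type*} [MeasurableSpace Ω] [MeasurableSpace Ω']
    (P : Measure Ω) (S : Ω → EuclideanSpace ℝ (Fin p))
    (P' : Measure Ω') (T : Ω' → EuclideanSpace ℝ (Fin p))
    (𝒜 : Set (Set (EuclideanSpace ℝ (Fin p)))) : ℝ :=
  sSup ((fun A => |P.real (S ⁻¹' A) - P'.real (T ⁻¹' A)|) '' 𝒜)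

/-- Log-concavity of a Borel measure on `ℝᵖ`. -/
def IsLogConcaveMeasure {p : ℕ} (μ : Measure (EuclideanSpace ℝ (Fin p))) : Prop :=
  ∀ A₁ A₂ : Set (EuclideanSpace ℝ (Fin p)), IsCompact A₁ → IsCompact A₂ →
    ∀ t : ℝ, 0 < t → t < 1 → μ A₁ ^ t * μ A₂ ^ (1 - t) ≤ μ (t • A₁ + (1 - t) • A₂)

/-- The support function `v ↦ sup {w ⬝ v : w ∈ A}`, with extended real values. -/
def supportFun {p : ℕ} (A : Set (EuclideanSpace ℝ (Fin p))) (v : EuclideanSpace ℝ (Fin p)) :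
    EReal :=
  ⨆ w ∈ A, ((⟪w, v⟫ : ℝ) : EReal)

/-- The polytope `A` relaxed by `ε` along the normals in `V`:
the set of `w` with `w ⬝ v ≤ supportFun A v + ε` for all `v ∈ V`. -/
def enlargePolytope {p : ℕ} (A : Set (EuclideanSpace ℝ (Fin p)))
    (V : Finset (EuclideanSpace ℝ (Fin p))) (ε : ℝ) : Set (EuclideanSpace ℝ (Fin p)) :=
  ⋂ v ∈ V, {w | ((⟪w, v⟫ : ℝ) : EReal) ≤ supportFun A v + (ε : EReal)}

/-- `A` is an intersection of at most `m` closed half-spaces, with outward unit normals the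
elements of `V`. -/
structure IsGenerated {p : ℕ} (m : ℕ) (A : Set (EuclideanSpace ℝ (Fin p)))
    (V : Finset (EuclideanSpace ℝ (Fin p))) : Prop where
  card_le : V.card ≤ m
  norm_eq_one : ∀ v ∈ V, ‖v‖ = 1
  eq_iInter : A = ⋂ v ∈ V, {w | ((⟪w, v⟫ : ℝ) : EReal) ≤ supportFun A v}

/-- `A` admits an approximation with precision `ε` by an `m`-generated convex set `Am`
with set of normals `V`: `Am ⊆ A ⊆ Am^ε`. -/
def AdmitsApprox {p : ℕ} (A : Set (EuclideanSpace ℝ (Fin p))) (ε : ℝ) (m : ℕ) : Prop :=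
  ∃ (Am : Set (EuclideanSpace ℝ (Fin p))) (V : Finset (EuclideanSpace ℝ (Fin p))),
    IsGenerated m Am V ∧ Am ⊆ A ∧ A ⊆ enlargePolytope Am V ε

/-- The class of simple convex sets with parameters `a`, `d` (and `n`) in `ℝᵖ`. -/
def simpleConvexSets (n p : ℕ) (a d : ℝ) : Set (Set (EuclideanSpace ℝ (Fin p))) :=
  {A | MeasurableSet A ∧ Convex ℝ A ∧
    ∃ m : ℕ, (m : ℝ) ≤ ((p : ℝ) * (n : ℝ)) ^ d ∧ AdmitsApprox A (a / n) m}

end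

/-! ### Mass of short windows under the standard normal law on the line. -/

section OneDim

open scoped ENNReal

/-! Write `L = log (pn)`. Apart from the empty set and the whole space, a simple convex set lies
between two parallel polyhedra with at most `(pn)^d` facets and offsets differing by `a / n`
(`AdmitsApprox.exists_polyhedron`). So it suffices to compare the two sums on polyhedra, uniformly
in the offsets `b`, and to know that the Gaussian mass of a shell of width `ε` between parallel
polyhedra is of order `√L * ε`. The latter is Nazarov's inequality,
`gaussian_polyhedron_anticoncentration`.

The comparison is Lindeberg's replacement of one summand at a time, for the test function `g (κ *
logSumExp (β (⟪v j, x⟫ - b j)))` with `κ = 1 / L` and `β = φ L`. This smooths the indicator of the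
polyhedron at scale `1 / φ`. Derivatives of log-sum-exp are cumulants under softmax weights, which
sum to one. So the third order remainder costs `κ β ^ 3` times a third moment of a single
projection, without a factor `m`, and it is supported where the smoothed slack lies in a bounded
window (`IsSmoothStep.abs_sub_taylor_le`).

The replaced summand is independent of the rest and small with probability at least one half, so the
probability of the window is at most twice that of a shell for a hybrid sum
(`measureReal_window_le`). That is at most a Gaussian shell plus `2ρ`, where `ρ` is the largest
discrepancy over all hybrids and all offsets. Up to constants and a tail term, the `n` steps give `ρ
≤ √L / φ + n ^ (-1/2) φ ^ 3 L ^ 2 (√L / φ + ρ)`. With `φ` a small multiple of `n ^ (1/6) L ^ (-2/3)`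
the coefficient of `ρ` is at most `1/2`, so `ρ` is absorbed and the rate is `√L / φ`, of order `n ^
(-1/6) L ^ (7/6)`.

Log-concavity enters only through Borell's lemma (`IsLogConcaveMeasure.measure_lt_abs_inner_le`):
projections have exponential moments controlled by their variance. These bound the third moments and
make summands beyond scale `1 / β` negligible even after summing over `m` facets and `n` steps. If
`n` is at most a multiple of `L ^ 7`, the claimed bound exceeds one. -/

theorem gaussianPDF_shift_le {u t s : ℝ} (hu : 0 ≤ u) (ht : t ≤ u + 1) (hs : 0 ≤ s)
    (hs' : s ≤ 1 / (u + 1)) :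
    gaussianPDF 0 1 t ≤ ENNReal.ofReal (Real.exp 2) * gaussianPDF 0 1 (t + s) := by
  rw [gaussianPDF, gaussianPDF, ← ENNReal.ofReal_mul (Real.exp_pos _).le]
  apply ENNReal.ofReal_le_ofReal
  simp only [gaussianPDFReal_def]
  rw [mul_left_comm, ← Real.exp_add]
  gcongr
  -- The exponents differ by `s * t + s ^ 2 / 2`, which is at most `1 + 1 / 2`.
  have h1 : s * (u + 1) ≤ 1 := by rwa [le_div_iff₀ (by positivity)] at hs'
  have h2 : s * t ≤ s * (u + 1) := by gcongr
  have h3 : s ≤ 1 := by nlinarith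
  simp only [sub_zero, NNReal.coe_one]
  nlinarith

/-- The part of an upper set in a window of width `ε` carries at most a fraction of order
`(u + 1) * ε` of the Gaussian mass of the upper set above the start of the window. -/
theorem gaussianReal_window_le {I : Set ℝ} (hI : IsUpperSet I) (hIm : MeasurableSet I)
    {b u ε : ℝ} (hu : 0 ≤ u) (hb : b ≤ u) (hε1 : ε ≤ 1) :
    gaussianReal 0 1 (I ∩ Set.Ioc b (b + ε)) ≤
      ENNReal.ofReal (Real.exp 2 * (u + 1) * ε) * gaussianReal 0 1 (I ∩ Set.Ioi b) := by
  set S := I ∩ Set.Ioc b (b + ε) with hS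
  set T := I ∩ Set.Ioi b with hT
  have hSm : MeasurableSet S := hIm.inter measurableSet_Ioc
  have hTm : MeasurableSet T := hIm.inter measurableSet_Ioi
  set δ : ℝ := 1 / (u + 1) with hδ
  have hδ0 : 0 < δ := by positivity
  set φ : ℝ → ℝ≥0∞ := gaussianPDF 0 1 with hφ
  have hφm : Measurable φ := measurable_gaussianPDF 0 1
  -- Pushing `S` to the right by `s ≤ δ` keeps it inside `T`, as `I` is an upper set, and lowers the
  -- density by a factor of at most `e ^ 2`. Averaging over `s` and swapping the integrals, each `x
  -- ∈ T` is reached only for `s` in an interval of length `ε`. Hence `δ * γ(S) ≤ e ^ 2 * ε * γ(T)`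
  -- for the standard normal law `γ`, and `1 / δ = u + 1`.
  have key : ∀ s ∈ Set.Icc 0 δ, gaussianReal 0 1 S ≤
      ENNReal.ofReal (Real.exp 2) * ∫⁻ x, S.indicator 1 (x - s) * φ x := by
    intro s hs
    rw [gaussianReal_apply 0 one_ne_zero, ← lintegral_indicator hSm,
      ← lintegral_add_right_eq_self (fun x => S.indicator 1 (x - s) * φ x) s,
      ← lintegral_const_mul' _ _ ENNReal.ofReal_ne_top]
    apply lintegral_mono
    intro t
    by_cases h : t ∈ S
    · simpa [h] using gaussianPDF_shift_le hu (by linarith [h.2.2]) hs.1 hs.2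
    · simp [h]
  have h1 : ENNReal.ofReal δ * gaussianReal 0 1 S ≤
      ENNReal.ofReal (Real.exp 2) *
        ∫⁻ s in Set.Icc 0 δ, ∫⁻ x, S.indicator 1 (x - s) * φ x := by
    rw [← lintegral_const_mul' _ _ ENNReal.ofReal_ne_top]
    calc ENNReal.ofReal δ * gaussianReal 0 1 S
        = ∫⁻ s in Set.Icc 0 δ, gaussianReal 0 1 S := by
          rw [setLIntegral_const, Real.volume_Icc, sub_zero, mul_comm]
      _ ≤ _ := setLIntegral_mono' measurableSet_Icc key
  have hmeas : Measurable (Function.uncurry fun s x : ℝ =>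
      S.indicator (1 : ℝ → ℝ≥0∞) (x - s) * φ x) :=
    (((measurable_const.indicator hSm).comp (measurable_snd.sub measurable_fst)).mul
      (hφm.comp measurable_snd))
  have h2 : ∫⁻ s in Set.Icc 0 δ, ∫⁻ x, S.indicator 1 (x - s) * φ x ≤
      ENNReal.ofReal ε * gaussianReal 0 1 T := by
    rw [lintegral_lintegral_swap hmeas.aemeasurable, gaussianReal_apply 0 one_ne_zero,
      ← lintegral_indicator hTm, ← lintegral_const_mul' _ _ ENNReal.ofReal_ne_top]
    apply lintegral_mono
    intro x
    dsimp only
    by_cases hx : x ∈ T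
    · rw [Set.indicator_of_mem hx]
      have : ∫⁻ s in Set.Icc 0 δ, S.indicator 1 (x - s) * φ x ≤
          ∫⁻ s, (Set.Ico (x - b - ε) (x - b)).indicator (fun _ => φ x) s := by
        refine (setLIntegral_le_lintegral _ _).trans (lintegral_mono fun s => ?_)
        by_cases h : x - s ∈ S
        · have : s ∈ Set.Ico (x - b - ε) (x - b) :=
            ⟨by linarith [h.2.2], by linarith [h.2.1]⟩
          simp [h, this]
        · simp [h]
      refine this.trans ?_
      rw [lintegral_indicator measurableSet_Ico, setLIntegral_const, Real.volume_Ico, mul_comm]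
      ring_nf
      exact le_rfl
    · rw [Set.indicator_of_notMem hx, mul_zero, nonpos_iff_eq_zero]
      rw [setLIntegral_congr_fun (g := fun _ => 0) measurableSet_Icc, lintegral_zero]
      intro s hs
      have : x - s ∉ S := fun h => hx ⟨hI (by linarith [hs.1]) h.1,
        by have := h.2.1; have := hs.1; simp only [Set.mem_Ioi]; linarith⟩
      simp [this]
  have h3 := h1.trans (mul_le_mul_right h2 (ENNReal.ofReal (Real.exp 2)))
  have h4 : ENNReal.ofReal (u + 1) * ENNReal.ofReal δ = 1 := by
    rw [← ENNReal.ofReal_mul (by positivity), hδ, mul_one_div_cancel (by positivity),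
      ENNReal.ofReal_one]
  calc gaussianReal 0 1 S = ENNReal.ofReal (u + 1) * (ENNReal.ofReal δ * gaussianReal 0 1 S) := by
        rw [← mul_assoc, h4, one_mul]
    _ ≤ ENNReal.ofReal (u + 1) * (ENNReal.ofReal (Real.exp 2) *
          (ENNReal.ofReal ε * gaussianReal 0 1 T)) := mul_le_mul_right h3 _
    _ = _ := by
        rw [ENNReal.ofReal_mul (by positivity), ENNReal.ofReal_mul (by positivity)]
        ring

theorem gaussianReal_Ioc_le {b u ε : ℝ} (hu : 0 ≤ u) (hb : u ≤ b) :
    gaussianReal 0 1 (Set.Ioc b (b + ε)) ≤ ENNReal.ofReal (Real.exp (-u ^ 2 / 2) * ε) := by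
  rw [gaussianReal_apply 0 one_ne_zero, ENNReal.ofReal_mul (Real.exp_pos _).le]
  calc ∫⁻ x in Set.Ioc b (b + ε), gaussianPDF 0 1 x
      ≤ ∫⁻ x in Set.Ioc b (b + ε), ENNReal.ofReal (Real.exp (-u ^ 2 / 2)) := by
        refine setLIntegral_mono' measurableSet_Ioc fun x hx => ?_
        apply ENNReal.ofReal_le_ofReal
        rw [gaussianPDFReal_def]
        simp only [NNReal.coe_one, mul_one, sub_zero]
        have h1 : Real.exp (-x ^ 2 / 2) ≤ Real.exp (-u ^ 2 / 2) := by
          gcongr; exact hb.trans hx.1.le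
        have h2 : (√(2 * Real.pi))⁻¹ ≤ 1 := by
          apply inv_le_one_of_one_le₀
          rw [Real.one_le_sqrt]
          nlinarith [Real.pi_gt_three]
        calc _ ≤ 1 * Real.exp (-u ^ 2 / 2) := by gcongr
          _ = _ := one_mul _
    _ = _ := by rw [setLIntegral_const, Real.volume_Ioc]; congr 2; ring

end OneDim

/-! ### Gaussian anticoncentration for polyhedra. -/

section Split

variable {E : Type*} [NormedAddCommGroup E] [InnerProductSpace ℝ E] [FiniteDimensional ℝ E]
  [MeasurableSpace E] [BorelSpace E]

theorem inner_covarianceOperator_right {G : Measure E} [IsGaussian G] (y z : E) :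
    ⟪y, covarianceOperator G z⟫ = ∫ x, ⟪z, x⟫ * ⟪y, x⟫ ∂G := by
  rw [real_inner_comm, covarianceOperator_inner IsGaussian.memLp_two_id]

theorem memLp_inner {G : Measure E} [IsGaussian G] (y : E) :
    MemLp (fun x => ⟪y, x⟫) 2 G :=
  (IsGaussian.memLp_two_id (μ := G)).continuousLinearMap_comp (innerSL ℝ y)

/-- Under a centered Gaussian measure, `x` splits into independent parts `x - ⟪w, x⟫ h` and
`⟪w, x⟫` where `h` is the image of `w` under the covariance operator. -/
theorem indepFun_sub_smul_covarianceOperator {G : Measure E} [IsGaussian G]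
    (hG : ∀ y : E, ∫ x, ⟪y, x⟫ ∂G = 0) {w : E} (hw : ∫ x, ⟪w, x⟫ ^ 2 ∂G = 1) :
    IndepFun (fun x => x - ⟪w, x⟫ • covarianceOperator G w) (fun x => ⟪w, x⟫) G := by
  have h1 : HasGaussianLaw (fun x => (x - ⟪w, x⟫ • covarianceOperator G w, ⟪w, x⟫)) G :=
    (IsGaussian.hasGaussianLaw_id (μ := G)).map
      ((ContinuousLinearMap.id ℝ E - (innerSL ℝ w).smulRight (covarianceOperator G w)).prod
        (innerSL ℝ w))
  refine h1.indepFun_of_covariance_inner fun y r => ?_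
  have e1 : (fun x => ⟪y, x - ⟪w, x⟫ • covarianceOperator G w⟫) =
      fun x => ⟪y - ⟪y, covarianceOperator G w⟫ • w, x⟫ := by
    ext x; simp only [inner_sub_right, inner_sub_left, inner_smul_right, real_inner_smul_left]; ring
  have e2 : (fun x => ⟪r, ⟪w, x⟫⟫) = fun x => ⟪r • w, x⟫ := by
    ext x; rw [real_inner_smul_left]; simp [mul_comm]
  have e3 : ⟪w, covarianceOperator G w⟫ = 1 := by
    rw [inner_covarianceOperator_right, ← hw]; simp_rw [pow_two]
  have e4 : ⟪w, covarianceOperator G y⟫ = ⟪y, covarianceOperator G w⟫ := by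
    rw [inner_covarianceOperator_right, inner_covarianceOperator_right]
    simp_rw [mul_comm]
  rw [e1, e2, covariance, hG, hG]
  simp only [sub_zero]
  rw [← inner_covarianceOperator_right, map_sub, map_smul, real_inner_smul_left, inner_sub_right,
    inner_smul_right, e3, e4]
  ring

omit [FiniteDimensional ℝ E] in
theorem map_inner_eq_gaussianReal {G : Measure E} [IsGaussian G]
    (hG : ∀ y : E, ∫ x, ⟪y, x⟫ ∂G = 0) (w : E) :
    G.map (fun x => ⟪w, x⟫) = gaussianReal 0 (∫ x, ⟪w, x⟫ ^ 2 ∂G).toNNReal := by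
  have h : HasGaussianLaw (fun x => ⟪w, x⟫) G :=
    (IsGaussian.hasGaussianLaw_id (μ := G)).map (innerSL ℝ w)
  rw [h.map_eq_gaussianReal, hG, variance_of_integral_eq_zero h.aemeasurable (hG w)]

/-- Conditioning on the residual, which is independent of the standard normal variable `⟪w, x⟫`,
turns a Gaussian probability into an average over parallel lines. -/
theorem measure_inter_inner_mem_eq_lintegral {G : Measure E} [IsGaussian G]
    (hG : ∀ y : E, ∫ x, ⟪y, x⟫ ∂G = 0) {w : E} (hw : ∫ x, ⟪w, x⟫ ^ 2 ∂G = 1)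
    {R : Set E} (hR : MeasurableSet R) {B : Set ℝ} (hB : MeasurableSet B) :
    G (R ∩ {x | ⟪w, x⟫ ∈ B}) = ∫⁻ y, gaussianReal 0 1
      ({t | y + t • covarianceOperator G w ∈ R} ∩ B)
        ∂(G.map fun x => x - ⟪w, x⟫ • covarianceOperator G w) := by
  have hi := indepFun_sub_smul_covarianceOperator hG hw
  rw [indepFun_iff_map_prod_eq_prod_map_map (by fun_prop) (by fun_prop)] at hi
  have hmap := map_inner_eq_gaussianReal hG w
  rw [hw, Real.toNNReal_one] at hmap
  rw [hmap] at hi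
  set S' : Set (E × ℝ) := {q | q.1 + q.2 • covarianceOperator G w ∈ R ∧ q.2 ∈ B} with hS'
  have hS'm : MeasurableSet S' := by
    refine MeasurableSet.inter ?_ (measurable_snd hB)
    exact (by fun_prop : Measurable fun q : E × ℝ => q.1 + q.2 • covarianceOperator G w) hR
  have e : R ∩ {x | ⟪w, x⟫ ∈ B} =
      (fun x => (x - ⟪w, x⟫ • covarianceOperator G w, ⟪w, x⟫)) ⁻¹' S' := by
    ext x; simp [hS']
  rw [e, ← Measure.map_apply (by fun_prop) hS'm, hi, Measure.prod_apply hS'm]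
  rfl

/-- `hRs` says that the section of `R` by each line in the covariance direction is an upper set, so
the one-dimensional window bound holds on every line. -/
theorem gaussian_window_le {G : Measure E} [IsGaussian G]
    (hG : ∀ y : E, ∫ x, ⟪y, x⟫ ∂G = 0) {w : E} (hw : ∫ x, ⟪w, x⟫ ^ 2 ∂G = 1)
    {R : Set E} (hR : MeasurableSet R)
    (hRs : ∀ x ∈ R, ∀ s : ℝ, 0 ≤ s → x + s • covarianceOperator G w ∈ R)
    {b u ε : ℝ} (hu : 0 ≤ u) (hb : b ≤ u) (hε1 : ε ≤ 1) :
    G (R ∩ {x | ⟪w, x⟫ ∈ Set.Ioc b (b + ε)}) ≤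
      ENNReal.ofReal (Real.exp 2 * (u + 1) * ε) * G (R ∩ {x | ⟪w, x⟫ ∈ Set.Ioi b}) := by
  rw [measure_inter_inner_mem_eq_lintegral hG hw hR measurableSet_Ioc,
    measure_inter_inner_mem_eq_lintegral hG hw hR measurableSet_Ioi,
    ← lintegral_const_mul' _ _ ENNReal.ofReal_ne_top]
  refine lintegral_mono fun y => gaussianReal_window_le (fun t t' htt' ht => ?_) ?_ hu hb hε1
  · have := hRs _ ht (t' - t) (by linarith)
    rwa [add_assoc, ← add_smul, add_sub_cancel] at this
  · exact (by fun_prop : Measurable fun t : ℝ => y + t • covarianceOperator G w) hR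

theorem inner_covarianceOperator_le_one {G : Measure E} [IsGaussian G] {w z : E}
    (hw : ∫ x, ⟪w, x⟫ ^ 2 ∂G = 1) (hz : ∫ x, ⟪z, x⟫ ^ 2 ∂G = 1) :
    ⟪z, covarianceOperator G w⟫ ≤ 1 := by
  rw [inner_covarianceOperator_right]
  have i1 := (memLp_inner (G := G) w).integrable_sq
  have i2 := (memLp_inner (G := G) z).integrable_sq
  have : ∫ x, ⟪w, x⟫ * ⟪z, x⟫ ∂G ≤ ∫ x, (⟪w, x⟫ ^ 2 + ⟪z, x⟫ ^ 2) / 2 ∂G := by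
    refine integral_mono ((memLp_inner w).integrable_mul (memLp_inner z)) ((i1.add i2).div_const 2)
      fun x => ?_
    dsimp only
    nlinarith [sq_nonneg (⟪w, x⟫ - ⟪z, x⟫)]
  rw [integral_div, integral_add i1 i2, hw, hz] at this
  linarith

/-- The points where `j` is the least index maximizing `⟪w k, x⟫ - b k`. -/
def argmaxRegion {m : ℕ} (w : Fin m → E) (b : Fin m → ℝ) (j : Fin m) : Set E :=
  {x | ∀ k, ⟪w k, x⟫ - b k ≤ ⟪w j, x⟫ - b j ∧ (k < j → ⟪w k, x⟫ - b k < ⟪w j, x⟫ - b j)}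

omit [FiniteDimensional ℝ E] in
theorem measurableSet_argmaxRegion {m : ℕ} (w : Fin m → E) (b : Fin m → ℝ) (j : Fin m) :
    MeasurableSet (argmaxRegion w b j) := by
  unfold argmaxRegion
  simp only [Set.ofPred_forall, Set.ofPred_and]
  refine MeasurableSet.iInter fun k => (measurableSet_le (by fun_prop) (by fun_prop)).inter ?_
  exact MeasurableSet.iInter fun _ => measurableSet_lt (by fun_prop) (by fun_prop)

omit [FiniteDimensional ℝ E] [MeasurableSpace E] [BorelSpace E] in
theorem disjoint_argmaxRegion {m : ℕ} (w : Fin m → E) (b : Fin m → ℝ) {i j : Fin m}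
    (hij : i ≠ j) : Disjoint (argmaxRegion w b i) (argmaxRegion w b j) := by
  rw [Set.disjoint_left]
  intro x hi hj
  rcases lt_or_gt_of_ne hij with h | h
  · exact absurd ((hj i).2 h) (not_lt.2 (hi j).1)
  · exact absurd ((hi j).2 h) (not_lt.2 (hj i).1)

omit [FiniteDimensional ℝ E] [MeasurableSpace E] [BorelSpace E] in
theorem exists_mem_argmaxRegion {m : ℕ} [NeZero m] (w : Fin m → E) (b : Fin m → ℝ) (x : E) :
    ∃ j, x ∈ argmaxRegion w b j := by
  classical
  set M := Finset.univ.filter fun j : Fin m => ∀ k, ⟪w k, x⟫ - b k ≤ ⟪w j, x⟫ - b j with hM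
  have hne : M.Nonempty := by
    obtain ⟨j, -, hj⟩ := Finset.exists_max_image (Finset.univ : Finset (Fin m))
      (fun k => ⟪w k, x⟫ - b k) Finset.univ_nonempty
    exact ⟨j, by simp [hM]; exact fun k => by simpa using hj k (Finset.mem_univ k)⟩
  have hj := (Finset.mem_filter.1 (M.min'_mem hne)).2
  refine ⟨M.min' hne, fun k => ⟨hj k, fun hk => lt_of_le_of_ne (hj k) fun h => ?_⟩⟩
  refine absurd (M.min'_le k ?_) (not_le.2 hk)
  exact Finset.mem_filter.2 ⟨Finset.mem_univ _, fun l => (hj l).trans h.ge⟩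

/-- The shell is cut according to which constraint is most exceeded. On the `j`-th piece it becomes
a window for `⟪w j, x⟫`, costing `(u + 1) * ε` times the mass of the piece; the pieces are disjoint,
so these costs do not accumulate with `m`. -/
theorem gaussian_anticoncentration_of_variance_one {G : Measure E} [IsGaussian G]
    (hG : ∀ y : E, ∫ x, ⟪y, x⟫ ∂G = 0) {m : ℕ} [NeZero m] {w : Fin m → E}
    (hw : ∀ j, ∫ x, ⟪w j, x⟫ ^ 2 ∂G = 1) (b : Fin m → ℝ) {ε : ℝ} (hε : 0 ≤ ε) (hε1 : ε ≤ 1) :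
    G {x | (∃ j, b j < ⟪w j, x⟫) ∧ ∀ j, ⟪w j, x⟫ ≤ b j + ε} ≤
      ENNReal.ofReal (ε * (Real.exp 2 * (√(2 * Real.log m) + 1) + 1)) := by
  -- This threshold satisfies `exp (-u ^ 2 / 2) = 1 / m`: the windows starting beyond `u` have mass
  -- at most `ε / m` each, hence at most `ε` together.
  set u := √(2 * Real.log m) with hu
  have hm : (1 : ℝ) ≤ m := by exact_mod_cast NeZero.one_le
  have hu2 : Real.exp (-u ^ 2 / 2) = (m : ℝ)⁻¹ := by
    rw [hu, Real.sq_sqrt (by have := Real.log_nonneg hm; positivity), neg_div,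
      mul_div_cancel_left₀ _ two_ne_zero, Real.exp_neg, Real.exp_log (by positivity)]
  set R := argmaxRegion w b with hR
  -- Along this direction `⟪w j, x⟫` grows with slope one and every `⟪w k, x⟫` with slope a
  -- correlation, at most one, so `j` remains the maximizer.
  have hRs : ∀ j, ∀ x ∈ R j, ∀ s : ℝ, 0 ≤ s → x + s • covarianceOperator G (w j) ∈ R j := by
    intro j x hx s hs k
    have h1 : ⟪w j, covarianceOperator G (w j)⟫ = 1 := by
      rw [inner_covarianceOperator_right, ← hw j]; simp_rw [pow_two]
    have h2 := mul_le_mul_of_nonneg_left (inner_covarianceOperator_le_one (hw j) (hw k)) hs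
    simp only [inner_add_right, inner_smul_right, h1]
    exact ⟨by linarith [(hx k).1], fun hk => by linarith [(hx k).2 hk]⟩
  have hsub : {x | (∃ j, b j < ⟪w j, x⟫) ∧ ∀ j, ⟪w j, x⟫ ≤ b j + ε} ⊆
      ⋃ j, R j ∩ {x | ⟪w j, x⟫ ∈ Set.Ioc (b j) (b j + ε)} := by
    rintro x ⟨⟨i, hi⟩, hx⟩
    obtain ⟨j, hj⟩ := exists_mem_argmaxRegion w b x
    exact Set.mem_iUnion.2 ⟨j, hj, by have := (hj i).1; constructor <;> linarith [hx j]⟩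
  have hterm : ∀ j, G (R j ∩ {x | ⟪w j, x⟫ ∈ Set.Ioc (b j) (b j + ε)}) ≤
      ENNReal.ofReal (Real.exp 2 * (u + 1) * ε) * G (R j) + ENNReal.ofReal ((m : ℝ)⁻¹ * ε) := by
    intro j
    rcases le_total (b j) u with h | h
    · refine (gaussian_window_le hG (hw j) (measurableSet_argmaxRegion w b j) (hRs j)
        (Real.sqrt_nonneg _) h hε1).trans (le_add_right ?_)
      gcongr
      exact Set.inter_subset_left
    · refine le_trans ?_ le_add_self
      have := gaussianReal_Ioc_le (ε := ε) (Real.sqrt_nonneg _) h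
      rw [hu2] at this
      refine le_trans ?_ this
      have hmap := map_inner_eq_gaussianReal hG (w j)
      rw [hw, Real.toNNReal_one] at hmap
      rw [← hmap, Measure.map_apply (by fun_prop) measurableSet_Ioc]
      exact measure_mono Set.inter_subset_right
  calc _ ≤ G (⋃ j, R j ∩ {x | ⟪w j, x⟫ ∈ Set.Ioc (b j) (b j + ε)}) := measure_mono hsub
    _ ≤ ∑ j, G (R j ∩ {x | ⟪w j, x⟫ ∈ Set.Ioc (b j) (b j + ε)}) := measure_iUnion_fintype_le _ _
    _ ≤ ∑ j, (ENNReal.ofReal (Real.exp 2 * (u + 1) * ε) * G (R j) +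
          ENNReal.ofReal ((m : ℝ)⁻¹ * ε)) := Finset.sum_le_sum fun j _ => hterm j
    _ = ENNReal.ofReal (Real.exp 2 * (u + 1) * ε) * G (⋃ j, R j) + ENNReal.ofReal ε := by
        rw [Finset.sum_add_distrib, ← Finset.mul_sum, measure_iUnion
          (fun i j hij => disjoint_argmaxRegion w b hij)
          (fun j => measurableSet_argmaxRegion w b j), tsum_fintype]
        congr 1
        rw [Finset.sum_const, Finset.card_univ, Fintype.card_fin, ← ENNReal.ofReal_nsmul,
          nsmul_eq_mul, mul_inv_cancel_left₀ (by positivity)]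
    _ ≤ ENNReal.ofReal (Real.exp 2 * (u + 1) * ε) * 1 + ENNReal.ofReal ε := by
        gcongr; exact prob_le_one
    _ = _ := by
        rw [mul_one, ← ENNReal.ofReal_add (by positivity) hε]
        congr 1; ring

/-- The polyhedron `{x | ∀ j, ⟪v j, x⟫ ≤ b j}`. -/
def polyhedron {m : ℕ} (v : Fin m → E) (b : Fin m → ℝ) : Set E := {x | ∀ j, ⟪v j, x⟫ ≤ b j}

omit [FiniteDimensional ℝ E] in
theorem measurableSet_polyhedron {m : ℕ} (v : Fin m → E) (b : Fin m → ℝ) :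
    MeasurableSet (polyhedron v b) := by
  simp only [polyhedron, Set.ofPred_forall]
  exact MeasurableSet.iInter fun k => measurableSet_le (by fun_prop) (by fun_prop)

omit [FiniteDimensional ℝ E] [MeasurableSpace E] [BorelSpace E] in
theorem polyhedron_mono {m : ℕ} (v : Fin m → E) {b c : Fin m → ℝ} (h : ∀ j, b j ≤ c j) :
    polyhedron v b ⊆ polyhedron v c := fun _ hx j => (hx j).trans (h j)

/-- Nazarov's inequality. -/
theorem gaussian_polyhedron_anticoncentration {G : Measure E} [IsGaussian G]
    (hG : ∀ y : E, ∫ x, ⟪y, x⟫ ∂G = 0) {m : ℕ} [NeZero m] {v : Fin m → E} {σ : ℝ} (hσ : 0 < σ)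
    (hv : ∀ j, σ ^ 2 ≤ ∫ x, ⟪v j, x⟫ ^ 2 ∂G) (b : Fin m → ℝ) {ε : ℝ} (hε : 0 ≤ ε) :
    G.real (polyhedron v fun j => b j + ε) - G.real (polyhedron v b) ≤
      Real.exp 2 * (√(2 * Real.log m) + 2) / σ * ε := by
  have hC : 1 ≤ Real.exp 2 * (√(2 * Real.log m) + 1) + 1 :=
    le_add_of_nonneg_left (by positivity)
  have hC' : Real.exp 2 * (√(2 * Real.log m) + 1) + 1 ≤
      Real.exp 2 * (√(2 * Real.log m) + 2) := by
    have := Real.one_le_exp (zero_le_two (α := ℝ))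
    linarith
  suffices h : G.real (polyhedron v fun j => b j + ε) - G.real (polyhedron v b) ≤
      ε / σ * (Real.exp 2 * (√(2 * Real.log m) + 1) + 1) by
    refine h.trans ((mul_le_mul_of_nonneg_left hC' (by positivity)).trans (le_of_eq (by ring)))
  -- When `ε > σ` the right-hand side exceeds one. Otherwise the normals are rescaled to unit
  -- variance, which shrinks each width to at most `ε / σ`.
  rcases le_or_gt (ε / σ) 1 with h1 | h1
  swap
  · have := measureReal_le_one (μ := G) (s := polyhedron v fun j => b j + ε)
    have := measureReal_nonneg (μ := G) (s := polyhedron v b)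
    nlinarith
  set τ : Fin m → ℝ := fun j => √(∫ x, ⟪v j, x⟫ ^ 2 ∂G) with hτ
  have hτσ : ∀ j, σ ≤ τ j := fun j => Real.le_sqrt_of_sq_le (hv j)
  have hτ0 : ∀ j, 0 < τ j := fun j => hσ.trans_le (hτσ j)
  have hw : ∀ j, ∫ x, ⟪(τ j)⁻¹ • v j, x⟫ ^ 2 ∂G = 1 := by
    intro j
    simp_rw [real_inner_smul_left, mul_pow]
    rw [integral_const_mul, inv_pow, hτ, Real.sq_sqrt ((sq_nonneg σ).trans (hv j))]
    exact inv_mul_cancel₀ ((pow_pos hσ 2).trans_le (hv j)).ne'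
  have key := gaussian_anticoncentration_of_variance_one hG hw (fun j => (τ j)⁻¹ * b j)
    (div_nonneg hε hσ.le) h1
  rw [← measureReal_sdiff (polyhedron_mono v fun j => le_add_of_nonneg_right hε)
    (measurableSet_polyhedron v b), measureReal_def]
  refine ENNReal.toReal_le_of_le_ofReal (by positivity) (le_trans (measure_mono ?_) key)
  rintro x ⟨hx1, hx2⟩
  simp only [polyhedron, Set.mem_ofPred_eq, not_forall, not_le] at hx1 hx2
  refine ⟨?_, fun j => ?_⟩
  · obtain ⟨j, hj⟩ := hx2
    refine ⟨j, ?_⟩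
    rw [real_inner_smul_left]
    exact mul_lt_mul_of_pos_left hj (inv_pos.2 (hτ0 j))
  · rw [real_inner_smul_left]
    have : (τ j)⁻¹ * ε ≤ ε / σ := by
      rw [div_eq_inv_mul]; gcongr; exact hτσ j
    have h2 := mul_le_mul_of_nonneg_left (hx1 j) (inv_pos.2 (hτ0 j)).le
    linarith [mul_add (τ j)⁻¹ (b j) ε]

end Split

/-! ### Taylor expansion of the smoothed maximum. -/

section SoftMax

/-- `g` is a step from `1` on `(-∞, 0]` to `0` on `[1, ∞)` whose first three derivatives
`g₁`, `g₂`, `g₃` are bounded by `B`. -/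
structure IsSmoothStep (g g₁ g₂ g₃ : ℝ → ℝ) (B : ℝ) : Prop where
  deriv₀ : ∀ t, HasDerivAt g (g₁ t) t
  deriv₁ : ∀ t, HasDerivAt g₁ (g₂ t) t
  deriv₂ : ∀ t, HasDerivAt g₂ (g₃ t) t
  nonneg : ∀ t, 0 ≤ g t
  le_one : ∀ t, g t ≤ 1
  eq_one : ∀ t ≤ 0, g t = 1
  eq_zero : ∀ t, 1 ≤ t → g t = 0
  one_le : 1 ≤ B
  bound₁ : ∀ t, |g₁ t| ≤ B
  bound₂ : ∀ t, |g₂ t| ≤ B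
  bound₃ : ∀ t, |g₃ t| ≤ B
  supp₁ : ∀ t ∉ Set.Icc (0 : ℝ) 1, g₁ t = 0
  supp₂ : ∀ t ∉ Set.Icc (0 : ℝ) 1, g₂ t = 0
  supp₃ : ∀ t ∉ Set.Icc (0 : ℝ) 1, g₃ t = 0

theorem deriv_eq_zero_of_const_off_Icc {f : ℝ → ℝ} {c₁ c₂ : ℝ} (h₁ : ∀ t < 0, f t = c₁)
    (h₂ : ∀ t, 1 < t → f t = c₂) : ∀ t ∉ Set.Icc (0 : ℝ) 1, deriv f t = 0 := by
  intro t ht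
  rw [Set.mem_Icc, not_and_or, not_le, not_le] at ht
  rcases ht with ht | ht
  · have : f =ᶠ[nhds t] fun _ => c₁ := by
      filter_upwards [Iio_mem_nhds ht] with s hs using h₁ s hs
    rw [this.deriv_eq, deriv_const]
  · have : f =ᶠ[nhds t] fun _ => c₂ := by
      filter_upwards [Ioi_mem_nhds ht] with s hs using h₂ s hs
    rw [this.deriv_eq, deriv_const]

theorem exists_bound_of_zero_off_Icc {f : ℝ → ℝ} (hf : Continuous f)
    (h : ∀ t ∉ Set.Icc (0 : ℝ) 1, f t = 0) : ∃ B, ∀ t, |f t| ≤ B := by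
  obtain ⟨B, hB⟩ := isCompact_Icc.exists_bound_of_continuousOn (s := Set.Icc (0 : ℝ) 1)
    hf.continuousOn
  refine ⟨B, fun t => ?_⟩
  by_cases ht : t ∈ Set.Icc (0 : ℝ) 1
  · exact hB t ht
  · rw [h t ht, abs_zero]
    exact (norm_nonneg _).trans (hB 0 (by simp))

theorem exists_isSmoothStep : ∃ (g g₁ g₂ g₃ : ℝ → ℝ) (B : ℝ), IsSmoothStep g g₁ g₂ g₃ B := by
  set g : ℝ → ℝ := fun t => Real.smoothTransition (1 - t) with hg
  have hc : ContDiff ℝ 4 g := Real.smoothTransition.contDiff.comp (contDiff_const.sub contDiff_id)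
  have hc1 : ContDiff ℝ 3 (deriv g) := (contDiff_succ_iff_deriv.1 hc).2.2
  have hc2 : ContDiff ℝ 2 (deriv (deriv g)) := (contDiff_succ_iff_deriv.1 hc1).2.2
  have hc3 : ContDiff ℝ 1 (deriv (deriv (deriv g))) := (contDiff_succ_iff_deriv.1 hc2).2.2
  have e1 : ∀ t ≤ 0, g t = 1 := fun t ht =>
    Real.smoothTransition.one_of_one_le (by linarith)
  have e0 : ∀ t, 1 ≤ t → g t = 0 := fun t ht =>
    Real.smoothTransition.zero_of_nonpos (by linarith)
  have s1 := deriv_eq_zero_of_const_off_Icc (fun t ht => e1 t ht.le) (fun t ht => e0 t ht.le)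
  have s2 := deriv_eq_zero_of_const_off_Icc (fun t ht => s1 t (by simp [ht]))
    (fun t ht => s1 t (by simp [ht]))
  have s3 := deriv_eq_zero_of_const_off_Icc (fun t ht => s2 t (by simp [ht]))
    (fun t ht => s2 t (by simp [ht]))
  obtain ⟨B1, hB1⟩ := exists_bound_of_zero_off_Icc hc1.continuous s1
  obtain ⟨B2, hB2⟩ := exists_bound_of_zero_off_Icc hc2.continuous s2
  obtain ⟨B3, hB3⟩ := exists_bound_of_zero_off_Icc hc3.continuous s3
  exact ⟨g, deriv g, deriv (deriv g), deriv (deriv (deriv g)), max 1 (max B1 (max B2 B3)),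
    { deriv₀ := fun t => (hc.differentiable (by norm_num) t).hasDerivAt
      deriv₁ := fun t => (hc1.differentiable (by norm_num) t).hasDerivAt
      deriv₂ := fun t => (hc2.differentiable (by norm_num) t).hasDerivAt
      nonneg := fun t => Real.smoothTransition.nonneg _
      le_one := fun t => Real.smoothTransition.le_one _
      eq_one := e1
      eq_zero := e0
      one_le := le_max_left _ _
      bound₁ := fun t => (hB1 t).trans (by simp)
      bound₂ := fun t => (hB2 t).trans (by simp)
      bound₃ := fun t => (hB3 t).trans (by simp)
      supp₁ := s1
      supp₂ := s2
      supp₃ := s3 }⟩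

/-- Three successive applications of the mean value inequality; the factor `1 / 6` is given up. -/
theorem abs_sub_taylor_two_le {h h₁ h₂ h₃ : ℝ → ℝ} (d₀ : ∀ t, HasDerivAt h (h₁ t) t)
    (d₁ : ∀ t, HasDerivAt h₁ (h₂ t) t) (d₂ : ∀ t, HasDerivAt h₂ (h₃ t) t) {M : ℝ}
    (hM : ∀ t ∈ Set.Icc (0 : ℝ) 1, |h₃ t| ≤ M) :
    |h 1 - h 0 - h₁ 0 - h₂ 0 / 2| ≤ M := by
  have mv : ∀ {f f' : ℝ → ℝ} (_ : ∀ t, HasDerivAt f (f' t) t)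
      (_ : ∀ t ∈ Set.Icc (0 : ℝ) 1, |f' t| ≤ M), ∀ t ∈ Set.Icc (0 : ℝ) 1, |f t - f 0| ≤ M := by
    intro f f' hf hf' t ht
    have := (convex_Icc (0 : ℝ) 1).norm_image_sub_le_of_norm_hasDerivWithin_le (C := M)
      (fun x _ => (hf x).hasDerivWithinAt) hf' (by simp : (0 : ℝ) ∈ Set.Icc (0 : ℝ) 1) ht
    rw [Real.norm_eq_abs, Real.norm_eq_abs, sub_zero, abs_of_nonneg ht.1] at this
    have hM0 : 0 ≤ M := (abs_nonneg _).trans (hM 0 (by simp))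
    exact this.trans (mul_le_of_le_one_right hM0 ht.2)
  have a2 := mv d₂ hM
  have a1 := mv (f := fun t => h₁ t - h₂ 0 * t) (f' := fun t => h₂ t - h₂ 0)
    (fun t => ((d₁ t).sub ((hasDerivAt_id t).const_mul (h₂ 0))).congr_deriv (by simp)) a2
  have a0 := mv (f := fun t => h t - h₁ 0 * t - h₂ 0 * (t ^ 2 / 2))
    (f' := fun t => h₁ t - h₁ 0 - h₂ 0 * t)
    (fun t => by
      have := ((d₀ t).sub ((hasDerivAt_id t).const_mul (h₁ 0))).sub
        (((hasDerivAt_pow 2 t).div_const 2).const_mul (h₂ 0))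
      refine this.congr_deriv ?_
      simp) (fun t ht => by have := a1 t ht; simp only [mul_zero, sub_zero] at this
                            rwa [sub_right_comm])
  have := a0 1 (by simp)
  norm_num at this
  convert this using 2
  ring

variable {m : ℕ}

/-- The logarithm of the sum of the exponentials of the coordinates. -/
noncomputable def logSumExp (z : Fin m → ℝ) : ℝ := Real.log (∑ j, Real.exp (z j))

/-- The mean of `f` under the weights proportional to `exp (z j)`. -/
noncomputable def softMean (z f : Fin m → ℝ) : ℝ :=
  (∑ j, Real.exp (z j) * f j) / ∑ j, Real.exp (z j)

variable [NeZero m]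

theorem sum_exp_pos (z : Fin m → ℝ) : 0 < ∑ j, Real.exp (z j) :=
  Finset.sum_pos (fun _ _ => Real.exp_pos _) Finset.univ_nonempty

theorem softMean_mono (z : Fin m → ℝ) {f h : Fin m → ℝ} (hfh : ∀ j, f j ≤ h j) :
    softMean z f ≤ softMean z h := by
  unfold softMean
  have := sum_exp_pos z
  gcongr with j
  exact hfh j

theorem softMean_const (z : Fin m → ℝ) (c : ℝ) : softMean z (fun _ => c) = c := by
  unfold softMean
  rw [← Finset.sum_mul, mul_div_cancel_left₀ _ (sum_exp_pos z).ne']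

omit [NeZero m] in
theorem softMean_add (z f h : Fin m → ℝ) :
    softMean z (fun j => f j + h j) = softMean z f + softMean z h := by
  simp_rw [softMean, mul_add, Finset.sum_add_distrib, add_div]

omit [NeZero m] in
theorem softMean_const_mul (z f : Fin m → ℝ) (c : ℝ) :
    softMean z (fun j => c * f j) = c * softMean z f := by
  simp_rw [softMean, mul_left_comm _ c, ← Finset.mul_sum, mul_div_assoc]

omit [NeZero m] in
theorem abs_softMean_le (z f : Fin m → ℝ) : |softMean z f| ≤ softMean z fun j => |f j| := by
  unfold softMean
  rw [abs_div, abs_of_nonneg (Finset.sum_nonneg fun j _ => (Real.exp_pos (z j)).le)]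
  gcongr
  refine (Finset.abs_sum_le_sum_abs _ _).trans (le_of_eq ?_)
  simp [abs_mul]

theorem softMean_nonneg (z : Fin m → ℝ) {f : Fin m → ℝ} (hf : ∀ j, 0 ≤ f j) :
    0 ≤ softMean z f := by
  simpa [softMean_const] using softMean_mono z (f := fun _ => 0) hf

/-- The weighted mean of the pointwise inequality `(2 t + c) (c - t) ^ 2 ≥ 0` at `t = |f j|`. -/
theorem softMean_mul_sq_le (z f : Fin m → ℝ) {c : ℝ} (hc : 0 ≤ c) :
    c * softMean z (fun j => f j ^ 2) ≤ c ^ 3 / 3 + 2 / 3 * softMean z fun j => |f j| ^ 3 := by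
  rw [← softMean_const_mul, ← softMean_const z (c ^ 3 / 3), ← softMean_const_mul,
    ← softMean_add]
  refine softMean_mono z fun j => ?_
  rw [← sq_abs]
  have := abs_nonneg (f j)
  nlinarith [mul_nonneg (add_nonneg (mul_nonneg zero_le_two this) hc) (sq_nonneg (c - |f j|))]

/-- Jensen's inequality for the cube, from its tangent line at the mean. -/
theorem softMean_abs_pow_three_le (z f : Fin m → ℝ) :
    (softMean z fun j => |f j|) ^ 3 ≤ softMean z fun j => |f j| ^ 3 := by
  have h := softMean_nonneg z (f := fun j => |f j|) fun j => abs_nonneg _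
  set P := softMean z fun j => |f j| with hP
  have h2 : softMean z (fun j => 3 * P ^ 2 * |f j|) ≤
      softMean z fun j => 2 * P ^ 3 + |f j| ^ 3 := by
    refine softMean_mono z fun j => ?_
    have := abs_nonneg (f j)
    nlinarith [mul_nonneg (add_nonneg (mul_nonneg zero_le_two h) this) (sq_nonneg (P - |f j|))]
  rw [softMean_const_mul, softMean_add, softMean_const, ← hP] at h2
  nlinarith

theorem hasDerivAt_logSumExp (z a : Fin m → ℝ) (t : ℝ) :
    HasDerivAt (fun t : ℝ => logSumExp (z + t • a)) (softMean (z + t • a) a) t := by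
  have h : ∀ j, HasDerivAt (fun t : ℝ => Real.exp ((z + t • a) j))
      (Real.exp ((z + t • a) j) * a j) t := fun j => by
    have := (((hasDerivAt_id t).mul_const (a j)).const_add (z j)).exp
    simpa using this
  exact (HasDerivAt.fun_sum fun j _ => h j).log (sum_exp_pos _).ne'

/-- The derivative is the covariance of `f` and `a` under the softmax weights, so repeated
differentiation yields only weighted moments of `a`. -/
theorem hasDerivAt_softMean (z a f : Fin m → ℝ) (t : ℝ) :
    HasDerivAt (fun t : ℝ => softMean (z + t • a) f)
      (softMean (z + t • a) (fun j => a j * f j) -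
        softMean (z + t • a) f * softMean (z + t • a) a) t := by
  have h : ∀ j, HasDerivAt (fun t : ℝ => Real.exp ((z + t • a) j))
      (Real.exp ((z + t • a) j) * a j) t := fun j => by
    have := (((hasDerivAt_id t).mul_const (a j)).const_add (z j)).exp
    simpa using this
  have hp := (sum_exp_pos (z + t • a)).ne'
  have := (HasDerivAt.fun_sum (u := Finset.univ) fun j _ => (h j).mul_const (f j)).fun_div
    (HasDerivAt.fun_sum (u := Finset.univ) fun j _ => h j) hp
  refine this.congr_deriv ?_
  simp only [softMean, mul_assoc]
  field_simp

/-- The numerator changes by a factor of at most `e` and the denominator by at least `1 / e`. This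
lets the remainder be evaluated at `z`, with weights that do not depend on the increment. -/
theorem softMean_shift_le {z a f : Fin m → ℝ} (hf : ∀ j, 0 ≤ f j) (ha : ∀ j, |a j| ≤ 1) :
    softMean (z + a) f ≤ Real.exp 2 * softMean z f := by
  have h1 : ∑ j, Real.exp ((z + a) j) * f j ≤ Real.exp 1 * ∑ j, Real.exp (z j) * f j := by
    rw [Finset.mul_sum]
    refine Finset.sum_le_sum fun j _ => ?_
    rw [← mul_assoc, ← Real.exp_add]
    have := hf j
    gcongr
    simp only [Pi.add_apply]; linarith [(abs_le.1 (ha j)).2]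
  have h2 : Real.exp (-1) * ∑ j, Real.exp (z j) ≤ ∑ j, Real.exp ((z + a) j) := by
    rw [Finset.mul_sum]
    refine Finset.sum_le_sum fun j _ => ?_
    rw [← Real.exp_add]
    gcongr
    simp only [Pi.add_apply]; linarith [(abs_le.1 (ha j)).1]
  have h3 := sum_exp_pos z
  unfold softMean
  calc _ ≤ (Real.exp 1 * ∑ j, Real.exp (z j) * f j) / (Real.exp (-1) * ∑ j, Real.exp (z j)) := by
        gcongr
        exact mul_nonneg (Real.exp_pos _).le
          (Finset.sum_nonneg fun j _ => mul_nonneg (Real.exp_pos _).le (hf j))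
    _ = _ := by
        rw [mul_div_mul_comm, ← Real.exp_sub]; norm_num

theorem le_logSumExp (z : Fin m → ℝ) (j : Fin m) : z j ≤ logSumExp z := by
  rw [logSumExp, Real.le_log_iff_exp_le (sum_exp_pos z)]
  exact Finset.single_le_sum (f := fun j => Real.exp (z j)) (fun j _ => (Real.exp_pos _).le)
    (Finset.mem_univ j)

theorem logSumExp_le {z : Fin m → ℝ} {c : ℝ} (h : ∀ j, z j ≤ c) :
    logSumExp z ≤ c + Real.log m := by
  have hm : (0 : ℝ) < m := by exact_mod_cast NeZero.pos m
  rw [logSumExp, Real.log_le_iff_le_exp (sum_exp_pos z), Real.exp_add, Real.exp_log hm]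
  calc _ ≤ ∑ j : Fin m, Real.exp c := by gcongr with j; exact h j
    _ = _ := by simp [mul_comm]

theorem logSumExp_add_le {z a : Fin m → ℝ} {c : ℝ} (h : ∀ j, a j ≤ c) :
    logSumExp (z + a) ≤ logSumExp z + c := by
  rw [logSumExp, Real.log_le_iff_le_exp (sum_exp_pos _), Real.exp_add, logSumExp,
    Real.exp_log (sum_exp_pos z), Finset.sum_mul]
  gcongr with j
  rw [← Real.exp_add]
  gcongr
  exact add_le_add_right (h j) _

theorem abs_logSumExp_add_sub_le {z a : Fin m → ℝ} {c : ℝ} (h : ∀ j, |a j| ≤ c) :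
    |logSumExp (z + a) - logSumExp z| ≤ c := by
  have h1 := logSumExp_add_le (z := z) (a := a) fun j => (abs_le.1 (h j)).2
  have h2 := logSumExp_add_le (z := z + a) (a := -a) (c := c) fun j => by
    simp only [Pi.neg_apply]; linarith [(abs_le.1 (h j)).1]
  rw [add_neg_cancel_right] at h2
  rw [abs_le]; constructor <;> linarith

variable {g g₁ g₂ g₃ : ℝ → ℝ} {B κ : ℝ}

/-- In the remainder the increment `a` appears neither in the weights nor in the window, so for a
random increment independent of `z` the expectation factors. Large increments are charged to the
separate tail sum. -/
theorem IsSmoothStep.abs_sub_taylor_le (hg : IsSmoothStep g g₁ g₂ g₃ B) (hκ : 0 ≤ κ) (hκ1 : κ ≤ 1)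
    (z a : Fin m → ℝ) :
    |g (κ * logSumExp (z + a)) - g (κ * logSumExp z)
      - κ * g₁ (κ * logSumExp z) * softMean z a
      - (κ ^ 2 * g₂ (κ * logSumExp z) * softMean z a ^ 2 + κ * g₁ (κ * logSumExp z) *
          (softMean z (fun j => a j ^ 2) - softMean z a ^ 2)) / 2| ≤
    13 * Real.exp 2 * B * (κ * (Set.Icc (-1) 2).indicator 1 (κ * logSumExp z) *
      softMean z (fun j => |a j| ^ 3) + ∑ j, if 1 < |a j| then a j ^ 2 else 0) := by
  have hB := hg.one_le
  have hB0 : 0 ≤ B := zero_le_one.trans hB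
  have hsum0 : 0 ≤ ∑ j, if 1 < |a j| then a j ^ 2 else 0 :=
    Finset.sum_nonneg fun j _ => by split_ifs <;> positivity
  have hP0 : 0 ≤ softMean z fun j => |a j| ^ 3 := softMean_nonneg z fun j => by positivity
  have hind0 : 0 ≤ (Set.Icc (-1 : ℝ) 2).indicator (1 : ℝ → ℝ) (κ * logSumExp z) :=
    Set.indicator_nonneg (fun _ _ => zero_le_one) _
  have he : 1 ≤ Real.exp 2 := Real.one_le_exp zero_le_two
  -- Here no expansion is needed: with `A` the largest `|a j|`, the increment of `g`, the linear
  -- term and the quadratic term are each at most `B * A ^ 2`.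
  by_cases hbig : ∃ j, 1 < |a j|
  · obtain ⟨i, -, hi⟩ := Finset.exists_max_image (Finset.univ : Finset (Fin m)) (fun j => |a j|)
      Finset.univ_nonempty
    have hi := fun j => hi j (Finset.mem_univ j)
    set A := |a i| with hA
    have hA1 : 1 < A := by
      obtain ⟨j, hj⟩ := hbig; exact hj.trans_le (hi j)
    have hAs : A ^ 2 ≤ ∑ j, if 1 < |a j| then a j ^ 2 else 0 := by
      have := Finset.single_le_sum (f := fun j => if 1 < |a j| then a j ^ 2 else 0)
        (fun j _ => by split_ifs <;> positivity) (Finset.mem_univ i)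
      rwa [if_pos hA1, ← sq_abs] at this
    have p1 : |softMean z a| ≤ A := (abs_softMean_le z a).trans
      ((softMean_mono z hi).trans_eq (softMean_const z A))
    have p1' : softMean z a ^ 2 ≤ A ^ 2 := by rw [← sq_abs]; gcongr
    have p2 : softMean z (fun j => a j ^ 2) ≤ A ^ 2 :=
      (softMean_mono z fun j => by rw [← sq_abs]; gcongr; exact hi j).trans_eq
        (softMean_const z (A ^ 2))
    have p2' : 0 ≤ softMean z (fun j => a j ^ 2) := softMean_nonneg z fun j => sq_nonneg _
    have p3 : |softMean z (fun j => a j ^ 2) - softMean z a ^ 2| ≤ A ^ 2 := by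
      rw [abs_le]; constructor <;> nlinarith [sq_nonneg (softMean z a)]
    set s := κ * logSumExp z with hs
    have q1 : |κ * g₁ s| ≤ B := by
      rw [abs_mul, abs_of_nonneg hκ]
      exact (mul_le_mul hκ1 (hg.bound₁ s) (abs_nonneg _) zero_le_one).trans_eq (one_mul B)
    have q2 : |κ ^ 2 * g₂ s| ≤ B := by
      rw [abs_mul, abs_of_nonneg (sq_nonneg κ)]
      exact (mul_le_mul (pow_le_one₀ hκ hκ1) (hg.bound₂ s) (abs_nonneg _) zero_le_one).trans_eq
        (one_mul B)
    have r1 : |κ * g₁ s * softMean z a| ≤ B * A := by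
      rw [abs_mul]; gcongr
    have r2 : |κ ^ 2 * g₂ s * softMean z a ^ 2| ≤ B * A ^ 2 := by
      rw [abs_mul, abs_of_nonneg (sq_nonneg (softMean z a))]; gcongr
    have r3 : |κ * g₁ s * (softMean z (fun j => a j ^ 2) - softMean z a ^ 2)| ≤ B * A ^ 2 := by
      rw [abs_mul]; gcongr
    have r0 : |g (κ * logSumExp (z + a)) - g s| ≤ 1 := by
      have := hg.nonneg s; have := hg.le_one s
      have := hg.nonneg (κ * logSumExp (z + a)); have := hg.le_one (κ * logSumExp (z + a))
      rw [abs_le]; constructor <;> linarith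
    have hBA : B * A ≤ B * A ^ 2 := by gcongr; nlinarith
    have hBA' : 1 ≤ B * A ^ 2 := by nlinarith
    have hfin : B * A ^ 2 ≤ B * ∑ j, if 1 < |a j| then a j ^ 2 else 0 := by gcongr
    have hfirst : 0 ≤ κ * (Set.Icc (-1) 2).indicator 1 s * softMean z (fun j => |a j| ^ 3) := by
      positivity
    have : 3 * (B * A ^ 2) ≤ 13 * Real.exp 2 * B *
        (κ * (Set.Icc (-1) 2).indicator 1 s *
        softMean z (fun j => |a j| ^ 3) + ∑ j, if 1 < |a j| then a j ^ 2 else 0) := by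
      rw [mul_add]
      have h1 : 0 ≤ 13 * Real.exp 2 * B * (κ * (Set.Icc (-1) 2).indicator 1 s *
        softMean z (fun j => |a j| ^ 3)) := by positivity
      have h2 : 3 * (B * ∑ j, if 1 < |a j| then a j ^ 2 else 0) ≤
          13 * Real.exp 2 * (B * ∑ j, if 1 < |a j| then a j ^ 2 else 0) := by
        gcongr; linarith
      linarith
    refine le_trans ?_ this
    rw [abs_le] at *
    constructor <;> linarith
  · push Not at hbig
    set ℓ : ℝ → ℝ := fun t => κ * logSumExp (z + t • a) with hℓ
    set p : ℕ → ℝ → ℝ := fun k t => softMean (z + t • a) (fun j => a j ^ k) with hp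
    have dℓ : ∀ t, HasDerivAt ℓ (κ * p 1 t) t := fun t => by
      simpa [hp] using (hasDerivAt_logSumExp z a t).const_mul κ
    have dp : ∀ k t, HasDerivAt (p k) (p (k + 1) t - p k t * p 1 t) t := fun k t => by
      simpa [hp, pow_succ'] using hasDerivAt_softMean z a (fun j => a j ^ k) t
    have d0 : ∀ t, HasDerivAt (fun t => g (ℓ t)) (g₁ (ℓ t) * (κ * p 1 t)) t := fun t =>
      (hg.deriv₀ (ℓ t)).comp t (dℓ t)
    have d1 : ∀ t, HasDerivAt (fun t => g₁ (ℓ t) * (κ * p 1 t))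
        (g₂ (ℓ t) * (κ * p 1 t) * (κ * p 1 t) + g₁ (ℓ t) * (κ * (p 2 t - p 1 t * p 1 t))) t :=
      fun t => ((hg.deriv₁ (ℓ t)).comp t (dℓ t)).mul ((dp 1 t).const_mul κ)
    have d2 : ∀ t, HasDerivAt (fun t => g₂ (ℓ t) * (κ * p 1 t) * (κ * p 1 t) +
          g₁ (ℓ t) * (κ * (p 2 t - p 1 t * p 1 t))) (κ ^ 3 * g₃ (ℓ t) * p 1 t ^ 3 +
          3 * κ ^ 2 * g₂ (ℓ t) * (p 1 t * (p 2 t - p 1 t ^ 2)) +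
          κ * g₁ (ℓ t) * (p 3 t - 3 * p 1 t * p 2 t + 2 * p 1 t ^ 3)) t := fun t => by
      have := ((((hg.deriv₂ (ℓ t)).comp t (dℓ t)).mul ((dp 1 t).const_mul κ)).mul
        ((dp 1 t).const_mul κ)).add (((hg.deriv₁ (ℓ t)).comp t (dℓ t)).mul
          (((dp 2 t).sub ((dp 1 t).mul (dp 1 t))).const_mul κ))
      refine this.congr_deriv ?_
      simp only [Function.comp_apply, Nat.reduceAdd, Pi.mul_apply, Pi.sub_apply]
      ring
    have hM := abs_sub_taylor_two_le d0 d1 d2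
      (M := 13 * Real.exp 2 * B * (κ * (Set.Icc (-1) 2).indicator 1 (κ * logSumExp z) *
      softMean z (fun j => |a j| ^ 3))) ?_
    · simp only [hℓ, hp, one_smul, zero_smul, add_zero, pow_one] at hM
      have hB' : 0 ≤ 13 * Real.exp 2 * B * ∑ j, if 1 < |a j| then a j ^ 2 else 0 := by positivity
      rw [mul_add]
      refine le_trans (le_of_eq ?_) (hM.trans (le_add_of_nonneg_right hB'))
      congr 1; ring
    intro t ht
    have hta : ∀ j, |(t • a) j| ≤ 1 := fun j => by
      simp only [Pi.smul_apply, smul_eq_mul, abs_mul, abs_of_nonneg ht.1]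
      exact mul_le_one₀ ht.2 (abs_nonneg _) (hbig j)
    -- The derivatives of `g` vanish off `[0, 1]`. Log-sum-exp is 1-Lipschitz for the sup norm and
    -- `κ ≤ 1`, so `ℓ t ∈ [0, 1]` forces the starting value into `[-1, 2]`.
    by_cases hwin : ℓ t ∈ Set.Icc (0 : ℝ) 1
    · have hzwin : κ * logSumExp z ∈ Set.Icc (-1 : ℝ) 2 := by
        have h1 := abs_logSumExp_add_sub_le (z := z) hta
        have h2 : |ℓ t - κ * logSumExp z| ≤ 1 := by
          rw [hℓ, ← mul_sub, abs_mul, abs_of_nonneg hκ]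
          exact mul_le_one₀ hκ1 (abs_nonneg _) h1
        rw [abs_le] at h2
        constructor <;> linarith [hwin.1, hwin.2]
      rw [Set.indicator_of_mem hzwin, Pi.one_apply, mul_one]
      set P := softMean (z + t • a) (fun j => |a j| ^ 3) with hPdef
      have hPle : P ≤ Real.exp 2 * softMean z (fun j => |a j| ^ 3) :=
        softMean_shift_le (fun j => by positivity) hta
      set Q := softMean (z + t • a) (fun j => |a j|) with hQdef
      have hQ0 : 0 ≤ Q := softMean_nonneg _ fun j => abs_nonneg _
      have hQ3 : Q ^ 3 ≤ P := softMean_abs_pow_three_le _ a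
      have hp1 : |p 1 t| ≤ Q := by simpa [hp] using abs_softMean_le (z + t • a) a
      have hp2 : 0 ≤ p 2 t := softMean_nonneg _ fun j => sq_nonneg _
      have hp12 : Q * p 2 t ≤ P := by
        have := softMean_mul_sq_le (z + t • a) a hQ0
        simp only [hp]
        linarith
      have hp3 : |p 3 t| ≤ P := by
        have e : (fun j => |a j ^ 3|) = fun j => |a j| ^ 3 := funext fun j => abs_pow _ _
        rw [hPdef, ← e]
        exact abs_softMean_le (z + t • a) (fun j => a j ^ 3)
      have hP0 : 0 ≤ P := (pow_nonneg hQ0 3).trans hQ3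
      have c1 : |p 1 t ^ 3| ≤ P := by
        rw [abs_pow]; exact (pow_le_pow_left₀ (abs_nonneg _) hp1 3).trans hQ3
      have c2 : |p 1 t * p 2 t| ≤ P := by
        rw [abs_mul, abs_of_nonneg hp2]; exact (mul_le_mul_of_nonneg_right hp1 hp2).trans hp12
      have c3 : |p 1 t * (p 2 t - p 1 t ^ 2)| ≤ 2 * P := by
        rw [abs_le] at c1 c2 ⊢; constructor <;> nlinarith
      have c4 : |p 3 t - 3 * p 1 t * p 2 t + 2 * p 1 t ^ 3| ≤ 6 * P := by
        rw [abs_le] at c1 c2 hp3 ⊢; constructor <;> nlinarith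
      have k3 : |κ ^ 3 * g₃ (ℓ t)| ≤ κ * B := by
        rw [abs_mul, abs_of_nonneg (pow_nonneg hκ 3)]
        exact mul_le_mul (pow_le_of_le_one hκ hκ1 (by norm_num)) (hg.bound₃ _) (abs_nonneg _) hκ
      have k2 : |3 * κ ^ 2 * g₂ (ℓ t)| ≤ 3 * κ * B := by
        rw [abs_mul, abs_of_nonneg (by positivity)]
        exact mul_le_mul (mul_le_mul_of_nonneg_left (pow_le_of_le_one hκ hκ1 (by norm_num))
          (by norm_num)) (hg.bound₂ _) (abs_nonneg _) (by positivity)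
      have k1 : |κ * g₁ (ℓ t)| ≤ κ * B := by
        rw [abs_mul, abs_of_nonneg hκ]
        exact mul_le_mul_of_nonneg_left (hg.bound₁ _) hκ
      -- Since `κ ≤ 1`, every power of `κ` is at most `κ`; the constant is `13 = 1 + 3 * 2 + 6`.
      calc _ ≤ |κ ^ 3 * g₃ (ℓ t) * p 1 t ^ 3| +
            |3 * κ ^ 2 * g₂ (ℓ t) * (p 1 t * (p 2 t - p 1 t ^ 2))| +
            |κ * g₁ (ℓ t) * (p 3 t - 3 * p 1 t * p 2 t + 2 * p 1 t ^ 3)| := abs_add_three _ _ _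
        _ ≤ κ * B * P + 3 * κ * B * (2 * P) + κ * B * (6 * P) := by
            rw [abs_mul, abs_mul (3 * κ ^ 2 * g₂ (ℓ t)), abs_mul (κ * g₁ (ℓ t))]
            gcongr
        _ = 13 * B * κ * P := by ring
        _ ≤ 13 * B * κ * (Real.exp 2 * softMean z (fun j => |a j| ^ 3)) := by gcongr
        _ = _ := by ring
    · rw [hg.supp₁ _ hwin, hg.supp₂ _ hwin, hg.supp₃ _ hwin]
      simp only [mul_zero, zero_mul, add_zero, abs_zero]
      positivity

end SoftMax

/-! ### One replacement step and the probability of the window. -/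

section Lindeberg

variable {E : Type*} [NormedAddCommGroup E] [InnerProductSpace ℝ E] [FiniteDimensional ℝ E]
  [MeasurableSpace E] [BorelSpace E] {m : ℕ}

/-- The slacks `β (⟪v j, x⟫ - b j)` of the constraints of a polyhedron. -/
def scaledSlack (β : ℝ) (v : Fin m → E) (b : Fin m → ℝ) (x : E) : Fin m → ℝ :=
  fun j => β * (⟪v j, x⟫ - b j)

omit [FiniteDimensional ℝ E] [MeasurableSpace E] [BorelSpace E] in
theorem scaledSlack_add (β : ℝ) (v : Fin m → E) (b : Fin m → ℝ) (x y : E) :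
    scaledSlack β v b (x + y) = scaledSlack β v b x + fun j => β * ⟪v j, y⟫ := by
  ext j; simp only [scaledSlack, inner_add_right, Pi.add_apply]; ring

omit [FiniteDimensional ℝ E] [MeasurableSpace E] [BorelSpace E] in
theorem continuous_logSumExp_scaledSlack [NeZero m] (β : ℝ) (v : Fin m → E) (b : Fin m → ℝ) :
    Continuous fun x => logSumExp (scaledSlack β v b x) := by
  unfold logSumExp scaledSlack
  exact Continuous.log (by fun_prop) fun x => (sum_exp_pos _).ne'

/-- Bounds on the moments of the projections to the directions `v j`. -/
structure HasProjectionBounds (μ : Measure E) (v : Fin m → E) (β M T : ℝ) : Prop where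
  memLp : ∀ j, MemLp (fun x => ⟪v j, x⟫) 3 μ
  third : ∀ j, ∫ x, |⟪v j, x⟫| ^ 3 ∂μ ≤ M
  tail : ∀ j, ∫ x, (if 1 < |β * ⟪v j, x⟫| then (β * ⟪v j, x⟫) ^ 2 else 0) ∂μ ≤ T

namespace HasProjectionBounds

variable {μ : Measure E} [IsProbabilityMeasure μ] {v : Fin m → E} {β M T : ℝ}

omit [FiniteDimensional ℝ E] [BorelSpace E] in
theorem memLp_two (h : HasProjectionBounds μ v β M T) (j : Fin m) :
    MemLp (fun x => ⟪v j, x⟫) 2 μ := (h.memLp j).mono_exponent (by norm_num)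

omit [FiniteDimensional ℝ E] [BorelSpace E] in
theorem integrable (h : HasProjectionBounds μ v β M T) (j : Fin m) :
    Integrable (fun x => ⟪v j, x⟫) μ := (h.memLp_two j).integrable one_le_two

omit [FiniteDimensional ℝ E] [BorelSpace E] in
theorem integrable_mul (h : HasProjectionBounds μ v β M T) (j k : Fin m) :
    Integrable (fun x => ⟪v j, x⟫ * ⟪v k, x⟫) μ := (h.memLp_two j).integrable_mul (h.memLp_two k)

omit [FiniteDimensional ℝ E] [BorelSpace E] [IsProbabilityMeasure μ] in
theorem integrable_abs_pow (h : HasProjectionBounds μ v β M T) (j : Fin m) :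
    Integrable (fun x => |⟪v j, x⟫| ^ 3) μ := by
  simpa using (h.memLp j).integrable_norm_pow (by norm_num)

omit [FiniteDimensional ℝ E] in
theorem integrable_tail (h : HasProjectionBounds μ v β M T) (j : Fin m) :
    Integrable (fun x => if 1 < |β * ⟪v j, x⟫| then (β * ⟪v j, x⟫) ^ 2 else 0) μ := by
  have := ((h.memLp_two j).const_mul β).integrable_sq
  refine this.mono' ?_ (Filter.Eventually.of_forall fun x => ?_)
  · refine Measurable.aestronglyMeasurable ?_
    exact Measurable.ite (measurableSet_lt measurable_const (by fun_prop)) (by fun_prop)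
      measurable_const
  · split_ifs
    · rw [Real.norm_eq_abs, abs_of_nonneg (sq_nonneg _)]
    · simp only [norm_zero]; positivity

end HasProjectionBounds

omit [FiniteDimensional ℝ E] [BorelSpace E] [MeasurableSpace E] in
theorem integral_softMean {Ω : Type*} [MeasurableSpace Ω] {μ : Measure Ω} (z : Fin m → ℝ)
    {F : Fin m → Ω → ℝ} (hF : ∀ j, Integrable (F j) μ) :
    ∫ x, softMean z (fun j => F j x) ∂μ = softMean z fun j => ∫ x, F j x ∂μ := by
  unfold softMean
  rw [integral_div, integral_finsetSum _ fun j _ => (hF j).const_mul _]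
  simp_rw [integral_const_mul]

omit [FiniteDimensional ℝ E] [BorelSpace E] [MeasurableSpace E] in
theorem integrable_softMean {Ω : Type*} [MeasurableSpace Ω] {μ : Measure Ω} (z : Fin m → ℝ)
    {F : Fin m → Ω → ℝ} (hF : ∀ j, Integrable (F j) μ) :
    Integrable (fun x => softMean z (fun j => F j x)) μ :=
  (integrable_finsetSum _ fun j _ => (hF j).const_mul _).div_const _

/-- The square becomes linear in the products `a j * a k`, so its expectation involves only second
moments. -/
theorem softMean_sq (z a : Fin m → ℝ) :
    softMean z a ^ 2 = softMean z fun j => softMean z fun k => a j * a k := by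
  simp_rw [softMean_const_mul]
  simp_rw [mul_comm (a _), softMean_const_mul, pow_two]

variable {μ ν τ : Measure E} [IsProbabilityMeasure μ] [IsProbabilityMeasure ν]
  [IsProbabilityMeasure τ] {v : Fin m → E} {β M T : ℝ}

omit [FiniteDimensional ℝ E] [BorelSpace E] [MeasurableSpace E] in
theorem integrable_and_integral_affine_combination {Ω : Type*} [MeasurableSpace Ω] {μ : Measure Ω}
    [IsProbabilityMeasure μ] {F₁ F₂ F₃ : Ω → ℝ} (i₁ : Integrable F₁ μ)
    (i₂ : Integrable F₂ μ) (i₃ : Integrable F₃ μ) (c₀ c₁ c₂ c₃ : ℝ) :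
    Integrable (fun x => c₀ + c₁ * F₁ x + (c₂ * F₂ x + c₃ * (F₃ x - F₂ x)) / 2) μ ∧
    ∫ x, (c₀ + c₁ * F₁ x + (c₂ * F₂ x + c₃ * (F₃ x - F₂ x)) / 2) ∂μ =
      c₀ + c₁ * ∫ x, F₁ x ∂μ +
        (c₂ * ∫ x, F₂ x ∂μ + c₃ * (∫ x, F₃ x ∂μ - ∫ x, F₂ x ∂μ)) / 2 := by
  have j1 : Integrable (fun x => c₀ + c₁ * F₁ x) μ := (integrable_const c₀).add (i₁.const_mul c₁)
  have j3 : Integrable (fun x => c₃ * (F₃ x - F₂ x)) μ := (i₃.sub i₂).const_mul c₃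
  have j2 : Integrable (fun x => c₂ * F₂ x + c₃ * (F₃ x - F₂ x)) μ := (i₂.const_mul c₂).add j3
  refine ⟨j1.add (j2.div_const 2), ?_⟩
  rw [integral_add j1 (j2.div_const 2), integral_add (integrable_const c₀) (i₁.const_mul c₁),
    integral_div, integral_add (i₂.const_mul c₂) j3, integral_const_mul, integral_const_mul,
    integral_const_mul, integral_sub i₃ i₂, integral_const, probReal_univ, one_smul]

omit [FiniteDimensional ℝ E] [BorelSpace E] in
theorem integrable_quadratic (z : Fin m → ℝ)
    (hμ : HasProjectionBounds μ v β M T) (c₀ c₁ c₂ c₃ : ℝ) :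
    Integrable (fun x => c₀ + c₁ * softMean z (fun j => β * ⟪v j, x⟫) +
      (c₂ * softMean z (fun j => β * ⟪v j, x⟫) ^ 2 +
        c₃ * (softMean z (fun j => (β * ⟪v j, x⟫) ^ 2) -
          softMean z (fun j => β * ⟪v j, x⟫) ^ 2)) / 2) μ ∧
    ∫ x, (c₀ + c₁ * softMean z (fun j => β * ⟪v j, x⟫) +
      (c₂ * softMean z (fun j => β * ⟪v j, x⟫) ^ 2 +
        c₃ * (softMean z (fun j => (β * ⟪v j, x⟫) ^ 2) -
          softMean z (fun j => β * ⟪v j, x⟫) ^ 2)) / 2) ∂μ =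
      c₀ + c₁ * softMean z (fun j => β * ∫ x, ⟪v j, x⟫ ∂μ) +
      (c₂ * softMean z (fun j => softMean z fun k => β ^ 2 * ∫ x, ⟪v j, x⟫ * ⟪v k, x⟫ ∂μ) +
        c₃ * (softMean z (fun j => β ^ 2 * ∫ x, ⟪v j, x⟫ * ⟪v j, x⟫ ∂μ) -
          softMean z (fun j => softMean z fun k => β ^ 2 * ∫ x, ⟪v j, x⟫ * ⟪v k, x⟫ ∂μ))) / 2 := by
  have e : ∀ j k x, β * ⟪v j, x⟫ * (β * ⟪v k, x⟫) = β ^ 2 * (⟪v j, x⟫ * ⟪v k, x⟫) :=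
    fun j k x => by ring
  have e' : ∀ j x, (β * ⟪v j, x⟫) ^ 2 = β ^ 2 * (⟪v j, x⟫ * ⟪v j, x⟫) := fun j x => by ring
  simp_rw [softMean_sq, e, e']
  have i1 := integrable_softMean z fun j => (hμ.integrable j).const_mul β
  have i2' := fun j => integrable_softMean z fun k => (hμ.integrable_mul j k).const_mul (β ^ 2)
  have i2 := integrable_softMean z i2'
  have i3 := integrable_softMean z fun j => (hμ.integrable_mul j j).const_mul (β ^ 2)
  refine (integrable_and_integral_affine_combination i1 i2 i3 c₀ c₁ c₂ c₃).imp id fun h => h.trans ?_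
  rw [integral_softMean z fun j => (hμ.integrable j).const_mul β, integral_softMean z i2',
    integral_softMean z fun j => (hμ.integrable_mul j j).const_mul (β ^ 2)]
  simp_rw [integral_softMean z fun k => (hμ.integrable_mul _ k).const_mul (β ^ 2),
    integral_const_mul]

variable [NeZero m] {g g₁ g₂ g₃ : ℝ → ℝ} {B κ : ℝ}

theorem IsSmoothStep.continuous (hg : IsSmoothStep g g₁ g₂ g₃ B) : Continuous g :=
  continuous_iff_continuousAt.2 fun t => (hg.deriv₀ t).continuousAt

omit [FiniteDimensional ℝ E] [BorelSpace E] [MeasurableSpace E] in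
theorem IsSmoothStep.continuous_comp (hg : IsSmoothStep g g₁ g₂ g₃ B) (κ β : ℝ)
    (v : Fin m → E) (b : Fin m → ℝ) :
    Continuous fun x => g (κ * logSumExp (scaledSlack β v b x)) :=
  hg.continuous.comp (continuous_const.mul (continuous_logSumExp_scaledSlack β v b))

omit [FiniteDimensional ℝ E] in
theorem IsSmoothStep.integrable_comp (hg : IsSmoothStep g g₁ g₂ g₃ B) {Ω : Type*}
    [MeasurableSpace Ω] {P : Measure Ω} [IsFiniteMeasure P] (κ β : ℝ) (v : Fin m → E)
    (b : Fin m → ℝ) {X : Ω → E} (hX : Measurable X) :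
    Integrable (fun ω => g (κ * logSumExp (scaledSlack β v b (X ω)))) P := by
  refine Integrable.of_bound (C := 1)
    ((hg.continuous_comp κ β v b).measurable.comp hX).aestronglyMeasurable
    (Filter.Eventually.of_forall fun ω => ?_)
  rw [Real.norm_eq_abs, abs_of_nonneg (hg.nonneg _)]
  exact hg.le_one _

omit [FiniteDimensional ℝ E] in
-- The subtracted expression depends on `μ` only through first and second moments of the
-- projections, so it cancels between two laws matching in these.
theorem abs_integral_translate_sub_quadratic_le (hg : IsSmoothStep g g₁ g₂ g₃ B) (hκ : 0 ≤ κ)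
    (hκ1 : κ ≤ 1) (hβ : 0 ≤ β) (hμ : HasProjectionBounds μ v β M T) (b : Fin m → ℝ) (x : E)
    {z : Fin m → ℝ} (hz : z = scaledSlack β v b x) :
    |∫ y, g (κ * logSumExp (scaledSlack β v b (x + y))) ∂μ -
      (g (κ * logSumExp z) + κ * g₁ (κ * logSumExp z) *
        softMean z (fun j => β * ∫ x, ⟪v j, x⟫ ∂μ) +
      (κ ^ 2 * g₂ (κ * logSumExp z) *
        softMean z (fun j => softMean z fun k => β ^ 2 * ∫ x, ⟪v j, x⟫ * ⟪v k, x⟫ ∂μ) +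
        κ * g₁ (κ * logSumExp z) * (softMean z (fun j => β ^ 2 * ∫ x, ⟪v j, x⟫ * ⟪v j, x⟫ ∂μ) -
          softMean z (fun j => softMean z fun k => β ^ 2 * ∫ x, ⟪v j, x⟫ * ⟪v k, x⟫ ∂μ))) / 2)| ≤
    13 * Real.exp 2 * B * (κ * β ^ 3 * M * (Set.Icc (-1) 2).indicator 1 (κ * logSumExp z) +
      m * T) := by
  have hB0 : 0 ≤ B := zero_le_one.trans hg.one_le
  obtain ⟨hq, hqe⟩ := integrable_quadratic z hμ (g (κ * logSumExp z)) (κ * g₁ (κ * logSumExp z))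
    (κ ^ 2 * g₂ (κ * logSumExp z)) (κ * g₁ (κ * logSumExp z))
  have hf := hg.integrable_comp (P := μ) κ β v b (measurable_const_add x)
  have hind0 : 0 ≤ (Set.Icc (-1 : ℝ) 2).indicator (1 : ℝ → ℝ) (κ * logSumExp z) :=
    Set.indicator_nonneg (fun _ _ => zero_le_one) _
  rw [← hqe, ← integral_sub hf hq]
  have e3 : ∀ j y, |β * ⟪v j, y⟫| ^ 3 = β ^ 3 * |⟪v j, y⟫| ^ 3 := fun j y => by
    rw [abs_mul, mul_pow, abs_of_nonneg hβ]
  have i3 := fun j => (hμ.integrable_abs_pow j).const_mul (β ^ 3)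
  have i3' := (integrable_softMean z i3).const_mul
    (κ * (Set.Icc (-1) 2).indicator 1 (κ * logSumExp z))
  have i4 := integrable_finsetSum Finset.univ fun j _ => hμ.integrable_tail j
  calc _ ≤ ∫ y, 13 * Real.exp 2 * B * (κ * (Set.Icc (-1) 2).indicator 1 (κ * logSumExp z) *
      softMean z (fun j => β ^ 3 * |⟪v j, y⟫| ^ 3) +
      ∑ j, if 1 < |β * ⟪v j, y⟫| then (β * ⟪v j, y⟫) ^ 2 else 0) ∂μ := by
        rw [← Real.norm_eq_abs]
        refine norm_integral_le_of_norm_le ((i3'.add i4).const_mul _)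
          (Filter.Eventually.of_forall fun y => ?_)
        have := hg.abs_sub_taylor_le hκ hκ1 z fun j => β * ⟪v j, y⟫
        simp_rw [e3] at this
        rw [Real.norm_eq_abs, scaledSlack_add, ← hz]
        refine le_trans (le_of_eq ?_) this
        congr 1; ring
    _ = 13 * Real.exp 2 * B * (κ * (Set.Icc (-1) 2).indicator 1 (κ * logSumExp z) *
          softMean z (fun j => β ^ 3 * ∫ y, |⟪v j, y⟫| ^ 3 ∂μ) +
          ∑ j, ∫ y, (if 1 < |β * ⟪v j, y⟫| then (β * ⟪v j, y⟫) ^ 2 else 0) ∂μ) := by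
        rw [integral_const_mul, integral_add i3' i4, integral_const_mul, integral_softMean z i3,
          integral_finsetSum Finset.univ fun j _ => hμ.integrable_tail j]
        simp_rw [integral_const_mul]
    _ ≤ 13 * Real.exp 2 * B * (κ * (Set.Icc (-1) 2).indicator 1 (κ * logSumExp z) *
          (β ^ 3 * M) + m * T) := by
        gcongr
        · rw [← softMean_const z (β ^ 3 * M)]
          exact softMean_mono z fun j => mul_le_mul_of_nonneg_left (hμ.third j) (by positivity)
        · calc _ ≤ ∑ j : Fin m, T := by gcongr with j; exact hμ.tail j
            _ = m * T := by simp
    _ = _ := by ring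

theorem integral_conv_eq (τ μ : Measure E) [IsProbabilityMeasure τ] [IsProbabilityMeasure μ]
    {f : E → ℝ} (hf : Continuous f) (hb : ∀ x, ‖f x‖ ≤ 1) :
    ∫ x, f x ∂(τ ∗ μ) = ∫ x, ∫ y, f (x + y) ∂μ ∂τ := by
  rw [Measure.conv, integral_map (by fun_prop) hf.aestronglyMeasurable, integral_prod]
  refine Integrable.of_bound (C := 1) (Continuous.aestronglyMeasurable (by fun_prop))
    (Filter.Eventually.of_forall fun p => hb _)

/-- One step of the replacement method, with the error localized near the boundary. -/
theorem abs_integral_conv_sub_integral_conv_le (hg : IsSmoothStep g g₁ g₂ g₃ B) (hκ : 0 ≤ κ)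
    (hκ1 : κ ≤ 1) (hβ : 0 ≤ β) (hμ : HasProjectionBounds μ v β M T)
    (hν : HasProjectionBounds ν v β M T)
    (h₁ : ∀ j, ∫ x, ⟪v j, x⟫ ∂μ = ∫ x, ⟪v j, x⟫ ∂ν)
    (h₂ : ∀ j k, ∫ x, ⟪v j, x⟫ * ⟪v k, x⟫ ∂μ = ∫ x, ⟪v j, x⟫ * ⟪v k, x⟫ ∂ν) (b : Fin m → ℝ) :
    |∫ x, g (κ * logSumExp (scaledSlack β v b x)) ∂(τ ∗ μ) -
      ∫ x, g (κ * logSumExp (scaledSlack β v b x)) ∂(τ ∗ ν)| ≤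
    26 * Real.exp 2 * B * (κ * β ^ 3 * M *
      τ.real {x | κ * logSumExp (scaledSlack β v b x) ∈ Set.Icc (-1 : ℝ) 2} + m * T) := by
  have hc := hg.continuous_comp κ β v b
  have hb : ∀ x, ‖g (κ * logSumExp (scaledSlack β v b x))‖ ≤ 1 := fun x => by
    rw [Real.norm_eq_abs, abs_of_nonneg (hg.nonneg _)]; exact hg.le_one _
  have hint : ∀ (ρ : Measure E) [IsProbabilityMeasure ρ],
      Integrable (fun x => ∫ y, g (κ * logSumExp (scaledSlack β v b (x + y))) ∂ρ) τ := by
    intro ρ _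
    refine Integrable.integral_prod_left (μ := τ) (ν := ρ)
      (f := fun p : E × E => g (κ * logSumExp (scaledSlack β v b (p.1 + p.2)))) ?_
    exact hg.integrable_comp κ β v b (by fun_prop)
  rw [integral_conv_eq τ μ hc hb, integral_conv_eq τ ν hc hb, ← integral_sub (hint μ) (hint ν)]
  have hWm : MeasurableSet {x | κ * logSumExp (scaledSlack β v b x) ∈ Set.Icc (-1 : ℝ) 2} :=
    ((continuous_const.mul (continuous_logSumExp_scaledSlack β v b)).measurable measurableSet_Icc)
  set W := {x | κ * logSumExp (scaledSlack β v b x) ∈ Set.Icc (-1 : ℝ) 2} with hW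
  have hWi : Integrable (W.indicator (1 : E → ℝ)) τ := (integrable_const 1).indicator hWm
  have hWe : ∀ x, (Set.Icc (-1 : ℝ) 2).indicator (1 : ℝ → ℝ)
      (κ * logSumExp (scaledSlack β v b x)) = W.indicator (1 : E → ℝ) x := fun x => by
    simp only [Set.indicator, hW, Set.mem_ofPred_eq, Pi.one_apply]
  calc _ ≤ ∫ x, 26 * Real.exp 2 * B * (κ * β ^ 3 * M * W.indicator 1 x + m * T) ∂τ := by
        rw [← Real.norm_eq_abs]
        refine norm_integral_le_of_norm_le
          (((hWi.const_mul _).add (integrable_const _)).const_mul _)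
          (Filter.Eventually.of_forall fun x => ?_)
        -- The Taylor polynomials for `μ` and `ν` agree; the two remainders add up to `26 = 2 * 13`.
        have a1 := abs_integral_translate_sub_quadratic_le hg hκ hκ1 hβ hμ b x rfl
        have a2 := abs_integral_translate_sub_quadratic_le hg hκ hκ1 hβ hν b x rfl
        simp_rw [h₁, h₂] at a1
        rw [hWe] at a1 a2
        rw [Real.norm_eq_abs]
        rw [abs_le] at a1 a2 ⊢
        constructor <;> linarith
    _ = _ := by
        rw [integral_const_mul, integral_add (hWi.const_mul _) (integrable_const _),
          integral_const_mul, integral_indicator_one hWm, integral_const, probReal_univ, one_smul]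

omit [NeZero m] in
-- Union bound: the tail integrand is at least one wherever a projection is large.
theorem half_le_measureReal_projections_le (hμ : HasProjectionBounds μ v β M T)
    (hT : m * T ≤ 1 / 2) : 1 / 2 ≤ μ.real {y | ∀ j, |β * ⟪v j, y⟫| ≤ 1} := by
  have hm : MeasurableSet {y | ∀ j, |β * ⟪v j, y⟫| ≤ 1} := by
    simp only [Set.ofPred_forall]
    exact MeasurableSet.iInter fun j => measurableSet_le (by fun_prop) (by fun_prop)
  have h1 : μ.real {y | ∀ j, |β * ⟪v j, y⟫| ≤ 1}ᶜ ≤ 1 / 2 := by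
    calc _ = ∫ y, {y | ∀ j, |β * ⟪v j, y⟫| ≤ 1}ᶜ.indicator 1 y ∂μ :=
          (integral_indicator_one hm.compl).symm
      _ ≤ ∫ y, ∑ j, (if 1 < |β * ⟪v j, y⟫| then (β * ⟪v j, y⟫) ^ 2 else 0) ∂μ := by
          refine integral_mono ((integrable_const 1).indicator hm.compl)
            (integrable_finsetSum _ fun j _ => hμ.integrable_tail j) fun y => ?_
          dsimp only
          have h0 : ∀ j, 0 ≤ (if 1 < |β * ⟪v j, y⟫| then (β * ⟪v j, y⟫) ^ 2 else 0) := fun j => by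
            split_ifs <;> positivity
          refine Set.indicator_apply_le' (fun hy => ?_) fun _ => Finset.sum_nonneg fun j _ => h0 j
          simp only [Set.mem_compl_iff, Set.mem_ofPred_eq, not_forall, not_le] at hy
          obtain ⟨j, hj⟩ := hy
          refine le_trans ?_ (Finset.single_le_sum (fun j _ => h0 j) (Finset.mem_univ j))
          rw [if_pos hj, ← sq_abs, Pi.one_apply]
          exact one_le_pow₀ hj.le
      _ = ∑ j, ∫ y, (if 1 < |β * ⟪v j, y⟫| then (β * ⟪v j, y⟫) ^ 2 else 0) ∂μ :=
          integral_finsetSum _ fun j _ => hμ.integrable_tail j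
      _ ≤ ∑ j : Fin m, T := by gcongr with j; exact hμ.tail j
      _ = m * T := by simp
      _ ≤ 1 / 2 := hT
  rw [probReal_compl_eq_one_sub hm] at h1
  linarith

/-- The window concerns the sum without one summand. Adding back an independent summand, small with
probability at least `1 / 2`, keeps the point in a slightly larger shell, so the full law of the
hybrid controls the window at the cost of a factor two. -/
theorem measureReal_window_le (hκ : 0 < κ) (hκ1 : κ ≤ 1) (hβ : 0 < β)
    (hμ : HasProjectionBounds μ v β M T) (hT : m * T ≤ 1 / 2) {d : ℝ}
    (hd : κ * Real.log m ≤ d) (b : Fin m → ℝ) :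
    τ.real {x | κ * logSumExp (scaledSlack β v b x) ∈ Set.Icc (-1 : ℝ) 2} ≤
      2 * ((τ ∗ μ).real (polyhedron v fun j => b j + 3 / (κ * β)) -
        (τ ∗ μ).real (polyhedron v fun j => b j - (3 + d) / (κ * β))) := by
  have hd0 : 0 ≤ d := le_trans (mul_nonneg hκ.le (Real.log_natCast_nonneg m)) hd
  have hκβ : 0 < κ * β := mul_pos hκ hβ
  have h3 : 0 ≤ 3 / (κ * β) := by positivity
  have h3d : 0 ≤ (3 + d) / (κ * β) := by positivity
  set W := {x | κ * logSumExp (scaledSlack β v b x) ∈ Set.Icc (-1 : ℝ) 2} with hW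
  set Y := {y | ∀ j, |β * ⟪v j, y⟫| ≤ 1} with hY
  rw [← measureReal_sdiff (polyhedron_mono v fun j => by linarith) (measurableSet_polyhedron v _)]
  set A := (polyhedron v fun j => b j + 3 / (κ * β)) \
    (polyhedron v fun j => b j - (3 + d) / (κ * β)) with hA
  have hAm : MeasurableSet A := (measurableSet_polyhedron v _).diff (measurableSet_polyhedron v _)
  -- In units of `1 / (κ * β)`: each slack of `x` is at most `2` and that of `y` adds at most `1`.
  -- If all slacks of `x + y` were at most `-(3 + d)`, then `κ * logSumExp` at `x` would be at most
  -- `1 - (3 + d) + d = -2`, below the window.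
  have hsub : W ×ˢ Y ⊆ (fun p : E × E => p.1 + p.2) ⁻¹' A := by
    rintro ⟨x, y⟩ ⟨hx, hy⟩
    simp only at hx hy
    constructor
    · intro j
      have h1 : κ * (β * (⟪v j, x⟫ - b j)) ≤ 2 :=
        (mul_le_mul_of_nonneg_left (le_logSumExp (scaledSlack β v b x) j) hκ.le).trans hx.2
      have h2 : κ * (β * ⟪v j, y⟫) ≤ 1 :=
        (mul_le_mul_of_nonneg_left ((le_abs_self _).trans (hy j)) hκ.le).trans (by linarith)
      have : (⟪v j, x⟫ + ⟪v j, y⟫ - b j) ≤ 3 / (κ * β) := by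
        rw [le_div_iff₀ hκβ]; linarith
      dsimp only
      rw [inner_add_right]; linarith
    · intro hp
      have h1 : logSumExp (scaledSlack β v b x) ≤ (1 - (3 + d) / κ) + Real.log m := by
        refine logSumExp_le fun j => ?_
        have h2 := hp j
        have h3 := (abs_le.1 (hy j)).1
        dsimp only at h2
        rw [inner_add_right] at h2
        have h4 := mul_le_mul_of_nonneg_left h2 hβ.le
        have h5 : β * ((3 + d) / (κ * β)) = (3 + d) / κ := by field_simp
        rw [mul_sub, h5] at h4
        simp only [scaledSlack]
        linarith
      have h2 := mul_le_mul_of_nonneg_left h1 hκ.le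
      rw [mul_add, mul_sub, mul_div_cancel₀ _ hκ.ne'] at h2
      linarith [hx.1]
  have key : τ.real W * μ.real Y ≤ (τ ∗ μ).real A := by
    rw [← measureReal_prod_prod, Measure.conv, map_measureReal_apply (by fun_prop) hAm]
    exact measureReal_mono hsub
  have := half_le_measureReal_projections_le hμ hT
  have h0 := measureReal_nonneg (μ := τ) (s := W)
  nlinarith

end Lindeberg

/-! ### The chain of hybrid sums and the absorption of the discrepancy. -/

section Hybrid

variable {E : Type*} [NormedAddCommGroup E] [InnerProductSpace ℝ E] [FiniteDimensional ℝ E]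
  [MeasurableSpace E] [BorelSpace E] {m : ℕ} [NeZero m]
  {g g₁ g₂ g₃ : ℝ → ℝ} {B κ β d : ℝ}

omit [FiniteDimensional ℝ E] in
-- Log-sum-exp exceeds the maximum by at most `log m`; relaxing the offsets by `d / (κ * β)`
-- compensates for this.
theorem measureReal_polyhedron_le_integral (hg : IsSmoothStep g g₁ g₂ g₃ B) (hκ : 0 < κ)
    (hβ : 0 < β) (hd : κ * Real.log m ≤ d) (v : Fin m → E) (b : Fin m → ℝ) (μ : Measure E)
    [IsProbabilityMeasure μ] :
    μ.real (polyhedron v b) ≤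
      ∫ x, g (κ * logSumExp (scaledSlack β v (fun j => b j + d / (κ * β)) x)) ∂μ := by
  rw [← integral_indicator_one (measurableSet_polyhedron v b)]
  refine integral_mono ((integrable_const 1).indicator (measurableSet_polyhedron v b))
    (hg.integrable_comp κ β v _ measurable_id) fun x => ?_
  refine Set.indicator_apply_le' (fun hx => ?_) fun _ => hg.nonneg _
  rw [hg.eq_one, Pi.one_apply]
  have h1 : logSumExp (scaledSlack β v (fun j => b j + d / (κ * β)) x) ≤
      -(d / κ) + Real.log m := by
    refine logSumExp_le fun j => ?_
    have h5 : β * (d / (κ * β)) = d / κ := by field_simp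
    have h6 := mul_le_mul_of_nonneg_left (hx j) hβ.le
    simp only [scaledSlack]
    rw [mul_sub, mul_add, h5]
    linarith
  have h2 := mul_le_mul_of_nonneg_left h1 hκ.le
  rw [mul_add, mul_neg, mul_div_cancel₀ _ hκ.ne'] at h2
  linarith

omit [FiniteDimensional ℝ E] in
theorem integral_le_measureReal_polyhedron (hg : IsSmoothStep g g₁ g₂ g₃ B) (hκ : 0 < κ)
    (hβ : 0 < β) (v : Fin m → E) (b : Fin m → ℝ) (μ : Measure E) [IsProbabilityMeasure μ] :
    ∫ x, g (κ * logSumExp (scaledSlack β v b x)) ∂μ ≤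
      μ.real (polyhedron v fun j => b j + 1 / (κ * β)) := by
  have hm := measurableSet_polyhedron v fun j => b j + 1 / (κ * β)
  rw [← integral_indicator_one hm]
  refine integral_mono (hg.integrable_comp κ β v b measurable_id)
    ((integrable_const 1).indicator hm) fun x => ?_
  by_cases hx : x ∈ polyhedron v fun j => b j + 1 / (κ * β)
  · rw [Set.indicator_of_mem hx, Pi.one_apply]; exact hg.le_one _
  · rw [Set.indicator_of_notMem hx, hg.eq_zero]
    simp only [polyhedron, Set.mem_ofPred_eq, not_forall, not_le] at hx
    obtain ⟨j, hj⟩ := hx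
    have h1 := mul_le_mul_of_nonneg_left (le_logSumExp (scaledSlack β v b x) j) hκ.le
    refine le_trans ?_ h1
    have h2 := mul_le_mul_of_nonneg_left hj.le (mul_pos hκ hβ).le
    rw [mul_add, mul_div_cancel₀ _ (mul_pos hκ hβ).ne'] at h2
    simp only [scaledSlack]
    linarith

/-- Comparison of the first and the last of a chain of measures, consecutive ones of which differ
by the replacement of one summand. -/
theorem abs_measureReal_polyhedron_sub_le_of_chain (hg : IsSmoothStep g g₁ g₂ g₃ B) (hκ : 0 < κ)
    (hκ1 : κ ≤ 1) (hβ : 0 < β) (hd : κ * Real.log m ≤ d) {v : Fin m → E} {M T Λ : ℝ} (hM : 0 ≤ M)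
    (hT : m * T ≤ 1 / 2) {n : ℕ} (D τ μ ν : ℕ → Measure E) [∀ i, IsProbabilityMeasure (D i)]
    [∀ i, IsProbabilityMeasure (τ i)] [∀ i, IsProbabilityMeasure (μ i)]
    [∀ i, IsProbabilityMeasure (ν i)]
    (hD : ∀ i < n, D i = τ i ∗ μ i) (hD' : ∀ i < n, D (i + 1) = τ i ∗ ν i)
    (hμ : ∀ i < n, HasProjectionBounds (μ i) v β M T)
    (hν : ∀ i < n, HasProjectionBounds (ν i) v β M T)
    (h₁ : ∀ i < n, ∀ j, ∫ x, ⟪v j, x⟫ ∂(μ i) = ∫ x, ⟪v j, x⟫ ∂(ν i))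
    (h₂ : ∀ i < n, ∀ j k, ∫ x, ⟪v j, x⟫ * ⟪v k, x⟫ ∂(μ i) = ∫ x, ⟪v j, x⟫ * ⟪v k, x⟫ ∂(ν i))
    (hΛ : 0 ≤ Λ)
    (hanti : ∀ (b : Fin m → ℝ) (ε : ℝ), 0 ≤ ε →
      (D n).real (polyhedron v fun j => b j + ε) - (D n).real (polyhedron v b) ≤ Λ * ε)
    (hsmall : n * (26 * Real.exp 2 * B * (κ * β ^ 3 * M)) ≤ 1 / 8) (b : Fin m → ℝ) :
    |(D 0).real (polyhedron v b) - (D n).real (polyhedron v b)| ≤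
      Λ * ((5 + 3 * d) / (κ * β)) + 2 * (n * (26 * Real.exp 2 * B * (m * T))) := by
  have hB0 : 0 ≤ B := zero_le_one.trans hg.one_le
  have hd0 : 0 ≤ d := le_trans (mul_nonneg hκ.le (Real.log_natCast_nonneg m)) hd
  have hκβ : 0 < κ * β := mul_pos hκ hβ
  -- The supremum runs over all hybrids and all offsets, because the window bound for one hybrid
  -- calls on its discrepancy at other offsets.
  set S : Set ℝ := {r | ∃ i ≤ n, ∃ b : Fin m → ℝ,
    r = |(D i).real (polyhedron v b) - (D n).real (polyhedron v b)|} with hS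
  have hSb : BddAbove S := by
    refine ⟨1, ?_⟩
    rintro r ⟨i, -, b, rfl⟩
    have := measureReal_le_one (μ := D i) (s := polyhedron v b)
    have := measureReal_le_one (μ := D n) (s := polyhedron v b)
    have := measureReal_nonneg (μ := D i) (s := polyhedron v b)
    have := measureReal_nonneg (μ := D n) (s := polyhedron v b)
    rw [abs_le]; constructor <;> linarith
  set ρ := sSup S with hρ
  have hρle : ∀ i ≤ n, ∀ b : Fin m → ℝ,
      |(D i).real (polyhedron v b) - (D n).real (polyhedron v b)| ≤ ρ :=
    fun i hi b => le_csSup hSb ⟨i, hi, b, rfl⟩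
  set F : (Fin m → ℝ) → ℕ → ℝ :=
    fun b i => ∫ x, g (κ * logSumExp (scaledSlack β v b x)) ∂(D i) with hF
  set η := 26 * Real.exp 2 * B * (κ * β ^ 3 * M) with hη
  set ζ := 26 * Real.exp 2 * B * (m * T) with hζ
  set ω := 2 * (Λ * ((6 + d) / (κ * β)) + 2 * ρ) with hω
  have hstep : ∀ (b : Fin m → ℝ), ∀ i < n, |F b i - F b (i + 1)| ≤ η * ω + ζ := by
    intro b i hi
    have h := abs_integral_conv_sub_integral_conv_le (τ := τ i) hg hκ.le hκ1 hβ.le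
      (hμ i hi) (hν i hi) (h₁ i hi) (h₂ i hi) b
    rw [← hD i hi, ← hD' i hi] at h
    refine h.trans ?_
    have hw := measureReal_window_le (τ := τ i) hκ hκ1 hβ (hμ i hi) hT hd b
    rw [← hD i hi] at hw
    have a1 := abs_le.1 (hρle i hi.le fun j => b j + 3 / (κ * β))
    have a2 := abs_le.1 (hρle i hi.le fun j => b j - (3 + d) / (κ * β))
    have a3 := hanti (fun j => b j - (3 + d) / (κ * β)) ((6 + d) / (κ * β)) (by positivity)
    have e : (fun j => b j - (3 + d) / (κ * β) + (6 + d) / (κ * β)) =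
        fun j => b j + 3 / (κ * β) := by ext j; ring
    rw [e] at a3
    -- A shell of the hybrid is a shell of the final law, bounded by `hanti`, up to `ρ` at each of
    -- its two boundaries.
    have hw' : (τ i).real {x | κ * logSumExp (scaledSlack β v b x) ∈ Set.Icc (-1 : ℝ) 2} ≤ ω := by
      linarith
    have := mul_le_mul_of_nonneg_left hw' (by positivity : 0 ≤ η)
    rw [hη] at this
    rw [hη, hζ]
    linarith
  have htel : ∀ (b : Fin m → ℝ), ∀ i ≤ n, |F b i - F b n| ≤ n * (η * ω + ζ) := by
    intro b i hi
    rcases hi.eq_or_lt with rfl | hi'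
    · rw [sub_self, abs_zero]
      rcases Nat.eq_zero_or_pos i with rfl | h0
      · simp
      · have := (abs_nonneg _).trans (hstep b (i - 1) (by omega))
        positivity
    have h0 := (abs_nonneg _).trans (hstep b i hi')
    have h := dist_le_Ico_sum_of_dist_le (f := F b) (d := fun _ => η * ω + ζ) hi
      fun {k} _ hk => by rw [Real.dist_eq]; exact hstep b k hk
    rw [Real.dist_eq, Finset.sum_const, Nat.card_Ico, nsmul_eq_mul] at h
    refine h.trans (mul_le_mul_of_nonneg_right ?_ h0)
    exact_mod_cast Nat.sub_le n i
  have hmain : ∀ i ≤ n, ∀ b : Fin m → ℝ,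
      |(D i).real (polyhedron v b) - (D n).real (polyhedron v b)| ≤
        Λ * ((1 + d) / (κ * β)) + n * (η * ω + ζ) := by
    intro i hi b
    have u1 := measureReal_polyhedron_le_integral hg hκ hβ hd v b (D i)
    have u2 := (abs_le.1 (htel (fun j => b j + d / (κ * β)) i hi)).2
    have u3 := integral_le_measureReal_polyhedron hg hκ hβ v (fun j => b j + d / (κ * β)) (D n)
    have u4 := hanti b ((1 + d) / (κ * β)) (by positivity)
    have e1 : (fun j => b j + d / (κ * β) + 1 / (κ * β)) =
        fun j => b j + (1 + d) / (κ * β) := by ext j; ring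
    rw [e1] at u3
    have l1 := integral_le_measureReal_polyhedron hg hκ hβ v (fun j => b j - 1 / (κ * β)) (D i)
    have l2 := (abs_le.1 (htel (fun j => b j - 1 / (κ * β)) i hi)).1
    have l3 := measureReal_polyhedron_le_integral hg hκ hβ hd v
      (fun j => b j - (1 + d) / (κ * β)) (D n)
    have l4 := hanti (fun j => b j - (1 + d) / (κ * β)) ((1 + d) / (κ * β)) (by positivity)
    have e2 : (fun j => b j - (1 + d) / (κ * β) + d / (κ * β)) =
        fun j => b j - 1 / (κ * β) := by ext j; ring
    rw [e2] at l3
    simp only [sub_add_cancel] at l1 l4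
    rw [abs_le]
    constructor <;> linarith
  have hρ' : ρ ≤ Λ * ((1 + d) / (κ * β)) + n * (η * ω + ζ) := by
    refine csSup_le ⟨_, 0, Nat.zero_le n, b, rfl⟩ ?_
    rintro r ⟨i, hi, b, rfl⟩
    exact hmain i hi b
  have hω0 : 0 ≤ ω := by
    have : 0 ≤ ρ := (abs_nonneg _).trans (hρle 0 (Nat.zero_le n) b)
    positivity
  -- With `s = Λ / (κ * β)`, `ω / 8` equals `s * (6 + d) / 4 + ρ / 2`. Moving `ρ / 2` to the left
  -- and doubling gives `s * (5 + 5 * d / 2)`, within the stated `5 + 3 * d`.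
  have hnω : n * η * ω ≤ 1 / 8 * ω := mul_le_mul_of_nonneg_right hsmall hω0
  refine (hρle 0 (Nat.zero_le n) b).trans ?_
  have e1 : Λ * ((1 + d) / (κ * β)) = Λ / (κ * β) * (1 + d) := by ring
  have e2 : Λ * ((6 + d) / (κ * β)) = Λ / (κ * β) * (6 + d) := by ring
  have e3 : Λ * ((5 + 3 * d) / (κ * β)) = Λ / (κ * β) * (5 + 3 * d) := by ring
  have h0 : 0 ≤ Λ / (κ * β) * d := by positivity
  rw [e2] at hω
  rw [e1] at hρ'
  rw [e3]
  nlinarith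

/-- The law of a sum of independent vectors with laws `μ 0, …, μ (n - 1)`. -/
noncomputable def convRange (μ : ℕ → Measure E) : ℕ → Measure E
  | 0 => Measure.dirac 0
  | n + 1 => convRange μ n ∗ μ n

instance (μ : ℕ → Measure E) [∀ i, IsProbabilityMeasure (μ i)] (n : ℕ) :
    IsProbabilityMeasure (convRange μ n) := by
  induction n with
  | zero => exact Measure.dirac.isProbabilityMeasure
  | succ n ih => simp only [convRange]; infer_instance

theorem convRange_add (μ : ℕ → Measure E) [∀ i, IsProbabilityMeasure (μ i)] (i k : ℕ) :
    convRange μ (i + k) = convRange μ i ∗ convRange (fun l => μ (i + l)) k := by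
  induction k with
  | zero => simp [convRange]
  | succ k ih =>
    rw [← add_assoc, convRange, ih, convRange, Measure.conv_assoc]

theorem convRange_succ_left (μ : ℕ → Measure E) [∀ i, IsProbabilityMeasure (μ i)] (k : ℕ) :
    convRange μ (k + 1) = μ 0 ∗ convRange (fun l => μ (1 + l)) k := by
  rw [add_comm, convRange_add]
  simp [convRange]

/-- The law of a sum whose first `i` summands have laws `ν l` and the others have laws `μ l`. -/
noncomputable def hybridLaw (μ ν : ℕ → Measure E) (n i : ℕ) : Measure E :=
  convRange ν i ∗ convRange (fun l => μ (i + l)) (n - i)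

instance (μ ν : ℕ → Measure E) [∀ i, IsProbabilityMeasure (μ i)]
    [∀ i, IsProbabilityMeasure (ν i)] (n i : ℕ) : IsProbabilityMeasure (hybridLaw μ ν n i) := by
  unfold hybridLaw; infer_instance

/-- Together with `hybridLaw_succ_eq` this exhibits consecutive hybrids as the same law convolved
with `μ i` and with `ν i`. -/
theorem hybridLaw_eq (μ ν : ℕ → Measure E) [∀ i, IsProbabilityMeasure (μ i)]
    [∀ i, IsProbabilityMeasure (ν i)] {n i : ℕ} (hi : i < n) :
    hybridLaw μ ν n i =
      (convRange ν i ∗ convRange (fun l => μ (i + 1 + l)) (n - (i + 1))) ∗ μ i := by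
  rw [hybridLaw, show n - i = (n - (i + 1)) + 1 by omega, convRange_succ_left,
    Measure.conv_comm (μ (i + 0)), Measure.conv_assoc]
  simp only [add_zero, add_assoc]

theorem hybridLaw_succ_eq (μ ν : ℕ → Measure E) [∀ i, IsProbabilityMeasure (μ i)]
    [∀ i, IsProbabilityMeasure (ν i)] (n i : ℕ) :
    hybridLaw μ ν n (i + 1) =
      (convRange ν i ∗ convRange (fun l => μ (i + 1 + l)) (n - (i + 1))) ∗ ν i := by
  rw [hybridLaw, convRange, Measure.conv_assoc, Measure.conv_comm (ν i), ← Measure.conv_assoc]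

theorem abs_measureReal_convRange_polyhedron_sub_le (hg : IsSmoothStep g g₁ g₂ g₃ B) (hκ : 0 < κ)
    (hκ1 : κ ≤ 1) (hβ : 0 < β) (hd : κ * Real.log m ≤ d) {v : Fin m → E} {M T Λ : ℝ} (hM : 0 ≤ M)
    (hT : m * T ≤ 1 / 2) {n : ℕ} (μ ν : ℕ → Measure E) [∀ i, IsProbabilityMeasure (μ i)]
    [∀ i, IsProbabilityMeasure (ν i)]
    (hμ : ∀ i < n, HasProjectionBounds (μ i) v β M T)
    (hν : ∀ i < n, HasProjectionBounds (ν i) v β M T)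
    (h₁ : ∀ i < n, ∀ j, ∫ x, ⟪v j, x⟫ ∂(μ i) = ∫ x, ⟪v j, x⟫ ∂(ν i))
    (h₂ : ∀ i < n, ∀ j k, ∫ x, ⟪v j, x⟫ * ⟪v k, x⟫ ∂(μ i) = ∫ x, ⟪v j, x⟫ * ⟪v k, x⟫ ∂(ν i))
    (hΛ : 0 ≤ Λ)
    (hanti : ∀ (b : Fin m → ℝ) (ε : ℝ), 0 ≤ ε → (convRange ν n).real
      (polyhedron v fun j => b j + ε) - (convRange ν n).real (polyhedron v b) ≤ Λ * ε)
    (hsmall : n * (26 * Real.exp 2 * B * (κ * β ^ 3 * M)) ≤ 1 / 8) (b : Fin m → ℝ) :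
    |(convRange μ n).real (polyhedron v b) - (convRange ν n).real (polyhedron v b)| ≤
      Λ * ((5 + 3 * d) / (κ * β)) + 2 * (n * (26 * Real.exp 2 * B * (m * T))) := by
  have e0 : hybridLaw μ ν n 0 = convRange μ n := by
    simp [hybridLaw, convRange]
  have en : hybridLaw μ ν n n = convRange ν n := by
    simp [hybridLaw, convRange]
  have := abs_measureReal_polyhedron_sub_le_of_chain hg hκ hκ1 hβ hd hM hT
    (D := hybridLaw μ ν n)
    (τ := fun i => convRange ν i ∗ convRange (fun l => μ (i + 1 + l)) (n - (i + 1))) (μ := μ)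
    (ν := ν) (fun i hi => hybridLaw_eq μ ν hi) (fun i _ => hybridLaw_succ_eq μ ν n i) hμ hν h₁ h₂
    hΛ (by rwa [en]) hsmall b
  rwa [e0, en] at this

/-- The law of a sum of independent random vectors is the convolution of their laws. -/
theorem map_sum_eq_convRange {Ω : Type*} [MeasurableSpace Ω] {P : Measure Ω}
    [IsProbabilityMeasure P] {n : ℕ} {X : Fin n → Ω → E} (hX : ∀ i, AEMeasurable (X i) P)
    (hind : iIndepFun X P) (μ : ℕ → Measure E) (hμ : ∀ i : Fin n, P.map (X i) = μ i) :
    P.map (fun ω => ∑ i, X i ω) = convRange μ n := by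
  induction n with
  | zero => simp [convRange, Measure.map_const]
  | succ n ih =>
    have h1 := ih (X := fun i => X i.castSucc) (fun i => hX _)
      (hind.precomp (Fin.castSucc_injective n)) fun i => hμ i.castSucc
    have h2 : IndepFun (fun ω => ∑ i : Fin n, X i.castSucc ω) (X (Fin.last n)) P := by
      have := hind.indepFun_finsetSum_of_notMem₀ hX
        (s := Finset.univ.map Fin.castSuccEmb) (i := Fin.last n) (by simp)
      convert this using 1
      ext1 ω
      simp [Finset.sum_apply]
    have h3 := h2.map_add_eq_map_conv_map₀ (Finset.aemeasurable_fun_sum _ fun i _ => hX _)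
      (hX (Fin.last n))
    rw [h1, hμ] at h3
    rw [convRange]
    simp_rw [Fin.sum_univ_castSucc]
    exact h3

end Hybrid

/-! ### Exponential moments of log-concave and Gaussian projections. -/

section LogConcave

open scoped ENNReal

variable {p : ℕ}

/-- Markov's inequality for the square. -/
theorem measure_lt_abs_le_of_integral_sq_le {Ω : Type*} [MeasurableSpace Ω] {μ : Measure Ω}
    [IsProbabilityMeasure μ] {f : Ω → ℝ} (hf : MemLp f 2 μ) {k s : ℝ} (hs : 0 < s)
    (hk : ∫ x, f x ^ 2 ∂μ ≤ k) : μ {x | s < |f x|} ≤ ENNReal.ofReal (k / s ^ 2) := by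
  have h := mul_meas_ge_le_integral_of_nonneg (μ := μ) (f := fun x => f x ^ 2)
    (Filter.Eventually.of_forall fun x => sq_nonneg _) hf.integrable_sq (s ^ 2)
  have h1 : μ {x | s < |f x|} ≤ μ {x | s ^ 2 ≤ f x ^ 2} := by
    refine measure_mono fun x hx => ?_
    simp only [Set.mem_ofPred_eq] at hx ⊢
    rw [← sq_abs (f x)]
    gcongr
  refine h1.trans ?_
  rw [← ofReal_measureReal]
  apply ENNReal.ofReal_le_ofReal
  rw [le_div_iff₀ (by positivity), mul_comm]
  exact h.trans hk

/-- Borell's lemma. Mixing a far set, with weight `1 / N`, with a set in the slab `|⟪v, x⟫| ≤ s`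
still lands outside the slab, since `(2 N - 1) s / N - (1 - 1 / N) s = s`. Log-concavity then bounds
the `1 / N`-th power of the mass of the far set. -/
theorem IsLogConcaveMeasure.measure_lt_abs_inner_le {μ : Measure (EuclideanSpace ℝ (Fin p))}
    [IsProbabilityMeasure μ] (hμ : IsLogConcaveMeasure μ) (v : EuclideanSpace ℝ (Fin p)) {s : ℝ}
    (h : μ {x | s < |⟪v, x⟫|} ≤ 1 / 4) (N : ℕ) (hN : 0 < N) :
    μ {x | (2 * N - 1) * s < |⟪v, x⟫|} ≤ (1 / 2) ^ N := by
  have hcont : Continuous fun x : EuclideanSpace ℝ (Fin p) => |⟪v, x⟫| := by fun_prop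
  have hm : ∀ c : ℝ, MeasurableSet {x : EuclideanSpace ℝ (Fin p) | c < |⟪v, x⟫|} :=
    fun c => measurableSet_lt measurable_const hcont.measurable
  -- `N = 1` would put all the weight on one set, whereas log-concavity is assumed for weights
  -- strictly between zero and one.
  rcases (Nat.succ_le_of_lt hN).eq_or_lt' with h1 | h1
  · subst h1
    rw [show (2 * ((1 : ℕ) : ℝ) - 1) * s = s by push_cast; ring, pow_one]
    exact h.trans (ENNReal.div_le_div_left (by norm_num) 1)
  have hcompl : 1 / 2 < μ {x | s < |⟪v, x⟫|}ᶜ := by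
    rw [prob_compl_eq_one_sub (hm s)]
    refine lt_of_lt_of_le ?_ (tsub_le_tsub_left h 1)
    rw [← ENNReal.toReal_lt_toReal (by norm_num) (by simp),
      ENNReal.toReal_sub_of_le (by norm_num) (by simp)]
    norm_num
  obtain ⟨A₂, hA₂s, hA₂c, hA₂⟩ := (hm s).compl.exists_lt_isCompact hcompl
  rw [(hm _).measure_eq_iSup_isCompact]
  refine iSup₂_le fun A₁ hA₁s => iSup_le fun hA₁c => ?_
  have hN0 : (0 : ℝ) < N := by exact_mod_cast hN
  have hN1 : (1 : ℝ) < N := by exact_mod_cast h1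
  have hNinv : (N : ℝ)⁻¹ < 1 := inv_lt_one_of_one_lt₀ hN1
  have key := hμ A₁ A₂ hA₁c hA₂c (N : ℝ)⁻¹ (inv_pos.2 hN0) hNinv
  have hsub : (N : ℝ)⁻¹ • A₁ + (1 - (N : ℝ)⁻¹) • A₂ ⊆ {x | s < |⟪v, x⟫|} := by
    rintro _ ⟨_, ⟨x, hx, rfl⟩, _, ⟨y, hy, rfl⟩, rfl⟩
    have h1 : (2 * N - 1) * s < |⟪v, x⟫| := hA₁s hx
    have h2 : |⟪v, y⟫| ≤ s := not_lt.1 (hA₂s hy)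
    simp only [Set.mem_ofPred_eq, inner_add_right, inner_smul_right]
    have h3 : |(N : ℝ)⁻¹ * ⟪v, x⟫| - |(1 - (N : ℝ)⁻¹) * ⟪v, y⟫| ≤
        |(N : ℝ)⁻¹ * ⟪v, x⟫ + (1 - (N : ℝ)⁻¹) * ⟪v, y⟫| := by
      have := abs_sub_abs_le_abs_sub ((N : ℝ)⁻¹ * ⟪v, x⟫) (-((1 - (N : ℝ)⁻¹) * ⟪v, y⟫))
      rwa [abs_neg, sub_neg_eq_add] at this
    refine lt_of_lt_of_le ?_ h3
    rw [abs_mul, abs_mul, abs_of_pos (inv_pos.2 hN0), abs_of_pos (sub_pos.2 hNinv)]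
    have h4 := mul_lt_mul_of_pos_left h1 (inv_pos.2 hN0)
    have h5 := mul_le_mul_of_nonneg_left h2 (sub_pos.2 hNinv).le
    have h6 : (N : ℝ)⁻¹ * ((2 * N - 1) * s) = 2 * s - (N : ℝ)⁻¹ * s := by field_simp
    rw [h6] at h4
    linarith
  have key2 : μ A₁ ^ (N : ℝ)⁻¹ * (1 / 2) ^ (1 - (N : ℝ)⁻¹) ≤ 1 / 4 := by
    refine le_trans ?_ (key.trans ((measure_mono hsub).trans h))
    gcongr
  have key3 := ENNReal.rpow_le_rpow key2 hN0.le
  rw [ENNReal.mul_rpow_of_nonneg _ _ hN0.le, ← ENNReal.rpow_mul, ← ENNReal.rpow_mul,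
    inv_mul_cancel₀ hN0.ne', ENNReal.rpow_one, sub_mul, inv_mul_cancel₀ hN0.ne', one_mul,
    ENNReal.rpow_natCast] at key3
  have e : (N : ℝ) - 1 = ((N - 1 : ℕ) : ℝ) := by rw [Nat.cast_sub hN]; simp
  rw [e, ENNReal.rpow_natCast] at key3
  have e4 : (1 / 4 : ℝ≥0∞) ^ N ≤ (1 / 2) ^ N * (1 / 2) ^ (N - 1) := by
    rw [show (1 / 4 : ℝ≥0∞) = 1 / 2 * (1 / 2) by
      rw [← ENNReal.toReal_eq_toReal_iff' (by simp) (by simp [ENNReal.mul_eq_top])]; norm_num,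
      mul_pow]
    gcongr 1
    exact pow_le_pow_of_le_one (by simp) (by simp) (by omega)
  exact (ENNReal.mul_le_mul_iff_left (by simp) (by simp)).1 (key3.trans e4)

theorem integrable_and_integral_le_of_lintegral_le {Ω : Type*} [MeasurableSpace Ω] {μ : Measure Ω}
    {f : Ω → ℝ} (hf : AEStronglyMeasurable f μ) (h0 : ∀ x, 0 ≤ f x) {K : ℝ} (hK : 0 ≤ K)
    (h : ∫⁻ x, ENNReal.ofReal (f x) ∂μ ≤ ENNReal.ofReal K) :
    Integrable f μ ∧ ∫ x, f x ∂μ ≤ K := by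
  refine ⟨⟨hf, ?_⟩, ?_⟩
  · rw [hasFiniteIntegral_iff_ofReal (Filter.Eventually.of_forall h0)]
    exact h.trans_lt ENNReal.ofReal_lt_top
  · rw [integral_eq_lintegral_of_nonneg_ae (Filter.Eventually.of_forall h0) hf]
    exact ENNReal.toReal_le_of_le_ofReal hK h

theorem exp_quarter_div_two_le : Real.exp (1 / 4) / 2 ≤ 13 / 20 := by
  have h : Real.exp (1 / 4) ^ 4 < (13 / 10) ^ 4 := by
    rw [← Real.exp_nat_mul]
    norm_num
    linarith [Real.exp_one_lt_d9]
  linarith [lt_of_pow_lt_pow_left₀ 4 (by norm_num) h]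

/-- Exponential moments of a variable with tails `2 ^ (-N)`. -/
theorem integrable_exp_of_tail {Ω : Type*} [MeasurableSpace Ω] {μ : Measure Ω}
    [IsProbabilityMeasure μ] {f : Ω → ℝ} (hf : AEMeasurable f μ) {s : ℝ} (hs : 0 < s)
    (h : ∀ N : ℕ, 0 < N → μ {x | (2 * N - 1) * s < |f x|} ≤ (1 / 2) ^ N) :
    Integrable (fun x => Real.exp (1 / (8 * s) * |f x|)) μ ∧
      ∫ x, Real.exp (1 / (8 * s) * |f x|) ∂μ ≤ 4 := by
  refine integrable_and_integral_le_of_lintegral_le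
    (by fun_prop : AEMeasurable _ μ).aestronglyMeasurable (fun x => (Real.exp_pos _).le)
    (by norm_num) ?_
  have hpt : ∀ x, ENNReal.ofReal (Real.exp (1 / (8 * s) * |f x|)) ≤ ∑' N : ℕ,
      {x | (2 * N - 1) * s < |f x|}.indicator
        (fun _ => ENNReal.ofReal (Real.exp ((2 * N + 1) / 8))) x := by
    intro x
    -- The layer with `2 N - 1 < |f x| / s ≤ 2 N + 1`; for `N = 0` the lower bound is vacuous.
    set N := ⌈(|f x| / s - 1) / 2⌉₊ with hN
    have h1 : (|f x| / s - 1) / 2 ≤ N := Nat.le_ceil _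
    have h2 : |f x| ≤ (2 * N + 1) * s := by
      rw [← div_le_iff₀ hs]; linarith
    have h3 : (2 * N - 1) * s < |f x| := by
      rcases Nat.eq_zero_or_pos N with h0 | h0
      · rw [h0]; have := abs_nonneg (f x); simp; linarith
      · have := Nat.ceil_lt_add_one (Nat.ceil_pos.1 (hN ▸ h0)).le
        rw [← hN] at this
        rw [← lt_div_iff₀ hs]; linarith
    refine le_trans ?_ (ENNReal.le_tsum N)
    rw [Set.indicator_of_mem (by exact h3)]
    apply ENNReal.ofReal_le_ofReal
    gcongr
    rw [one_div, inv_mul_le_iff₀ (by positivity)]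
    linarith
  have hms : ∀ N : ℕ, NullMeasurableSet {x | (2 * (N : ℝ) - 1) * s < |f x|} μ := fun N =>
    nullMeasurableSet_lt aemeasurable_const (by fun_prop)
  calc _ ≤ ∫⁻ x, ∑' N : ℕ, {x | (2 * N - 1) * s < |f x|}.indicator
        (fun _ => ENNReal.ofReal (Real.exp ((2 * N + 1) / 8))) x ∂μ := lintegral_mono hpt
    _ = ∑' N : ℕ, ENNReal.ofReal (Real.exp ((2 * N + 1) / 8)) *
          μ {x | (2 * N - 1) * s < |f x|} := by
        rw [lintegral_tsum fun N => aemeasurable_const.indicator₀ (hms N)]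
        congr 1; ext N
        rw [lintegral_indicator₀ (hms N), setLIntegral_const]
    _ ≤ ∑' N : ℕ, ENNReal.ofReal (13 / 10) * ENNReal.ofReal (13 / 20) ^ N := by
        refine ENNReal.tsum_le_tsum fun N => ?_
        have h1 : μ {x | (2 * N - 1) * s < |f x|} ≤ (1 / 2) ^ N := by
          rcases Nat.eq_zero_or_pos N with rfl | h0
          · simpa using prob_le_one
          · exact h N h0
        have h2 : (1 / 2 : ℝ≥0∞) = ENNReal.ofReal (1 / 2) := by
          rw [ENNReal.ofReal_div_of_pos two_pos]; simp
        refine (mul_le_mul_right h1 _).trans ?_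
        rw [h2, ← ENNReal.ofReal_pow (by norm_num), ← ENNReal.ofReal_pow (by norm_num),
          ← ENNReal.ofReal_mul (Real.exp_pos _).le, ← ENNReal.ofReal_mul (by norm_num)]
        apply ENNReal.ofReal_le_ofReal
        -- The layers sum to a geometric series of ratio `exp (1 / 4) / 2 ≤ 13 / 20`, with total at
        -- most `1.3 / 0.35 < 4`.
        have e : Real.exp ((2 * N + 1) / 8) * (1 / 2) ^ N =
            Real.exp (1 / 8) * (Real.exp (1 / 4) / 2) ^ N := by
          rw [div_pow (Real.exp _), ← Real.exp_nat_mul, one_div_pow, mul_one_div, mul_div_assoc',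
            ← Real.exp_add]
          congr 2; ring
        rw [e]
        have h8 : Real.exp (1 / 8) ≤ 13 / 10 := by
          have : Real.exp (1 / 8) ≤ Real.exp (1 / 4) := by gcongr; norm_num
          linarith [exp_quarter_div_two_le]
        exact mul_le_mul h8 (pow_le_pow_left₀ (by positivity) exp_quarter_div_two_le N)
          (by positivity) (by norm_num)
    _ = ENNReal.ofReal (13 / 10) * ENNReal.ofReal (1 - 13 / 20)⁻¹ := by
        rw [ENNReal.tsum_mul_left, ENNReal.tsum_geometric, ENNReal.ofReal_inv_of_pos (by norm_num),
          ENNReal.ofReal_sub _ (by norm_num), ENNReal.ofReal_one]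
    _ ≤ ENNReal.ofReal 4 := by
        rw [← ENNReal.ofReal_mul (by norm_num)]
        apply ENNReal.ofReal_le_ofReal
        norm_num

theorem IsLogConcaveMeasure.integrable_exp {μ : Measure (EuclideanSpace ℝ (Fin p))}
    [IsProbabilityMeasure μ] (hμ : IsLogConcaveMeasure μ) {v : EuclideanSpace ℝ (Fin p)}
    (hv : MemLp (fun x => ⟪v, x⟫) 2 μ) {k : ℝ} (hk : 0 < k) (h : ∫ x, ⟪v, x⟫ ^ 2 ∂μ ≤ k) :
    Integrable (fun x => Real.exp (1 / (16 * √k) * |⟪v, x⟫|)) μ ∧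
      ∫ x, Real.exp (1 / (16 * √k) * |⟪v, x⟫|) ∂μ ≤ 4 := by
  have hs : 0 < 2 * √k := by positivity
  -- Two standard deviations suffice for the `1 / 4` in Borell's lemma; `8 * s` is then `16 * √k`.
  have h1 : μ {x | 2 * √k < |⟪v, x⟫|} ≤ 1 / 4 := by
    refine (measure_lt_abs_le_of_integral_sq_le hv hs h).trans (le_of_eq ?_)
    rw [mul_pow, Real.sq_sqrt hk.le, div_mul_cancel_right₀ hk.ne', ENNReal.ofReal_inv_of_pos
      (by norm_num)]
    norm_num
  have := integrable_exp_of_tail hv.aemeasurable hs (hμ.measure_lt_abs_inner_le v h1)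
  rwa [show (8 * (2 * √k)) = 16 * √k by ring] at this

theorem gaussianReal_integrable_exp_abs {v : NNReal} {k : ℝ} (hk : 0 < k) (hv : v ≤ k) :
    Integrable (fun x => Real.exp (1 / (16 * √k) * |x|)) (gaussianReal 0 v) ∧
      ∫ x, Real.exp (1 / (16 * √k) * |x|) ∂(gaussianReal 0 v) ≤ 4 := by
  set θ := 1 / (16 * √k) with hθ
  have hθ0 : 0 ≤ θ := by positivity
  have hle : ∀ x, Real.exp (θ * |x|) ≤ Real.exp (θ * x) + Real.exp (-θ * x) := fun x => by
    rcases abs_cases x with ⟨h, -⟩ | ⟨h, -⟩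
    · rw [h]; linarith [Real.exp_pos (-θ * x)]
    · rw [h, mul_neg, ← neg_mul]; linarith [Real.exp_pos (θ * x)]
  have i1 := integrable_exp_mul_gaussianReal (μ := 0) (v := v) θ
  have i2 := integrable_exp_mul_gaussianReal (μ := 0) (v := v) (-θ)
  have e : ∀ t, ∫ x, Real.exp (t * x) ∂(gaussianReal 0 v) = Real.exp (v * t ^ 2 / 2) := fun t => by
    have := congrFun (mgf_fun_id_gaussianReal (μ := 0) (v := v)) t
    simpa [mgf] using this
  have hint : Integrable (fun x => Real.exp (θ * |x|)) (gaussianReal 0 v) := by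
    refine (i1.add i2).mono' (Continuous.aestronglyMeasurable (by fun_prop))
      (Filter.Eventually.of_forall fun x => ?_)
    rw [Real.norm_eq_abs, Real.abs_exp]
    exact hle x
  refine ⟨hint, ?_⟩
  calc _ ≤ ∫ x, (Real.exp (θ * x) + Real.exp (-θ * x)) ∂(gaussianReal 0 v) :=
        integral_mono hint (i1.add i2) hle
    _ = 2 * Real.exp (v * θ ^ 2 / 2) := by
        rw [integral_add i1 i2, e, e, neg_sq]; ring
    _ ≤ 2 * Real.exp (1 / 4) := by
        refine mul_le_mul_of_nonneg_left (Real.exp_le_exp.2 ?_) zero_le_two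
        have : θ ^ 2 = 1 / (256 * k) := by
          rw [hθ, div_pow, mul_pow, Real.sq_sqrt hk.le]; norm_num
        rw [this]
        have h3 : v * (1 / (256 * k)) ≤ k * (1 / (256 * k)) := by gcongr
        have h4 : k * (1 / (256 * k)) = 1 / 256 := by field_simp
        linarith
    _ ≤ 4 := by linarith [exp_quarter_div_two_le]

/-- Projection bounds for the scaled law from exponential moments. -/
theorem hasProjectionBounds_of_integrable_exp {Ω : Type*} [MeasurableSpace Ω] {P : Measure Ω}
    {m : ℕ} {E : Type*} [NormedAddCommGroup E] [InnerProductSpace ℝ E]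
    [MeasurableSpace E] [BorelSpace E] [SecondCountableTopology E]
    {X : Ω → E} (hX : AEMeasurable X P) {v : Fin m → E} {θ r β : ℝ} (hθ : 0 < θ) (hr : 0 < r)
    (hβ : 0 < β) (hβr : β * r ≤ 1)
    (hint : ∀ j, Integrable (fun ω => Real.exp (θ * |⟪v j, X ω⟫|)) P)
    (hK : ∀ j, ∫ ω, Real.exp (θ * |⟪v j, X ω⟫|) ∂P ≤ 4) :
    HasProjectionBounds (P.map fun ω => r • X ω) v β (24 / θ ^ 3 * r ^ 3)
      (32 / θ ^ 2 * Real.exp (-(θ / (2 * (β * r))))) := by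
  have hXr : AEMeasurable (fun ω => r • X ω) P := hX.const_smul r
  have hcube : ∀ w : ℝ, |w| ^ 3 ≤ 6 / θ ^ 3 * Real.exp (θ * |w|) := fun w => by
    have := Real.pow_div_factorial_le_exp (θ * |w|) (by positivity) 3
    rw [mul_pow] at this
    rw [div_mul_eq_mul_div, le_div_iff₀ (by positivity)]
    norm_num [Nat.factorial] at this
    linarith
  have hi3 : ∀ j, Integrable (fun ω => |⟪v j, r • X ω⟫| ^ 3) P := fun j => by
    refine ((hint j).const_mul (6 / θ ^ 3 * r ^ 3)).mono' ?_ (Filter.Eventually.of_forall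
      fun ω => ?_)
    · exact AEMeasurable.aestronglyMeasurable (by fun_prop)
    · rw [Real.norm_eq_abs, abs_of_nonneg (by positivity), inner_smul_right, abs_mul, mul_pow,
        abs_of_pos hr]
      have := mul_le_mul_of_nonneg_left (hcube ⟪v j, X ω⟫) (pow_pos hr 3).le
      linarith
  refine ⟨fun j => ?_, fun j => ?_, fun j => ?_⟩
  · rw [memLp_map_measure_iff (by fun_prop) hXr]
    rw [← integrable_norm_rpow_iff (AEMeasurable.aestronglyMeasurable (by fun_prop)) (by norm_num)
      (by norm_num)]
    convert hi3 j using 2 with ω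
    rw [Function.comp_apply, Real.norm_eq_abs, show (3 : ℝ≥0∞).toReal = ((3 : ℕ) : ℝ) by norm_num,
      Real.rpow_natCast]
  · rw [integral_map hXr (by fun_prop)]
    calc _ ≤ ∫ ω, 6 / θ ^ 3 * r ^ 3 * Real.exp (θ * |⟪v j, X ω⟫|) ∂P := by
          refine integral_mono (hi3 j) ((hint j).const_mul _) fun ω => ?_
          dsimp only
          rw [inner_smul_right, abs_mul, mul_pow, abs_of_pos hr]
          have := mul_le_mul_of_nonneg_left (hcube ⟪v j, X ω⟫) (pow_pos hr 3).le
          linarith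
      _ ≤ 6 / θ ^ 3 * r ^ 3 * 4 := by
          rw [integral_const_mul]; gcongr; exact hK j
      _ = _ := by ring
  · have hmeas : Measurable fun x : E => if 1 < |β * ⟪v j, x⟫| then (β * ⟪v j, x⟫) ^ 2 else 0 :=
      Measurable.ite (measurableSet_lt measurable_const (by fun_prop)) (by fun_prop)
        measurable_const
    have hpt : ∀ ω, (if 1 < |β * ⟪v j, r • X ω⟫| then (β * ⟪v j, r • X ω⟫) ^ 2 else 0) ≤
        8 / θ ^ 2 * Real.exp (-(θ / (2 * (β * r)))) * Real.exp (θ * |⟪v j, X ω⟫|) := fun ω => by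
      set w := ⟪v j, X ω⟫ with hw
      have e : β * ⟪v j, r • X ω⟫ = β * r * w := by rw [inner_smul_right, mul_assoc]
      rw [e]
      have hβr0 : 0 < β * r := by positivity
      split_ifs with h
      · rw [abs_mul, abs_of_pos hβr0] at h
        have h1 : (β * r * w) ^ 2 ≤ |w| ^ 2 := by
          rw [← sq_abs, abs_mul, abs_of_pos hβr0]
          gcongr
          exact mul_le_of_le_one_left (abs_nonneg w) hβr
        -- Half of the exponent absorbs the square; the other half, on `|w| ≥ 1 / (β * r)`, gives
        -- the decay in the tail bound.
        have h2 : |w| ^ 2 ≤ 8 / θ ^ 2 * Real.exp (θ * |w| / 2) := by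
          have := Real.pow_div_factorial_le_exp (θ * |w| / 2) (by positivity) 2
          rw [div_pow, mul_pow] at this
          rw [div_mul_eq_mul_div, le_div_iff₀ (by positivity)]
          norm_num [Nat.factorial] at this
          rw [sq_abs]
          linarith
        refine h1.trans (h2.trans ?_)
        rw [mul_assoc, ← Real.exp_add]
        gcongr
        have h3 : 1 / (β * r) ≤ |w| := by
          rw [div_le_iff₀ hβr0]; linarith
        have h4 : θ / (2 * (β * r)) = θ / 2 * (1 / (β * r)) := by field_simp
        have h5 : θ / 2 * (1 / (β * r)) ≤ θ / 2 * |w| := by gcongr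
        rw [h4]; linarith
      · positivity
    rw [integral_map hXr hmeas.aestronglyMeasurable]
    calc _ ≤ ∫ ω, 8 / θ ^ 2 * Real.exp (-(θ / (2 * (β * r)))) *
            Real.exp (θ * |⟪v j, X ω⟫|) ∂P := by
          refine integral_mono_of_nonneg (Filter.Eventually.of_forall fun ω => ?_)
            ((hint j).const_mul _) (Filter.Eventually.of_forall hpt)
          dsimp only
          split_ifs <;> positivity
      _ ≤ 8 / θ ^ 2 * Real.exp (-(θ / (2 * (β * r)))) * 4 := by
          rw [integral_const_mul]; gcongr; exact hK j
      _ = _ := by ring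

end LogConcave

/-! ### Covariance matrices, their quadratic forms and the Gaussian counterparts. -/

section SecondMoment

variable {p : ℕ}

/-- Both `S - k₁` and `k₂ - S` are symmetric with nonnegative spectrum, hence positive semidefinite.
-/
theorem quadraticForm_bounds_of_eigenvalues {S : Matrix (Fin p) (Fin p) ℝ} (hS : S.IsHermitian)
    {k₁ k₂ : ℝ}
    (h : ∀ t : ℝ, Module.End.HasEigenvalue (Matrix.toLin' S) t → k₁ ≤ t ∧ t ≤ k₂)
    (x : Fin p → ℝ) :
    k₁ * (x ⬝ᵥ x) ≤ x ⬝ᵥ S.mulVec x ∧ x ⬝ᵥ S.mulVec x ≤ k₂ * (x ⬝ᵥ x) := by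
  have hspec : ∀ t ∈ spectrum ℝ S, k₁ ≤ t ∧ t ≤ k₂ := fun t ht => by
    apply h
    rw [Module.End.hasEigenvalue_iff_mem_spectrum, Matrix.spectrum_toLin']
    exact ht
  have hscal : ∀ k : ℝ, (algebraMap ℝ (Matrix (Fin p) (Fin p) ℝ) k).IsHermitian := fun k => by
    rw [Algebra.algebraMap_eq_smul_one, Matrix.IsHermitian, Matrix.conjTranspose_smul,
      Matrix.conjTranspose_one, star_trivial]
  have hmul : ∀ k : ℝ, (algebraMap ℝ (Matrix (Fin p) (Fin p) ℝ) k).mulVec x = k • x := fun k => by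
    rw [Algebra.algebraMap_eq_smul_one, Matrix.smul_mulVec, Matrix.one_mulVec]
  have h1 : (S - algebraMap ℝ _ k₁).PosSemidef := by
    rw [Matrix.posSemidef_iff_isHermitian_and_spectrum_nonneg]
    refine ⟨hS.sub (hscal k₁), fun t ht => ?_⟩
    rw [← spectrum.sub_singleton_eq] at ht
    obtain ⟨s, hs, _, rfl, rfl⟩ := ht
    have := (hspec s hs).1
    simp only [Set.mem_ofPred_eq]
    linarith
  have h2 : (algebraMap ℝ _ k₂ - S).PosSemidef := by
    rw [Matrix.posSemidef_iff_isHermitian_and_spectrum_nonneg]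
    refine ⟨(hscal k₂).sub hS, fun t ht => ?_⟩
    rw [← spectrum.singleton_sub_eq] at ht
    obtain ⟨_, rfl, s, hs, rfl⟩ := ht
    have := (hspec s hs).2
    simp only [Set.mem_ofPred_eq]
    linarith
  have e1 := h1.dotProduct_mulVec_nonneg x
  have e2 := h2.dotProduct_mulVec_nonneg x
  rw [Matrix.sub_mulVec, hmul, dotProduct_sub, dotProduct_smul, star_trivial, smul_eq_mul] at e1 e2
  constructor <;> linarith

variable {Ω : Type*} [MeasurableSpace Ω] {P : Measure Ω}
  {X : Ω → EuclideanSpace ℝ (Fin p)}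

theorem isHermitian_secondMomentMatrix : (secondMomentMatrix X P).IsHermitian := by
  ext j k
  simp [secondMomentMatrix, mul_comm]

theorem dotProduct_secondMomentMatrix_mulVec (hX : MemLp X 2 P)
    (x y : EuclideanSpace ℝ (Fin p)) :
    x ⬝ᵥ (secondMomentMatrix X P).mulVec y = ∫ ω, ⟪x, X ω⟫ * ⟪y, X ω⟫ ∂P := by
  have hm : ∀ j, MemLp (fun ω => X ω j) 2 P := fun j =>
    hX.continuousLinearMap_comp (EuclideanSpace.proj (𝕜 := ℝ) j)
  have hi : ∀ j k, Integrable (fun ω => X ω j * X ω k) P := fun j k => (hm j).integrable_mul (hm k)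
  have e : ∀ ω, ⟪x, X ω⟫ * ⟪y, X ω⟫ = ∑ j, ∑ k, x j * (y k * (X ω j * X ω k)) := fun ω => by
    simp only [PiLp.inner_apply, RCLike.inner_apply, conj_trivial, Finset.sum_mul_sum]
    refine Finset.sum_congr rfl fun j _ => Finset.sum_congr rfl fun k _ => by ring
  simp_rw [e]
  rw [integral_finsetSum _ fun j _ => integrable_finsetSum _ fun k _ =>
    ((hi j k).const_mul _).const_mul _]
  simp only [dotProduct, Matrix.mulVec, secondMomentMatrix, Matrix.of_apply]
  refine Finset.sum_congr rfl fun j _ => ?_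
  rw [integral_finsetSum _ fun k _ => ((hi j k).const_mul _).const_mul _, Finset.mul_sum]
  refine Finset.sum_congr rfl fun k _ => ?_
  rw [integral_const_mul, integral_const_mul]
  ring

theorem posSemidef_secondMomentMatrix (hX : MemLp X 2 P) : (secondMomentMatrix X P).PosSemidef := by
  refine Matrix.PosSemidef.of_dotProduct_mulVec_nonneg isHermitian_secondMomentMatrix fun x => ?_
  have := dotProduct_secondMomentMatrix_mulVec hX (WithLp.toLp 2 x) (WithLp.toLp 2 x)
  rw [star_trivial]
  change x ⬝ᵥ _ = _ at this
  rw [this]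
  exact integral_nonneg fun ω => mul_self_nonneg _

theorem integral_inner_sq_mem_Icc (hX : MemLp X 2 P) {k₁ k₂ : ℝ}
    (h : ∀ t : ℝ, Module.End.HasEigenvalue (Matrix.toLin' (secondMomentMatrix X P)) t →
      k₁ ≤ t ∧ t ≤ k₂) {x : EuclideanSpace ℝ (Fin p)} (hx : ‖x‖ = 1) :
    ∫ ω, ⟪x, X ω⟫ ^ 2 ∂P ∈ Set.Icc k₁ k₂ := by
  have h1 := quadraticForm_bounds_of_eigenvalues isHermitian_secondMomentMatrix h x
  have h2 : (x : Fin p → ℝ) ⬝ᵥ x = 1 := by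
    have := EuclideanSpace.real_norm_sq_eq x
    rw [hx] at this
    simp only [dotProduct, ← pow_two]
    rw [← this]; norm_num
  rw [dotProduct_secondMomentMatrix_mulVec hX, h2, mul_one, mul_one] at h1
  simp_rw [pow_two]
  exact h1

theorem integral_inner_multivariateGaussian (S : Matrix (Fin p) (Fin p) ℝ)
    (x : EuclideanSpace ℝ (Fin p)) :
    ∫ y, ⟪x, y⟫ ∂(multivariateGaussian 0 S) = 0 := by
  rw [integral_inner (IsGaussian.integrable_fun_id) x]
  simp

theorem integral_inner_mul_inner_multivariateGaussian {S : Matrix (Fin p) (Fin p) ℝ}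
    (hS : S.PosSemidef) (x y : EuclideanSpace ℝ (Fin p)) :
    ∫ z, ⟪x, z⟫ * ⟪y, z⟫ ∂(multivariateGaussian 0 S) = x ⬝ᵥ S.mulVec y := by
  rw [← covarianceBilin_multivariateGaussian (μ := 0) hS,
    covarianceBilin_apply IsGaussian.memLp_two_id]
  simp

theorem integrable_exp_abs_inner_multivariateGaussian {S : Matrix (Fin p) (Fin p) ℝ}
    (hS : S.PosSemidef) (x : EuclideanSpace ℝ (Fin p)) {k : ℝ} (hk : 0 < k)
    (h : x ⬝ᵥ S.mulVec x ≤ k) :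
    Integrable (fun y => Real.exp (1 / (16 * √k) * |⟪x, y⟫|)) (multivariateGaussian 0 S) ∧
      ∫ y, Real.exp (1 / (16 * √k) * |⟪x, y⟫|) ∂(multivariateGaussian 0 S) ≤ 4 := by
  have hmap := map_inner_eq_gaussianReal (integral_inner_multivariateGaussian S) x
  have h1 := gaussianReal_integrable_exp_abs
    (v := (∫ y, ⟪x, y⟫ ^ 2 ∂(multivariateGaussian 0 S)).toNNReal) hk (by
      rw [Real.coe_toNNReal _ (integral_nonneg fun y => sq_nonneg _)]
      simp_rw [pow_two]
      rwa [integral_inner_mul_inner_multivariateGaussian hS])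
  rw [← hmap] at h1
  rwa [integrable_map_measure (Continuous.aestronglyMeasurable (by fun_prop)) (by fun_prop),
    integral_map (by fun_prop) (Continuous.aestronglyMeasurable (by fun_prop))] at h1

end SecondMoment

/-! ### First and second moments of the normalized sum. -/

section GaussianSum

variable {p n : ℕ} {Ω : Type*} [MeasurableSpace Ω] {P : Measure Ω} [IsProbabilityMeasure P]
  {Y : Fin n → Ω → EuclideanSpace ℝ (Fin p)}

omit [IsProbabilityMeasure P] in
theorem hasGaussianLaw_normalizedSum (hY : ∀ i, HasGaussianLaw (Y i) P) (hind : iIndepFun Y P) :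
    HasGaussianLaw (normalizedSum Y) P :=
  (iIndepFun.hasGaussianLaw_fun_sum hY hind).fun_smul _

theorem integral_inner_normalizedSum (hY : ∀ i, MemLp (Y i) 2 P)
    (h0 : ∀ i x, ∫ ω, ⟪x, Y i ω⟫ ∂P = 0) (x : EuclideanSpace ℝ (Fin p)) :
    ∫ ω, ⟪x, normalizedSum Y ω⟫ ∂P = 0 := by
  simp_rw [normalizedSum, inner_smul_right, inner_sum]
  rw [integral_const_mul, integral_finsetSum _ fun i _ =>
    ((hY i).integrable one_le_two).const_inner x]
  simp [h0]

theorem integral_inner_sq_normalizedSum (hY : ∀ i, MemLp (Y i) 2 P)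
    (h0 : ∀ i x, ∫ ω, ⟪x, Y i ω⟫ ∂P = 0) (hind : iIndepFun Y P)
    (x : EuclideanSpace ℝ (Fin p)) :
    ∫ ω, ⟪x, normalizedSum Y ω⟫ ^ 2 ∂P = (n : ℝ)⁻¹ * ∑ i, ∫ ω, ⟪x, Y i ω⟫ ^ 2 ∂P := by
  have hm : ∀ i, MemLp (fun ω => ⟪x, Y i ω⟫) 2 P := fun i =>
    (hY i).continuousLinearMap_comp (innerSL ℝ x)
  have hv := IndepFun.variance_sum (μ := P) (X := fun i ω => ⟪x, Y i ω⟫) (s := Finset.univ)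
    (fun i _ => hm i) fun i _ j _ hij =>
      (hind.indepFun hij).comp (φ := fun y => ⟪x, y⟫) (ψ := fun y => ⟪x, y⟫)
        (by fun_prop) (by fun_prop)
  rw [variance_of_integral_eq_zero (memLp_finsetSum' _ fun i _ => hm i).aemeasurable] at hv
  · simp_rw [variance_of_integral_eq_zero (hm _).aemeasurable (h0 _ x)] at hv
    simp_rw [normalizedSum, inner_smul_right, inner_sum, mul_pow]
    rw [integral_const_mul, inv_pow, Real.sq_sqrt (Nat.cast_nonneg n), ← hv]
    simp [Finset.sum_apply]
  · simp only [Finset.sum_apply]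
    rw [integral_finsetSum _ fun i _ => (hm i).integrable one_le_two]
    simp [h0]

end GaussianSum

/-! ### From simple convex sets to polyhedra with finite offsets. -/

section Reduction

variable {p : ℕ}

/-- The two exceptional cases absorb infinite support values: an empty `Am` has support `⊥`, which
stays `⊥` after adding `ε`, and normals with support `⊤` impose nothing and are dropped. If no
normal remains, `A` is the whole space. -/
theorem AdmitsApprox.exists_polyhedron {A : Set (EuclideanSpace ℝ (Fin p))} {ε : ℝ} {m : ℕ}
    (h : AdmitsApprox A ε m) : A = ∅ ∨ A = Set.univ ∨
      ∃ (k : ℕ) (_ : NeZero k) (v : Fin k → EuclideanSpace ℝ (Fin p)) (b : Fin k → ℝ),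
        k ≤ m ∧ (∀ j, ‖v j‖ = 1) ∧ polyhedron v b ⊆ A ∧ A ⊆ polyhedron v fun j => b j + ε := by
  classical
  obtain ⟨Am, V, hgen, h1, h2⟩ := h
  rcases Am.eq_empty_or_nonempty with he | ⟨w, hw⟩
  · left
    have hsup : ∀ v, supportFun Am v = ⊥ := fun v => by simp [supportFun, he]
    have hV : V.Nonempty := by
      by_contra hV
      rw [Finset.not_nonempty_iff_eq_empty] at hV
      have := hgen.eq_iInter
      rw [hV, he] at this
      simp at this
      exact Set.empty_ne_univ this
    obtain ⟨v, hv⟩ := hV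
    rw [Set.eq_empty_iff_forall_notMem]
    intro x hx
    have := Set.mem_iInter₂.1 (h2 hx) v hv
    simp [hsup] at this
  · right
    have hbot : ∀ v, supportFun Am v ≠ ⊥ := fun v => by
      refine ne_bot_of_le_ne_bot (EReal.coe_ne_bot ⟪w, v⟫) ?_
      exact le_iSup₂ (f := fun (w : EuclideanSpace ℝ (Fin p)) (_ : w ∈ Am) =>
        ((⟪w, v⟫ : ℝ) : EReal)) w hw
    set V' := V.filter fun v => supportFun Am v ≠ ⊤ with hV'
    rcases V'.eq_empty_or_nonempty with h0 | h0
    · left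
      refine Set.eq_univ_of_univ_subset (Set.Subset.trans ?_ h1)
      rw [hgen.eq_iInter]
      intro x _
      refine Set.mem_iInter₂.2 fun v hv => ?_
      have : supportFun Am v = ⊤ := by
        by_contra hne
        have : v ∈ V' := Finset.mem_filter.2 ⟨hv, hne⟩
        simp [h0] at this
      simp [this]
    · right
      have hmem : ∀ j, (V'.equivFin.symm j : EuclideanSpace ℝ (Fin p)) ∈ V ∧
          supportFun Am (V'.equivFin.symm j) ≠ ⊤ := fun j =>
        Finset.mem_filter.1 (V'.equivFin.symm j).2
      have hcoe : ∀ j, ((supportFun Am (V'.equivFin.symm j)).toReal : EReal) =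
          supportFun Am (V'.equivFin.symm j) := fun j => EReal.coe_toReal (hmem j).2 (hbot _)
      refine ⟨V'.card, ⟨(Finset.card_pos.2 h0).ne'⟩, fun j => V'.equivFin.symm j,
        fun j => (supportFun Am (V'.equivFin.symm j)).toReal,
        (Finset.card_filter_le _ _).trans hgen.card_le,
        fun j => hgen.norm_eq_one _ (hmem j).1, ?_, ?_⟩
      · refine Set.Subset.trans (fun x hx => ?_) h1
        rw [hgen.eq_iInter]
        refine Set.mem_iInter₂.2 fun v hv => ?_
        simp only [Set.mem_ofPred_eq]
        by_cases ht : supportFun Am v = ⊤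
        · simp [ht]
        · have hv' : v ∈ V' := Finset.mem_filter.2 ⟨hv, ht⟩
          have := hx (V'.equivFin ⟨v, hv'⟩)
          simp only [Equiv.symm_apply_apply] at this
          rw [← EReal.coe_toReal ht (hbot v), EReal.coe_le_coe_iff, real_inner_comm]
          exact this
      · intro x hx j
        have := Set.mem_iInter₂.1 (h2 hx) _ (hmem j).1
        simp only [Set.mem_ofPred_eq] at this
        rw [← hcoe, ← EReal.coe_add, EReal.coe_le_coe_iff, real_inner_comm] at this
        exact this

end Reduction

/-! ### The comparison on polyhedra and the choice of parameters. -/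

section PolyhedronCLT

variable {n p m : ℕ} {Ω Ω' : Type*} [MeasurableSpace Ω] [MeasurableSpace Ω']
  {P : Measure Ω} [IsProbabilityMeasure P] {P' : Measure Ω'} [IsProbabilityMeasure P']
  {X : Fin n → Ω → EuclideanSpace ℝ (Fin p)} {Y : Fin n → Ω' → EuclideanSpace ℝ (Fin p)}
  {k₁ k₂ : ℝ}

/-- The law of the `i`-th scaled summand, extended by the Dirac mass at `0`. -/
noncomputable def scaledLaw (P : Measure Ω) (X : Fin n → Ω → EuclideanSpace ℝ (Fin p)) (i : ℕ) :
    Measure (EuclideanSpace ℝ (Fin p)) :=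
  if h : i < n then P.map (fun ω => (√n)⁻¹ • X ⟨i, h⟩ ω) else Measure.dirac 0

theorem isProbabilityMeasure_scaledLaw (hX : ∀ i, AEMeasurable (X i) P) (i : ℕ) :
    IsProbabilityMeasure (scaledLaw P X i) := by
  unfold scaledLaw
  split_ifs with h
  · exact Measure.isProbabilityMeasure_map ((hX _).fun_const_smul _)
  · infer_instance

theorem map_normalizedSum_eq_convRange (hX : ∀ i, AEMeasurable (X i) P) (hind : iIndepFun X P) :
    P.map (normalizedSum X) = convRange (scaledLaw P X) n := by
  have e : normalizedSum X = fun ω => ∑ i, (√n)⁻¹ • X i ω := by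
    ext1 ω; rw [normalizedSum, Finset.smul_sum]
  rw [e]
  refine map_sum_eq_convRange (fun i => (hX i).fun_const_smul _) ?_ _ fun i => ?_
  · exact hind.comp (fun _ (x : EuclideanSpace ℝ (Fin p)) => (√n)⁻¹ • x) fun _ => by fun_prop
  · simp [scaledLaw]

omit [IsProbabilityMeasure P] in
theorem aemeasurable_normalizedSum (hX : ∀ i, AEMeasurable (X i) P) :
    AEMeasurable (normalizedSum X) P :=
  (Finset.aemeasurable_fun_sum _ fun i _ => hX i).fun_const_smul _

theorem measureReal_preimage_normalizedSum (hX : ∀ i, AEMeasurable (X i) P)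
    (hind : iIndepFun X P) (v : Fin m → EuclideanSpace ℝ (Fin p)) (b : Fin m → ℝ) :
    P.real (normalizedSum X ⁻¹' polyhedron v b) =
      (convRange (scaledLaw P X) n).real (polyhedron v b) := by
  rw [← map_normalizedSum_eq_convRange hX hind,
    map_measureReal_apply_of_aemeasurable (aemeasurable_normalizedSum hX)
      (measurableSet_polyhedron v b)]

theorem gaussian_normalizedSum_anticoncentration [NeZero m] (hn : 0 < n) (hk₁ : 0 < k₁)
    (hYG : ∀ i, HasGaussianLaw (Y i) P') (hindY : iIndepFun Y P')
    (hY0 : ∀ i x, ∫ ω, ⟪x, Y i ω⟫ ∂P' = 0)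
    {v : Fin m → EuclideanSpace ℝ (Fin p)}
    (hYk : ∀ i j, k₁ ≤ ∫ ω, ⟪v j, Y i ω⟫ ^ 2 ∂P') (b : Fin m → ℝ) {ε : ℝ} (hε : 0 ≤ ε) :
    P'.real (normalizedSum Y ⁻¹' polyhedron v fun j => b j + ε) -
      P'.real (normalizedSum Y ⁻¹' polyhedron v b) ≤
      Real.exp 2 * (√(2 * Real.log m) + 2) / √k₁ * ε := by
  have hG := hasGaussianLaw_normalizedSum hYG hindY
  have hGm := hG.isGaussian_map
  have hY2 : ∀ i, MemLp (Y i) 2 P' := fun i => (hYG i).memLp_two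
  rw [← map_measureReal_apply_of_aemeasurable hG.aemeasurable (measurableSet_polyhedron v _),
    ← map_measureReal_apply_of_aemeasurable hG.aemeasurable (measurableSet_polyhedron v _)]
  refine gaussian_polyhedron_anticoncentration (fun x => ?_) (Real.sqrt_pos.2 hk₁) (fun j => ?_)
    b hε
  · rw [integral_map hG.aemeasurable (Continuous.aestronglyMeasurable (by fun_prop))]
    exact integral_inner_normalizedSum hY2 hY0 x
  · rw [integral_map hG.aemeasurable (Continuous.aestronglyMeasurable (by fun_prop)),
      integral_inner_sq_normalizedSum hY2 hY0 hindY, Real.sq_sqrt hk₁.le,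
      le_inv_mul_iff₀ (by exact_mod_cast hn)]
    calc (n : ℝ) * k₁ = ∑ i : Fin n, k₁ := by simp
      _ ≤ _ := Finset.sum_le_sum fun i _ => hYk i j

omit [IsProbabilityMeasure P] in
theorem integral_inner_map_const_smul {Z : Ω → EuclideanSpace ℝ (Fin p)} (hZ : AEMeasurable Z P)
    {x : EuclideanSpace ℝ (Fin p)} (h0 : ∫ ω, ⟪x, Z ω⟫ ∂P = 0) (r : ℝ) :
    ∫ y, ⟪x, y⟫ ∂(P.map fun ω => r • Z ω) = 0 := by
  rw [integral_map (hZ.fun_const_smul _) (Continuous.aestronglyMeasurable (by fun_prop))]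
  simp_rw [inner_smul_right]
  rw [integral_const_mul, h0, mul_zero]

theorem clt_polyhedron_of_parameters [NeZero m] (hn : 0 < n) (hk₁ : 0 < k₁)
    {θ : ℝ} (hθ : 0 < θ)
    (hX : ∀ i, AEMeasurable (X i) P) (hindX : iIndepFun X P)
    (hX0 : ∀ i x, ∫ ω, ⟪x, X i ω⟫ ∂P = 0)
    (hYG : ∀ i, HasGaussianLaw (Y i) P') (hindY : iIndepFun Y P')
    (hY0 : ∀ i x, ∫ ω, ⟪x, Y i ω⟫ ∂P' = 0)
    (hXY : ∀ i x y, ∫ ω, ⟪x, X i ω⟫ * ⟪y, X i ω⟫ ∂P = ∫ ω, ⟪x, Y i ω⟫ * ⟪y, Y i ω⟫ ∂P')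
    {v : Fin m → EuclideanSpace ℝ (Fin p)}
    (hYk : ∀ i j, k₁ ≤ ∫ ω, ⟪v j, Y i ω⟫ ^ 2 ∂P')
    (hXe : ∀ i j, Integrable (fun ω => Real.exp (θ * |⟪v j, X i ω⟫|)) P ∧
      ∫ ω, Real.exp (θ * |⟪v j, X i ω⟫|) ∂P ≤ 4)
    (hYe : ∀ i j, Integrable (fun ω => Real.exp (θ * |⟪v j, Y i ω⟫|)) P' ∧
      ∫ ω, Real.exp (θ * |⟪v j, Y i ω⟫|) ∂P' ≤ 4)
    {g g₁ g₂ g₃ : ℝ → ℝ} {B κ β d T : ℝ} (hg : IsSmoothStep g g₁ g₂ g₃ B) (hκ : 0 < κ)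
    (hκ1 : κ ≤ 1) (hβ : 0 < β) (hd : κ * Real.log m ≤ d) (hβn : β * (√n)⁻¹ ≤ 1)
    (hTe : T = 32 / θ ^ 2 * Real.exp (-(θ / (2 * (β * (√n)⁻¹))))) (hT : m * T ≤ 1 / 2)
    (hsmall : n * (26 * Real.exp 2 * B * (κ * β ^ 3 * (24 / θ ^ 3 * (√n)⁻¹ ^ 3))) ≤ 1 / 8)
    (b : Fin m → ℝ) :
    |P.real (normalizedSum X ⁻¹' polyhedron v b) - P'.real (normalizedSum Y ⁻¹' polyhedron v b)| ≤
      Real.exp 2 * (√(2 * Real.log m) + 2) / √k₁ * ((5 + 3 * d) / (κ * β)) +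
        2 * (n * (26 * Real.exp 2 * B * (m * T))) := by
  have hY : ∀ i, AEMeasurable (Y i) P' := fun i => (hYG i).aemeasurable
  have hr : 0 < (√n)⁻¹ := by
    have : (0 : ℝ) < n := by exact_mod_cast hn
    positivity
  have := isProbabilityMeasure_scaledLaw hX
  have := isProbabilityMeasure_scaledLaw hY
  have second : ∀ i x y, ∫ z, ⟪x, z⟫ * ⟪y, z⟫ ∂(P.map fun ω => (√n)⁻¹ • X i ω) =
      ∫ z, ⟪x, z⟫ * ⟪y, z⟫ ∂(P'.map fun ω => (√n)⁻¹ • Y i ω) := by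
    intro i x y
    rw [integral_map ((hX i).fun_const_smul _) (Continuous.aestronglyMeasurable (by fun_prop)),
      integral_map ((hY i).fun_const_smul _) (Continuous.aestronglyMeasurable (by fun_prop))]
    simp_rw [inner_smul_right, mul_mul_mul_comm]
    rw [integral_const_mul, integral_const_mul, hXY]
  rw [measureReal_preimage_normalizedSum hX hindX, measureReal_preimage_normalizedSum hY hindY]
  refine abs_measureReal_convRange_polyhedron_sub_le hg hκ hκ1 hβ hd
    (M := 24 / θ ^ 3 * (√n)⁻¹ ^ 3) (by positivity) hT
    (scaledLaw P X) (scaledLaw P' Y) ?_ ?_ ?_ ?_ (by positivity) ?_ hsmall b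
  · intro i hi
    rw [scaledLaw, dif_pos hi, hTe]
    exact hasProjectionBounds_of_integrable_exp (hX _) hθ hr hβ hβn
      (fun j => (hXe _ j).1) fun j => (hXe _ j).2
  · intro i hi
    rw [scaledLaw, dif_pos hi, hTe]
    exact hasProjectionBounds_of_integrable_exp (hY _) hθ hr hβ hβn
      (fun j => (hYe _ j).1) fun j => (hYe _ j).2
  · intro i hi j
    rw [scaledLaw, dif_pos hi, scaledLaw, dif_pos hi, integral_inner_map_const_smul (hX _) (hX0 _ _),
      integral_inner_map_const_smul (hY _) (hY0 _ _)]
  · intro i hi j k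
    rw [scaledLaw, dif_pos hi, scaledLaw, dif_pos hi, second]
  · intro b ε hε
    rw [← measureReal_preimage_normalizedSum hY hindY,
      ← measureReal_preimage_normalizedSum hY hindY]
    exact gaussian_normalizedSum_anticoncentration hn hk₁ hYG hindY hY0 hYk b hε

/-- The choice of the smoothing parameters. -/
theorem exists_smoothing_parameters {θ K d : ℝ} (hθ : 0 < θ) (hK : 0 < K) (hd : 0 < d) :
    ∃ c N₀ : ℝ, 0 < c ∧ 1 ≤ N₀ ∧ ∀ x L : ℝ, 0 < x → 1 ≤ L → N₀ * L ^ 7 ≤ x →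
      ∃ φ : ℝ, 0 < φ ∧ 1 / φ = c * (x ^ (-(1 / 6) : ℝ) * L ^ (2 / 3 : ℝ)) ∧
        φ * L * (√x)⁻¹ ≤ 1 ∧
        x * (K * (1 / L * (φ * L) ^ 3 * (24 / θ ^ 3 * (√x)⁻¹ ^ 3))) ≤ 1 / 8 ∧
        32 / θ ^ 2 * Real.exp (-(θ / (2 * (φ * L * (√x)⁻¹)))) ≤
          1 / 2 * Real.exp (-((d + 2) * L)) := by
  -- This solves `K * (24 / θ ^ 3) * c₀ = 1 / 8`, the smallness needed to absorb the discrepancy.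
  set c₀ := θ ^ 3 / (192 * K) with hc₀
  have hc₀0 : 0 < c₀ := by positivity
  -- The first summand yields the exponent `(d + 2 + 64 / θ ^ 2) * L` in the tail, its part `64 / θ
  -- ^ 2` being there to beat the prefactor `32 / θ ^ 2`. The `+ 1` gives `H ≥ 1`, hence `φ * L ≤
  -- √x`.
  set H := 2 * (d + 2 + 64 / θ ^ 2) / θ + 1 with hH
  have hH1 : 1 ≤ H := by rw [hH]; exact le_add_of_nonneg_left (by positivity)
  refine ⟨(c₀ ^ (1 / 3 : ℝ))⁻¹, c₀ * H ^ 3 + 1, by positivity,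
    le_add_of_nonneg_left (by positivity), fun x L hx hL hxL => ?_⟩
  have hL0 : 0 < L := by linarith
  set φ := c₀ ^ (1 / 3 : ℝ) * (x ^ (1 / 6 : ℝ) * L ^ (-(2 / 3) : ℝ)) with hφ
  have hφ0 : 0 < φ := by positivity
  have hφ3 : φ ^ 3 * L ^ 2 = c₀ * √x := by
    rw [hφ, mul_pow, mul_pow, ← Real.rpow_natCast, ← Real.rpow_natCast, ← Real.rpow_natCast,
      ← Real.rpow_mul hc₀0.le, ← Real.rpow_mul hx.le, ← Real.rpow_mul hL0.le, Real.sqrt_eq_rpow,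
      ← Real.rpow_natCast L, mul_assoc, mul_assoc, ← Real.rpow_add hL0]
    norm_num
  have hsx : 0 < √x := Real.sqrt_pos.2 hx
  have hsx2 : √x ^ 2 = x := Real.sq_sqrt hx.le
  -- After cubing this reads `c₀ * H ^ 3 * L ^ 4 ≤ x`, so `L ^ 4` would do in place of `L ^ 7`.
  have hkey : φ * L * (√x)⁻¹ * (H * L) ≤ 1 := by
    have h1 : (φ * L * H * L) ^ 3 ≤ √x ^ 3 := by
      have e1 : (φ * L * H * L) ^ 3 = φ ^ 3 * L ^ 2 * (H ^ 3 * L ^ 4) := by ring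
      rw [e1, hφ3]
      have h2 : c₀ * (H ^ 3 * L ^ 4) ≤ x := by
        have h3 : L ^ 4 ≤ L ^ 7 := pow_le_pow_right₀ hL (by norm_num)
        calc c₀ * (H ^ 3 * L ^ 4) ≤ c₀ * (H ^ 3 * L ^ 7) := by gcongr
          _ ≤ (c₀ * H ^ 3 + 1) * L ^ 7 := by nlinarith [pow_pos hL0 7]
          _ ≤ x := hxL
      calc c₀ * √x * (H ^ 3 * L ^ 4) = √x * (c₀ * (H ^ 3 * L ^ 4)) := by ring
        _ ≤ √x * x := by gcongr
        _ = √x ^ 3 := by rw [← hsx2]; simp only [Real.sqrt_sq hsx.le]; ring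
    have h2 := le_of_pow_le_pow_left₀ (by norm_num) hsx.le h1
    calc φ * L * (√x)⁻¹ * (H * L) = (φ * L * H * L) / √x := by ring
      _ ≤ 1 := by rw [div_le_one hsx]; exact h2
  have hHL : 1 ≤ H * L := by nlinarith
  have hr0 : 0 < φ * L * (√x)⁻¹ := by positivity
  refine ⟨φ, hφ0, ?_, ?_, ?_, ?_⟩
  · rw [hφ, one_div, mul_inv, mul_inv, Real.rpow_neg hx.le, Real.rpow_neg hL0.le, inv_inv]
  · nlinarith
  · have e : x * (K * (1 / L * (φ * L) ^ 3 * (24 / θ ^ 3 * (√x)⁻¹ ^ 3))) =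
        K * (24 / θ ^ 3) * (φ ^ 3 * L ^ 2) * (x * (√x)⁻¹ ^ 3) := by
      field_simp
    have e2 : √x * (x * (√x)⁻¹ ^ 3) = 1 := by
      nth_rewrite 2 [← hsx2]; field_simp
    rw [e, hφ3]
    calc K * (24 / θ ^ 3) * (c₀ * √x) * (x * (√x)⁻¹ ^ 3)
        = K * (24 / θ ^ 3) * c₀ * (√x * (x * (√x)⁻¹ ^ 3)) := by ring
      _ = K * (24 / θ ^ 3) * c₀ := by rw [e2, mul_one]
      _ ≤ 1 / 8 := by rw [hc₀]; field_simp; norm_num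
  · have h1 : H * L ≤ 1 / (φ * L * (√x)⁻¹) := by
      rw [le_div_iff₀ hr0]; linarith
    have h2 : (d + 2 + 64 / θ ^ 2) * L ≤ θ / (2 * (φ * L * (√x)⁻¹)) := by
      calc (d + 2 + 64 / θ ^ 2) * L ≤ θ / 2 * (H * L) := by
            rw [hH]
            have : θ / 2 * ((2 * (d + 2 + 64 / θ ^ 2) / θ + 1) * L) =
                (d + 2 + 64 / θ ^ 2) * L + θ / 2 * L := by field_simp
            rw [this]
            exact le_add_of_nonneg_right (by positivity)
        _ ≤ θ / 2 * (1 / (φ * L * (√x)⁻¹)) := by gcongr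
        _ = _ := by field_simp
    have h3 : Real.exp (-(64 / θ ^ 2 * L)) ≤ θ ^ 2 / 64 := by
      have h4 : 64 / θ ^ 2 ≤ Real.exp (64 / θ ^ 2 * L) := by
        have h5 := Real.add_one_le_exp (64 / θ ^ 2 * L)
        have h6 : 64 / θ ^ 2 * 1 ≤ 64 / θ ^ 2 * L := by gcongr
        linarith
      rw [Real.exp_neg, inv_le_comm₀ (Real.exp_pos _) (by positivity), inv_div]
      exact h4
    calc _ ≤ 32 / θ ^ 2 * Real.exp (-((d + 2 + 64 / θ ^ 2) * L)) := by gcongr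
      _ = 32 / θ ^ 2 * (Real.exp (-(64 / θ ^ 2 * L)) * Real.exp (-((d + 2) * L))) := by
          rw [← Real.exp_add]; congr 2; ring
      _ ≤ 32 / θ ^ 2 * (θ ^ 2 / 64 * Real.exp (-((d + 2) * L))) := by gcongr
      _ = _ := by field_simp; norm_num

end PolyhedronCLT

/-! ### Elementary comparisons with the rate. -/

section Rates

theorem one_le_log_natCast_mul {n p : ℕ} (hn : 4 ≤ n) (hp : 3 ≤ p) :
    1 ≤ Real.log ((p : ℝ) * (n : ℝ)) := by
  have h1 : (4 : ℝ) ≤ n := by exact_mod_cast hn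
  have h2 : (3 : ℝ) ≤ p := by exact_mod_cast hp
  rw [Real.le_log_iff_exp_le (by positivity)]
  nlinarith [Real.exp_one_lt_d9]

theorem inv_le_rate {x L : ℝ} (hx : 1 ≤ x) (hL : 1 ≤ L) :
    x⁻¹ ≤ x ^ (-(1 / 6) : ℝ) * L ^ (7 / 6 : ℝ) := by
  have h1 : x⁻¹ ≤ x ^ (-(1 / 6) : ℝ) := by
    rw [← Real.rpow_neg_one]
    exact Real.rpow_le_rpow_of_exponent_le hx (by norm_num)
  have h2 : 1 ≤ L ^ (7 / 6 : ℝ) := Real.one_le_rpow hL (by norm_num)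
  have h3 : 0 ≤ x ^ (-(1 / 6) : ℝ) := by positivity
  nlinarith

theorem sqrt_mul_inv_le_rate {x L : ℝ} (hx : 1 ≤ x) (hL : 1 ≤ L) :
    √L * x⁻¹ ≤ x ^ (-(1 / 6) : ℝ) * L ^ (7 / 6 : ℝ) := by
  have h1 : x⁻¹ ≤ x ^ (-(1 / 6) : ℝ) := by
    rw [← Real.rpow_neg_one]
    exact Real.rpow_le_rpow_of_exponent_le hx (by norm_num)
  have h2 : √L ≤ L ^ (7 / 6 : ℝ) := by
    rw [Real.sqrt_eq_rpow]
    exact Real.rpow_le_rpow_of_exponent_le hL (by norm_num)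
  rw [mul_comm]
  gcongr

/-- In this range of `n` the target bound is trivial, a difference of probabilities being at most
one. -/
theorem one_le_rate_of_lt {x L N₀ : ℝ} (hx : 1 ≤ x) (hL : 1 ≤ L) (hN₀ : 1 ≤ N₀)
    (h : x ≤ N₀ * L ^ 7) :
    1 ≤ N₀ ^ (1 / 6 : ℝ) * (x ^ (-(1 / 6) : ℝ) * L ^ (7 / 6 : ℝ)) := by
  have hx0 : 0 < x := by linarith
  have hL0 : 0 < L := by linarith
  have h1 : x ^ (1 / 6 : ℝ) ≤ N₀ ^ (1 / 6 : ℝ) * L ^ (7 / 6 : ℝ) := by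
    calc x ^ (1 / 6 : ℝ) ≤ (N₀ * L ^ 7) ^ (1 / 6 : ℝ) := by gcongr
      _ = _ := by
        rw [Real.mul_rpow (by positivity) (by positivity), ← Real.rpow_natCast L,
          ← Real.rpow_mul hL0.le]
        norm_num
  calc 1 = x ^ (1 / 6 : ℝ) * x ^ (-(1 / 6) : ℝ) := by rw [← Real.rpow_add hx0]; norm_num
    _ ≤ N₀ ^ (1 / 6 : ℝ) * L ^ (7 / 6 : ℝ) * x ^ (-(1 / 6) : ℝ) := by gcongr
    _ = _ := by ring

theorem sqrt_two_mul_log_add_two_le {y d L : ℝ} (hd : 0 ≤ d) (hL : 1 ≤ L)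
    (hy : Real.log y ≤ d * L) : √(2 * Real.log y) + 2 ≤ (√(2 * d) + 2) * √L := by
  have h1 : √(2 * Real.log y) ≤ √(2 * d) * √L := by
    rw [← Real.sqrt_mul (by positivity)]
    exact Real.sqrt_le_sqrt (by linarith)
  have h2 : 1 ≤ √L := Real.one_le_sqrt.2 hL
  linarith

end Rates

/-! ### Assembly of the bound. -/

section Main

theorem exists_clt_polyhedron_rate {θ d k₁ : ℝ} (hθ : 0 < θ) (hd : 0 < d) (hk₁ : 0 < k₁) :
    ∃ C : ℝ, 0 < C ∧ ∀ (n p : ℕ), 4 ≤ n → 3 ≤ p →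
      ∀ (Ω Ω' : Type*) [MeasurableSpace Ω] [MeasurableSpace Ω']
        (P : Measure Ω) [IsProbabilityMeasure P] (P' : Measure Ω') [IsProbabilityMeasure P']
        (X : Fin n → Ω → EuclideanSpace ℝ (Fin p)) (Y : Fin n → Ω' → EuclideanSpace ℝ (Fin p)),
        (∀ i, AEMeasurable (X i) P) → iIndepFun X P → (∀ i x, ∫ ω, ⟪x, X i ω⟫ ∂P = 0) →
        (∀ i, HasGaussianLaw (Y i) P') → iIndepFun Y P' → (∀ i x, ∫ ω, ⟪x, Y i ω⟫ ∂P' = 0) →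
        (∀ i x y, ∫ ω, ⟪x, X i ω⟫ * ⟪y, X i ω⟫ ∂P = ∫ ω, ⟪x, Y i ω⟫ * ⟪y, Y i ω⟫ ∂P') →
        ∀ (m : ℕ) [NeZero m], (m : ℝ) ≤ ((p : ℝ) * n) ^ d →
        ∀ (v : Fin m → EuclideanSpace ℝ (Fin p)),
        (∀ i j, k₁ ≤ ∫ ω, ⟪v j, Y i ω⟫ ^ 2 ∂P') →
        (∀ i j, Integrable (fun ω => Real.exp (θ * |⟪v j, X i ω⟫|)) P ∧
          ∫ ω, Real.exp (θ * |⟪v j, X i ω⟫|) ∂P ≤ 4) →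
        (∀ i j, Integrable (fun ω => Real.exp (θ * |⟪v j, Y i ω⟫|)) P' ∧
          ∫ ω, Real.exp (θ * |⟪v j, Y i ω⟫|) ∂P' ≤ 4) →
        ∀ b : Fin m → ℝ,
          |P.real (normalizedSum X ⁻¹' polyhedron v b) -
            P'.real (normalizedSum Y ⁻¹' polyhedron v b)| ≤
            C * ((n : ℝ) ^ (-(1 / 6) : ℝ) * Real.log ((p : ℝ) * n) ^ (7 / 6 : ℝ)) ∧
          ∀ ε : ℝ, 0 ≤ ε → P'.real (normalizedSum Y ⁻¹' polyhedron v fun j => b j + ε) -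
            P'.real (normalizedSum Y ⁻¹' polyhedron v b) ≤
              C * √(Real.log ((p : ℝ) * n)) * ε := by
  obtain ⟨g, g₁, g₂, g₃, B, hg⟩ := exists_isSmoothStep
  have hB : 0 < B := zero_lt_one.trans_le hg.one_le
  set K := 26 * Real.exp 2 * B with hKdef
  have hK : 0 < K := by positivity
  obtain ⟨c, N₀, hc, hN₀, hpar⟩ := exists_smoothing_parameters hθ hK hd
  set A := Real.exp 2 * (√(2 * d) + 2) / √k₁ with hA
  have hA0 : 0 < A := by positivity
  -- The summands pay in turn for smoothing, for the tails, for the range `n ≤ N₀ * L ^ 7`, and for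
  -- the Gaussian shell estimate.
  refine ⟨A * ((5 + 3 * d) * c) + K + N₀ ^ (1 / 6 : ℝ) + A, by positivity, ?_⟩
  intro n p hn hp Ω Ω' _ _ P _ P' _ X Y hX hindX hX0 hYG hindY hY0 hXY m _ hm v hYk hXe hYe b
  have hn0 : 0 < n := by omega
  have hnR : (1 : ℝ) ≤ n := by exact_mod_cast hn0
  have hpR : (1 : ℝ) ≤ p := by exact_mod_cast (by omega : 1 ≤ p)
  have hm0 : (0 : ℝ) < m := by exact_mod_cast NeZero.pos m
  set L := Real.log ((p : ℝ) * n) with hLdef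
  have hL : 1 ≤ L := one_le_log_natCast_mul hn hp
  have hL0 : 0 < L := by linarith
  have hexpL : Real.exp L = (p : ℝ) * n := Real.exp_log (by positivity)
  have hnL : (n : ℝ) ≤ Real.exp L := by rw [hexpL]; nlinarith
  have hmL : Real.log m ≤ d * L := by
    calc Real.log m ≤ Real.log (((p : ℝ) * n) ^ d) := Real.log_le_log hm0 hm
      _ = d * L := Real.log_rpow (by positivity) d
  have hΛ : Real.exp 2 * (√(2 * Real.log m) + 2) / √k₁ ≤ A * √L := by
    rw [hA, div_mul_eq_mul_div, mul_assoc]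
    gcongr
    exact sqrt_two_mul_log_add_two_le hd.le hL hmL
  set R := (n : ℝ) ^ (-(1 / 6) : ℝ) * L ^ (7 / 6 : ℝ) with hR
  have hR0 : 0 ≤ R := by positivity
  refine ⟨?_, fun ε hε => ?_⟩
  · rcases le_total (n : ℝ) (N₀ * L ^ 7) with hsm | hlg
    · have h1 := one_le_rate_of_lt hnR hL hN₀ hsm
      have h2 : |P.real (normalizedSum X ⁻¹' polyhedron v b) -
          P'.real (normalizedSum Y ⁻¹' polyhedron v b)| ≤ 1 := by
        have := measureReal_le_one (μ := P) (s := normalizedSum X ⁻¹' polyhedron v b)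
        have := measureReal_le_one (μ := P') (s := normalizedSum Y ⁻¹' polyhedron v b)
        have := measureReal_nonneg (μ := P) (s := normalizedSum X ⁻¹' polyhedron v b)
        have := measureReal_nonneg (μ := P') (s := normalizedSum Y ⁻¹' polyhedron v b)
        rw [abs_le]; constructor <;> linarith
      refine (h2.trans h1).trans (mul_le_mul_of_nonneg_right ?_ hR0)
      have : 0 ≤ A * ((5 + 3 * d) * c) := by positivity
      linarith
    · obtain ⟨φ, hφ0, hφ, hβn, hsmall, hT⟩ := hpar n L (by linarith) hL hlg
      set T := 32 / θ ^ 2 * Real.exp (-(θ / (2 * (φ * L * (√(n : ℝ))⁻¹)))) with hTdef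
      -- Of the exponent `(d + 2) * L`, the part `d * L` pays for `m`; of the remaining `2 * L`, one
      -- `L` pays for the `n` steps and the other leaves `1 / n`.
      have hmT : m * T ≤ 1 / 2 * Real.exp (-(2 * L)) := by
        have h1 : (m : ℝ) ≤ Real.exp (d * L) := by
          rw [← Real.log_le_iff_le_exp hm0]; exact hmL
        calc m * T ≤ Real.exp (d * L) * (1 / 2 * Real.exp (-((d + 2) * L))) := by gcongr
          _ = 1 / 2 * (Real.exp (d * L) * Real.exp (-((d + 2) * L))) := by ring
          _ = _ := by rw [← Real.exp_add]; congr 2; ring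
      have hmT' : m * T ≤ 1 / 2 := by
        have : Real.exp (-(2 * L)) ≤ 1 := Real.exp_le_one_iff.2 (by linarith)
        linarith
      have hnmT : n * (m * T) ≤ 1 / 2 * (n : ℝ)⁻¹ := by
        calc n * (m * T) ≤ Real.exp L * (1 / 2 * Real.exp (-(2 * L))) := by gcongr
          _ = 1 / 2 * (Real.exp L * Real.exp (-(2 * L))) := by ring
          _ = 1 / 2 * (Real.exp L)⁻¹ := by
            rw [← Real.exp_add, ← Real.exp_neg]; congr 2; ring
          _ ≤ 1 / 2 * (n : ℝ)⁻¹ := by gcongr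
      have key := clt_polyhedron_of_parameters (κ := 1 / L) (β := φ * L) (d := d) (T := T) hn0 hk₁
        hθ hX hindX hX0 hYG hindY hY0 hXY hYk hXe hYe hg (by positivity)
        (by rw [div_le_one hL0]; exact hL) (by positivity)
        (by rw [one_div, inv_mul_le_iff₀ hL0]; linarith) hβn rfl hmT' hsmall b
      refine key.trans ?_
      have e1 : (5 + 3 * d) / (1 / L * (φ * L)) =
          (5 + 3 * d) * c * ((n : ℝ) ^ (-(1 / 6) : ℝ) * L ^ (2 / 3 : ℝ)) := by
        rw [show 1 / L * (φ * L) = φ by field_simp, div_eq_mul_one_div, hφ]; ring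
      have e2 : √L * L ^ (2 / 3 : ℝ) = L ^ (7 / 6 : ℝ) := by
        rw [Real.sqrt_eq_rpow, ← Real.rpow_add hL0]; norm_num
      have t1 : Real.exp 2 * (√(2 * Real.log m) + 2) / √k₁ * ((5 + 3 * d) / (1 / L * (φ * L))) ≤
          A * ((5 + 3 * d) * c) * R := by
        rw [e1]
        calc _ ≤ A * √L * ((5 + 3 * d) * c * ((n : ℝ) ^ (-(1 / 6) : ℝ) * L ^ (2 / 3 : ℝ))) := by
              gcongr
          _ = A * ((5 + 3 * d) * c) * ((n : ℝ) ^ (-(1 / 6) : ℝ) * (√L * L ^ (2 / 3 : ℝ))) := by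
              ring
          _ = _ := by rw [e2]
      have t2 : 2 * (n * (K * (m * T))) ≤ K * R := by
        calc 2 * (n * (K * (m * T))) = 2 * K * (n * (m * T)) := by ring
          _ ≤ 2 * K * (1 / 2 * (n : ℝ)⁻¹) := by gcongr
          _ = K * (n : ℝ)⁻¹ := by ring
          _ ≤ K * R := by gcongr; exact inv_le_rate hnR hL
      have t3 : 0 ≤ (N₀ ^ (1 / 6 : ℝ) + A) * R := by positivity
      linarith
  · refine (gaussian_normalizedSum_anticoncentration hn0 hk₁ hYG hindY hY0 hYk b hε).trans ?_
    refine mul_le_mul_of_nonneg_right (hΛ.trans (mul_le_mul_of_nonneg_right ?_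
      (Real.sqrt_nonneg L))) hε
    have : 0 ≤ A * ((5 + 3 * d) * c) := by positivity
    have : 0 ≤ N₀ ^ (1 / 6 : ℝ) := by positivity
    linarith

theorem mainTheorem5 (a d k₁ k₂ : ℝ) (ha : 0 ≤ a) (hd : 0 < d) (hk₁ : 0 < k₁) (hk : k₁ ≤ k₂) :
    ∃ C : ℝ, 0 < C ∧ ∀ (n p : ℕ), 4 ≤ n → 3 ≤ p →
      ∀ (Ω Ω' : Type*) [MeasurableSpace Ω] [MeasurableSpace Ω']
        (P : Measure Ω) [IsProbabilityMeasure P] (P' : Measure Ω') [IsProbabilityMeasure P']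
        (X : Fin n → Ω → EuclideanSpace ℝ (Fin p)) (Y : Fin n → Ω' → EuclideanSpace ℝ (Fin p)),
        (∀ i, Measurable (X i)) →
        iIndepFun X P →
        (∀ i, MemLp (X i) 2 P) →
        (∀ i, ∫ ω, X i ω ∂P = 0) →
        (∀ i, IsLogConcaveMeasure (P.map (X i))) →
        (∀ i, ∀ t : ℝ,
          Module.End.HasEigenvalue (Matrix.toLin' (secondMomentMatrix (X i) P)) t →
            k₁ ≤ t ∧ t ≤ k₂) →
        iIndepFun Y P' →
        (∀ i, HasLaw (Y i) (multivariateGaussian 0 (secondMomentMatrix (X i) P)) P') →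
        rhoDist P (normalizedSum X) P' (normalizedSum Y) (simpleConvexSets n p a d) ≤
          C * (n : ℝ) ^ (-(1 / 6) : ℝ) * Real.log ((p : ℝ) * (n : ℝ)) ^ (7 / 6 : ℝ) := by
  have hk₂ : 0 < k₂ := hk₁.trans_le hk
  obtain ⟨C, hC, hmain⟩ := exists_clt_polyhedron_rate (θ := 1 / (16 * √k₂)) (by positivity) hd hk₁
  -- `C` comes from the polyhedra and `C * a` from the Gaussian mass of the shell of width `a / n`.
  refine ⟨C * (1 + a), by positivity, ?_⟩
  intro n p hn hp Ω Ω' _ _ P _ P' _ X Y hXm hindX hX2 hX0 hlc heig hindY hYlaw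
  have hnR : (1 : ℝ) ≤ n := by exact_mod_cast (by omega : 1 ≤ n)
  have hL := one_le_log_natCast_mul hn hp
  set L := Real.log ((p : ℝ) * n) with hLdef
  have hXa : ∀ i, AEMeasurable (X i) P := fun i => (hXm i).aemeasurable
  have hYG : ∀ i, HasGaussianLaw (Y i) P' := fun i => (hYlaw i).hasGaussianLaw
  have hYa : ∀ i, AEMeasurable (Y i) P' := fun i => (hYG i).aemeasurable
  have hX0' : ∀ i x, ∫ ω, ⟪x, X i ω⟫ ∂P = 0 := fun i x => by
    rw [integral_inner ((hX2 i).integrable one_le_two), hX0, inner_zero_right]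
  have hYint : ∀ i (f : EuclideanSpace ℝ (Fin p) → ℝ), Continuous f →
      ∫ ω, f (Y i ω) ∂P' = ∫ y, f y ∂(multivariateGaussian 0 (secondMomentMatrix (X i) P)) :=
    fun i f hf => by
      rw [← (hYlaw i).map_eq, integral_map (hYa i) hf.aestronglyMeasurable]
  have hY0 : ∀ i x, ∫ ω, ⟪x, Y i ω⟫ ∂P' = 0 := fun i x => by
    rw [hYint i (fun y => ⟪x, y⟫) (by fun_prop), integral_inner_multivariateGaussian]
  have hXY : ∀ i x y, ∫ ω, ⟪x, X i ω⟫ * ⟪y, X i ω⟫ ∂P = ∫ ω, ⟪x, Y i ω⟫ * ⟪y, Y i ω⟫ ∂P' :=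
    fun i x y => by
      rw [hYint i (fun z => ⟪x, z⟫ * ⟪y, z⟫) (by fun_prop),
        integral_inner_mul_inner_multivariateGaussian (posSemidef_secondMomentMatrix (hX2 i)),
        dotProduct_secondMomentMatrix_mulVec (hX2 i)]
  have hXk : ∀ i x, ‖x‖ = 1 → ∫ ω, ⟪x, X i ω⟫ ^ 2 ∂P ∈ Set.Icc k₁ k₂ := fun i x hx =>
    integral_inner_sq_mem_Icc (hX2 i) (heig i) hx
  have hYk : ∀ i x, ‖x‖ = 1 → k₁ ≤ ∫ ω, ⟪x, Y i ω⟫ ^ 2 ∂P' := fun i x hx => by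
    have := (hXk i x hx).1
    simp_rw [pow_two, hXY] at this
    simp_rw [pow_two]
    exact this
  have hXe : ∀ i x, ‖x‖ = 1 → Integrable (fun ω => Real.exp (1 / (16 * √k₂) * |⟪x, X i ω⟫|)) P ∧
      ∫ ω, Real.exp (1 / (16 * √k₂) * |⟪x, X i ω⟫|) ∂P ≤ 4 := fun i x hx => by
    have := Measure.isProbabilityMeasure_map (hXa i)
    have h1 : MemLp (fun y => ⟪x, y⟫) 2 (P.map (X i)) := by
      rw [memLp_map_measure_iff (Continuous.aestronglyMeasurable (by fun_prop)) (hXa i)]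
      exact (hX2 i).continuousLinearMap_comp (innerSL ℝ x)
    have h2 : ∫ y, ⟪x, y⟫ ^ 2 ∂(P.map (X i)) ≤ k₂ := by
      rw [integral_map (hXa i) (Continuous.aestronglyMeasurable (by fun_prop))]
      exact (hXk i x hx).2
    have h3 := (hlc i).integrable_exp h1 hk₂ h2
    rwa [integrable_map_measure (Continuous.aestronglyMeasurable (by fun_prop)) (hXa i),
      integral_map (hXa i) (Continuous.aestronglyMeasurable (by fun_prop))] at h3
  have hYe : ∀ i x, ‖x‖ = 1 → Integrable (fun ω => Real.exp (1 / (16 * √k₂) * |⟪x, Y i ω⟫|)) P' ∧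
      ∫ ω, Real.exp (1 / (16 * √k₂) * |⟪x, Y i ω⟫|) ∂P' ≤ 4 := fun i x hx => by
    have h3 := integrable_exp_abs_inner_multivariateGaussian
      (posSemidef_secondMomentMatrix (hX2 i)) x hk₂ (by
        rw [dotProduct_secondMomentMatrix_mulVec (hX2 i)]
        have := (hXk i x hx).2
        simp_rw [pow_two] at this
        exact this)
    rw [← (hYlaw i).map_eq] at h3
    rwa [integrable_map_measure (Continuous.aestronglyMeasurable (by fun_prop)) (hYa i),
      integral_map (hYa i) (Continuous.aestronglyMeasurable (by fun_prop))] at h3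
  set R := (n : ℝ) ^ (-(1 / 6) : ℝ) * L ^ (7 / 6 : ℝ) with hR
  have hR0 : 0 ≤ R := by positivity
  have hfin : C * (1 + a) * (n : ℝ) ^ (-(1 / 6) : ℝ) * L ^ (7 / 6 : ℝ) = C * R + C * a * R := by
    rw [hR]; ring
  rw [hfin]
  refine Real.sSup_le ?_ (by positivity)
  rintro _ ⟨S, ⟨-, -, m, hm, happ⟩, rfl⟩
  dsimp only
  rcases happ.exists_polyhedron with rfl | rfl | ⟨k, _, v, b, hkm, hv, hsub, hsup⟩
  · simp only [Set.preimage_empty, measureReal_empty, sub_self, abs_zero]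
    positivity
  · simp only [Set.preimage_univ, probReal_univ, sub_self, abs_zero]
    positivity
  have hkR : (k : ℝ) ≤ ((p : ℝ) * n) ^ d := le_trans (by exact_mod_cast hkm) hm
  have key := hmain n p hn hp Ω Ω' P P' X Y hXa hindX hX0' hYG hindY hY0 hXY k hkR v
    (fun i j => hYk i _ (hv j)) (fun i j => hXe i _ (hv j)) fun i j => hYe i _ (hv j)
  have hε : 0 ≤ a / n := by positivity
  -- The set lies between the polyhedra with offsets `b` and `b + a / n`. The comparison is used on
  -- both, and anticoncentration is needed for the Gaussian sum only.
  have k1 := abs_le.1 (key b).1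
  have k2 := abs_le.1 (key fun j => b j + a / n).1
  have k3 := (key b).2 (a / n) hε
  have k4 : C * √L * (a / n) ≤ C * a * R := by
    calc C * √L * (a / n) = C * a * (√L * (n : ℝ)⁻¹) := by ring
      _ ≤ C * a * R := by gcongr; exact sqrt_mul_inv_le_rate hnR hL
  have x1 : P.real (normalizedSum X ⁻¹' polyhedron v b) ≤ P.real (normalizedSum X ⁻¹' S) :=
    measureReal_mono (Set.preimage_mono hsub)
  have x2 : P.real (normalizedSum X ⁻¹' S) ≤
      P.real (normalizedSum X ⁻¹' polyhedron v fun j => b j + a / n) :=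
    measureReal_mono (Set.preimage_mono hsup)
  have y1 : P'.real (normalizedSum Y ⁻¹' polyhedron v b) ≤ P'.real (normalizedSum Y ⁻¹' S) :=
    measureReal_mono (Set.preimage_mono hsub)
  have y2 : P'.real (normalizedSum Y ⁻¹' S) ≤
      P'.real (normalizedSum Y ⁻¹' polyhedron v fun j => b j + a / n) :=
    measureReal_mono (Set.preimage_mono hsup)
  rw [abs_le]
  constructor <;> linarith [k1.1, k1.2, k2.1, k2.2]

end Main
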